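/- Let $n\ge 2$, let $U\subseteq\mathbb R^n$ be a nonempty connected open set with coordinates $x^1,\dots,x^n$, and let $g_{ij}$ be a smooth metric on $U$ of arbitrary signature, with Christoffel symbols $\Gamma^k_{ij}$ and Laplace operator $\Delta u=g^{ij}u_{,ij}-g^{ij}\Gamma^k_{ij}u_{,k}$. Let $R$ be the Ricci scalar of $g$ in the sign convention in which it is negative on round spheres, i.e. $R=-S$ with $S=g^{ij}(\partial_k\Gamma^k_{ij}-\partial_j\Gamma^k_{ik}+\Gamma^k_{kl}\Gamma^l_{ij}-\Gamma^k_{jl}\Gamma^l_{ik})$. A conformal Killing vector (CKV) with factor $\psi$ is a smooth vector field $\xi$ on $U$ with $L_\xi g=2\psi g$ for a smooth function $\psi$; it is proper if none of $\psi=0$, $\psi_{,i}=0$, $\psi_{;ij}=0$ holds identically on $U$. A Lie point symmetry of $\Delta u=Vu$ is a smooth vector field $X=\xi^i(x,u)\partial_i+\eta(x,u)\partial_u$ on $U\times\mathbb R$ whose second prolongation annihilates $\Delta u-Vu$ at all second-order jets over $U$ at which $\Delta u-Vu=0$. For every smooth solution $b$ of $\Delta b=Vb$ on $U$ the field $b(x)\partial_u$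 is called a trivial symmetry; a Lie point symmetry is called linear if its $\partial_u$-component has the form $a(x)u$. (1) Let $V=-\frac{n-2}{4(n-1)}R+\bar V$ with $\bar V$ smooth. For every CKV $\xi$ with factor $\psi$, $$\xi^kV_{,k}+2\psi V-\tfrac{2-n}{2}\Delta\psi=\xi^k\bar V_{,k}+2\psi\bar V ,$$ so that the Klein–Gordon symmetry condition (vanishing of the left side) reduces to $\xi^k\bar V_{,k}+2\psi\bar V=0$. The Lie point symmetries of $\Delta u=Vu$ are exactly the fields $X=\xi^i\partial_i+\left(\frac{2-n}{2}\psi u+a_0u+b\right)\partial_u$ where $\xi$ is a CKV with factor $\psi$ such that $\xi^k\bar V_{,k}+2\psi\bar V=0$ on $U$, $a_0\in\mathbb R$, and $b$ is a smooth solution of $\Delta b=Vb$. Every Lie point symmetry is the sum of a linear and a trivial one (and all such sums are Lie point symmetries); the linear ones form a Lie algebra, and the Lie bracket of a Lie point symmetry with a trivial one is trivial. (2) Every linear Lie point symmetry of the Laplace equation $\Delta u=0$ is a linear Lie point symmetry of the conformal Laplace equation $\Delta u+\frac{n-2}{4(n-1)}Ru=0$; that is, up to the trivial symmetries $b\,\partial_u$,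 the symmetry algebra of the former is contained in that of the latter. The two algebras of linear symmetries coincide if $U$ has no proper CKVs, and also if the factors of all CKVs of $U$ are solutions of the Laplace equation. (3) Let $n\ge3$. Suppose that there are coordinates $y$ on $U$ (a smooth injective map $y:U\to\mathbb R^n$ with nowhere vanishing Jacobian) in which $g=N^2\sum_a\varepsilon_a(dy^a)^2$, with $\varepsilon_a=\pm1$ and $N$ smooth and nowhere zero. Then the conformal Laplace equation on $U$ admits a symmetry algebra of dimension $\frac12(n+1)(n+2)+2$, the infinite family $b\,\partial_u$ being counted as one generator: the Lie algebra of linear symmetries has dimension $\frac12(n+1)(n+2)+1$, nonzero solutions $b$ exist on $U$, and for each of them the linear symmetries together with $b\,\partial_u$ span a space of dimension $\frac12(n+1)(n+2)+2$. If such coordinates exist only locally, around each point of $U$ (that is, $g$ is conformally flat), then every point of $U$ has arbitrarily small connected open neighbourhoods on which the same conclusion holds. -/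

import Mathlib

open scoped ContDiff
open TopologicalSpace

noncomputable section

namespace ConfKG

/-! Coordinates `x = (x^1,…,x^n)` range over an open set `U` of `Fin n → ℝ`. Tensors are given by
their components, which are functions on the whole of `Fin n → ℝ` of which only the values on `U`
matter. -/

/-- The partial derivative `∂f/∂x^i`. -/
def pd {n : ℕ} (i : Fin n) (f : (Fin n → ℝ) → ℝ) (x : Fin n → ℝ) : ℝ :=
  fderiv ℝ f x (Pi.single i 1)

/-- `g` is a smooth metric on `U` (symmetric, nondegenerate, of arbitrary signature). -/
structure IsMetricOn {n : ℕ} (g : (Fin n → ℝ) → Matrix (Fin n) (Fin n) ℝ)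
    (U : Opens (Fin n → ℝ)) : Prop where
  smooth : ∀ i j, ContDiffOn ℝ ∞ (fun x => g x i j) U
  symm : ∀ x ∈ U, ∀ i j, g x i j = g x j i
  nondegenerate : ∀ x ∈ U, (g x).det ≠ 0

section Geometry

variable {n : ℕ} (g : (Fin n → ℝ) → Matrix (Fin n) (Fin n) ℝ)

/-- The Christoffel symbols `Γ^k_{ij} = ½ g^{kl} (∂_i g_{lj} + ∂_j g_{li} - ∂_l g_{ij})`. -/
def christoffel (k i j : Fin n) (x : Fin n → ℝ) : ℝ :=
  (1 / 2) * ∑ l, (g x)⁻¹ k l *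
    (pd i (fun y => g y l j) x + pd j (fun y => g y l i) x - pd l (fun y => g y i j) x)

/-- The contraction `Γ^k = g^{ij} Γ^k_{ij}`. -/
def contractedChristoffel (k : Fin n) (x : Fin n → ℝ) : ℝ :=
  ∑ i, ∑ j, (g x)⁻¹ i j * christoffel g k i j x

/-- The components `f_{;ij}` of the Hessian of a function. -/
def hessian (f : (Fin n → ℝ) → ℝ) (i j : Fin n) (x : Fin n → ℝ) : ℝ :=
  pd j (pd i f) x - ∑ k, christoffel g k i j x * pd k f x

/-- The Laplace operator `Δf = g^{ij} f_{,ij} - Γ^k f_{,k}`. -/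
def laplacian (f : (Fin n → ℝ) → ℝ) (x : Fin n → ℝ) : ℝ :=
  ∑ i, ∑ j, (g x)⁻¹ i j * pd j (pd i f) x - ∑ k, contractedChristoffel g k x * pd k f x

/-- The Ricci tensor in the common sign convention (positive on round spheres),
`Ric_{ij} = ∂_k Γ^k_{ij} - ∂_j Γ^k_{ik} + Γ^k_{kl} Γ^l_{ij} - Γ^k_{jl} Γ^l_{ik}`. -/
def ricci (i j : Fin n) (x : Fin n → ℝ) : ℝ :=
  ∑ k, (pd k (christoffel g k i j) x - pd j (christoffel g k i k) x
    + ∑ l, (christoffel g k k l x * christoffel g l i j x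
      - christoffel g k j l x * christoffel g l i k x))

/-- The scalar curvature `g^{ij} Ric_{ij}` in the common sign convention: positive on round
spheres. -/
def scalarCurvature (x : Fin n → ℝ) : ℝ :=
  ∑ i, ∑ j, (g x)⁻¹ i j * ricci g i j x

/-- The Ricci scalar `R` in the opposite (Eisenhart's) sign convention: negative on round spheres.
With `Δ = g^{ij} ∇_i ∇_j` this is the sign for which `Δu + (n-2)/(4(n-1)) R u = 0` is the
conformally covariant (Yamabe) equation. -/
def ricciScalar (x : Fin n → ℝ) : ℝ := -scalarCurvature g x

/-- The potential `-(n-2)/(4(n-1)) R` of the conformal Laplace equation. -/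
def conformalPotential (x : Fin n → ℝ) : ℝ :=
  -(((n : ℝ) - 2) / (4 * ((n : ℝ) - 1))) * ricciScalar g x

/-- `ξ` is a conformal Killing vector of `g` on `U` with conformal factor `ψ`:
`L_ξ g_{ij} = 2 ψ g_{ij}`. -/
structure IsCKV (U : Opens (Fin n → ℝ)) (ξ : (Fin n → ℝ) → (Fin n → ℝ))
    (ψ : (Fin n → ℝ) → ℝ) : Prop where
  smooth_field : ContDiffOn ℝ ∞ ξ U
  smooth_factor : ContDiffOn ℝ ∞ ψ U
  lie_deriv : ∀ x ∈ U, ∀ i j,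
    ∑ k, (ξ x k * pd k (fun y => g y i j) x + g x k j * pd i (fun y => ξ y k) x
      + g x i k * pd j (fun y => ξ y k) x) = 2 * ψ x * g x i j

/-- A proper conformal Killing vector: one that is neither Killing (`ψ = 0`), nor homothetic
(`ψ_{,i} = 0`), nor a special conformal Killing vector (`ψ_{;ij} = 0`). -/
def IsProperCKV (U : Opens (Fin n → ℝ)) (ξ : (Fin n → ℝ) → (Fin n → ℝ))
    (ψ : (Fin n → ℝ) → ℝ) : Prop :=
  IsCKV g U ξ ψ ∧ ¬ (∀ x ∈ U, ψ x = 0) ∧ ¬ (∀ x ∈ U, ∀ i, pd i ψ x = 0) ∧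
    ¬ (∀ x ∈ U, ∀ i j, hessian g ψ i j x = 0)

/-- `y` are coordinates on `W` in which `g` is `N²` times a constant diagonal metric with
entries `±1`. -/
def HasConformallyFlatCoordinates (W : Opens (Fin n → ℝ)) : Prop :=
  ∃ (y : (Fin n → ℝ) → (Fin n → ℝ)) (N : (Fin n → ℝ) → ℝ) (ε : Fin n → ℝ),
    ContDiffOn ℝ ∞ y W ∧ Set.InjOn y W ∧
    (∀ x ∈ W, (Matrix.of fun a i => pd i (fun z => y z a) x).det ≠ 0) ∧
    ContDiffOn ℝ ∞ N W ∧ (∀ x ∈ W, N x ≠ 0) ∧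
    (∀ a, ε a = 1 ∨ ε a = -1) ∧
    ∀ x ∈ W, ∀ i j,
      g x i j = N x ^ 2 * ∑ a, ε a * pd i (fun z => y z a) x * pd j (fun z => y z a) x

/-- `g` is conformally flat on `U`: around every point there are coordinates in which it is
conformal to a constant metric. -/
def IsConformallyFlat (U : Opens (Fin n → ℝ)) : Prop :=
  ∀ x ∈ U, ∃ W : Opens (Fin n → ℝ), x ∈ W ∧ W ≤ U ∧ HasConformallyFlatCoordinates g W

/-- `b` is a (smooth) solution on `U` of the Klein-Gordon equation `Δb = V b`. -/
def IsSolution (V : (Fin n → ℝ) → ℝ) (U : Opens (Fin n → ℝ)) (b : (Fin n → ℝ) → ℝ) : Prop :=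
  ContDiffOn ℝ ∞ b U ∧ ∀ x ∈ U, laplacian g b x = V x * b x

/-- The left-hand side `ξ^k V_{,k} + 2 ψ V - (2-n)/2 Δψ` of the symmetry condition of the
Klein-Gordon equation `Δu = V u`. -/
def kgSymmetryExpr (V : (Fin n → ℝ) → ℝ) (ξ : (Fin n → ℝ) → (Fin n → ℝ))
    (ψ : (Fin n → ℝ) → ℝ) (x : Fin n → ℝ) : ℝ :=
  ∑ k, ξ x k * pd k V x + 2 * ψ x * V x - (2 - (n : ℝ)) / 2 * laplacian g ψ x

end Geometry

/-! ### Jets, prolongations and Lie point symmetries -/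

/-- The space with coordinates `(x, u)`. -/
abbrev Jet0 (n : ℕ) := (Fin n → ℝ) × ℝ

/-- First jets `((x, u), u_i)`. -/
abbrev Jet1 (n : ℕ) := Jet0 n × (Fin n → ℝ)

/-- Second jets `(((x, u), u_i), u_ij)`; genuine jets have `u_ij = u_ji`. -/
abbrev Jet2 (n : ℕ) := Jet1 n × (Fin n → Fin n → ℝ)

variable {n : ℕ}

/-- The total derivative `D_i F = F_{,i} + u_i F_u` of a function of `(x, u)`. -/
def totalD0 (F : Jet0 n → ℝ) (i : Fin n) (z : Jet1 n) : ℝ :=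
  fderiv ℝ F z.1 (Pi.single i 1, z.2 i)

/-- The total derivative `D_i F = F_{,i} + u_i F_u + u_ij F_{u_j}` of a function of
`(x, u, u_k)`. -/
def totalD1 (F : Jet1 n → ℝ) (i : Fin n) (z : Jet2 n) : ℝ :=
  fderiv ℝ F z.1 ((Pi.single i 1, z.1.2 i), fun j => z.2 i j)

/-- For `X = ξ^i ∂_i + η ∂_u` (that is, `X (x, u) = (ξ, η)`), the coefficient
`η_[i] = D_i η - u_j D_i ξ^j` of the first prolongation. -/
def prolongCoeff1 (X : Jet0 n → Jet0 n) (i : Fin n) (z : Jet1 n) : ℝ :=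
  totalD0 (fun w => (X w).2) i z - ∑ j, z.2 j * totalD0 (fun w => (X w).1 j) i z

/-- The coefficient `η_[ij] = D_j η_[i] - u_ik D_j ξ^k` of the second prolongation. -/
def prolongCoeff2 (X : Jet0 n → Jet0 n) (i j : Fin n) (z : Jet2 n) : ℝ :=
  totalD1 (prolongCoeff1 X i) j z - ∑ k, z.2 i k * totalD0 (fun w => (X w).1 k) j z.1

/-- The second prolongation `X^[2] = X + η_[i] ∂_{u_i} + η_[ij] ∂_{u_ij}`, a vector field on
the second jet space. -/
def prolongation (X : Jet0 n → Jet0 n) (z : Jet2 n) : Jet2 n :=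
  ((X z.1.1, fun i => prolongCoeff1 X i z.1), fun i j => prolongCoeff2 X i j z)

/-- The smooth vector field `X` on `U × ℝ` is (the generator of) a Lie point symmetry of the second
order equation `H (x, u, u_i, u_ij) = 0`: `X^[2] H = 0` at all second jets over `U` with
`H = 0`. -/
def IsLiePointSymmetry (H : Jet2 n → ℝ) (U : Opens (Fin n → ℝ)) (X : Jet0 n → Jet0 n) : Prop :=
  ContDiffOn ℝ ∞ X ((U : Set (Fin n → ℝ)) ×ˢ Set.univ) ∧
  ∀ z : Jet2 n, z.1.1.1 ∈ U → (∀ i j, z.2 i j = z.2 j i) → H z = 0 →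
    fderiv ℝ H z (prolongation X z) = 0

/-- The Klein-Gordon equation `Δu - V u = g^{ij} u_ij - Γ^k u_k - V u = 0` as a function on the
second jet space. -/
def kleinGordon (g : (Fin n → ℝ) → Matrix (Fin n) (Fin n) ℝ) (V : (Fin n → ℝ) → ℝ)
    (z : Jet2 n) : ℝ :=
  ∑ i, ∑ j, (g z.1.1.1)⁻¹ i j * z.2 i j - ∑ k, contractedChristoffel g k z.1.1.1 * z.1.2 k
    - V z.1.1.1 * z.1.1.2

/-! The prolongation is linear in the vector field. -/

theorem totalD0_diff {F : Jet0 n → ℝ} {z : Jet1 n} (hF : ContDiffAt ℝ ∞ F z.1) (i : Fin n) :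
    DifferentiableAt ℝ (totalD0 F i) z := by
  have h1 : DifferentiableAt ℝ (fderiv ℝ F) z.1 :=
    (hF.fderiv_right (m := 1) (by norm_cast)).differentiableAt (by norm_num)
  have h2 : DifferentiableAt ℝ (fun w : Jet1 n => fderiv ℝ F w.1) z :=
    DifferentiableAt.comp (g := fderiv ℝ F) z h1 differentiableAt_fst
  have h3 : DifferentiableAt ℝ
      (fun w : Jet1 n => ((Pi.single i 1, w.2 i) : Jet0 n)) z := by fun_prop
  exact h2.clm_apply h3

theorem contDiffAt_parts {X : Jet0 n → Jet0 n} {w : Jet0 n} (hX : ContDiffAt ℝ ∞ X w) :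
    ContDiffAt ℝ ∞ (fun v => (X v).2) w ∧ ∀ j, ContDiffAt ℝ ∞ (fun v => (X v).1 j) w :=
  ⟨hX.snd, fun j => contDiffAt_pi.1 hX.fst j⟩

theorem prolongCoeff1_diff {X : Jet0 n → Jet0 n} {z : Jet1 n} (hX : ContDiffAt ℝ ∞ X z.1)
    (i : Fin n) : DifferentiableAt ℝ (prolongCoeff1 X i) z := by
  obtain ⟨h2, h1⟩ := contDiffAt_parts hX
  have hs : DifferentiableAt ℝ
      (fun z : Jet1 n => ∑ j, z.2 j * totalD0 (fun w => (X w).1 j) i z) z := by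
    refine DifferentiableAt.fun_sum fun j _ => ?_
    exact DifferentiableAt.mul (by fun_prop) (totalD0_diff (h1 j) i)
  exact (totalD0_diff h2 i).sub hs

theorem totalD0_lin {F G : Jet0 n → ℝ} {z : Jet1 n} (hF : ContDiffAt ℝ ∞ F z.1)
    (hG : ContDiffAt ℝ ∞ G z.1) (a b : ℝ) (i : Fin n) :
    totalD0 (fun w => a * F w + b * G w) i z = a * totalD0 F i z + b * totalD0 G i z := by
  have hF' := hF.differentiableAt (by norm_num)
  have hG' := hG.differentiableAt (by norm_num)
  have h := (hF'.hasFDerivAt.const_mul a).add (hG'.hasFDerivAt.const_mul b)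
  have h' : fderiv ℝ (fun w => a * F w + b * G w) z.1
      = a • fderiv ℝ F z.1 + b • fderiv ℝ G z.1 := h.fderiv
  simp [totalD0, h']

theorem totalD1_lin {F G : Jet1 n → ℝ} {z : Jet2 n} (hF' : DifferentiableAt ℝ F z.1)
    (hG' : DifferentiableAt ℝ G z.1) (a b : ℝ) (i : Fin n) :
    totalD1 (fun w => a * F w + b * G w) i z = a * totalD1 F i z + b * totalD1 G i z := by
  have h := (hF'.hasFDerivAt.const_mul a).add (hG'.hasFDerivAt.const_mul b)
  have h' : fderiv ℝ (fun w => a * F w + b * G w) z.1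
      = a • fderiv ℝ F z.1 + b • fderiv ℝ G z.1 := h.fderiv
  simp [totalD1, h']

theorem prolongCoeff1_lin {X Y : Jet0 n → Jet0 n} {z : Jet1 n} (hX : ContDiffAt ℝ ∞ X z.1)
    (hY : ContDiffAt ℝ ∞ Y z.1) (a b : ℝ) (i : Fin n) :
    prolongCoeff1 (a • X + b • Y) i z = a * prolongCoeff1 X i z + b * prolongCoeff1 Y i z := by
  obtain ⟨hX2, hX1⟩ := contDiffAt_parts hX
  obtain ⟨hY2, hY1⟩ := contDiffAt_parts hY
  have e2 : (fun w => ((a • X + b • Y) w).2) = fun w => a * (X w).2 + b * (Y w).2 := by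
    funext w; simp
  have e1 : ∀ j, (fun w => ((a • X + b • Y) w).1 j)
      = fun w => a * (X w).1 j + b * (Y w).1 j := by
    intro j; funext w; simp
  have hs : ∑ j, z.2 j * totalD0 (fun w => ((a • X + b • Y) w).1 j) i z
      = a * ∑ j, z.2 j * totalD0 (fun w => (X w).1 j) i z
        + b * ∑ j, z.2 j * totalD0 (fun w => (Y w).1 j) i z := by
    rw [Finset.mul_sum, Finset.mul_sum, ← Finset.sum_add_distrib]
    refine Finset.sum_congr rfl fun j _ => ?_
    rw [e1, totalD0_lin (hX1 j) (hY1 j)]; ring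
  unfold prolongCoeff1
  rw [hs, e2, totalD0_lin hX2 hY2]; ring

theorem prolongation_lin {X Y : Jet0 n → Jet0 n} {z : Jet2 n}
    (hX : ContDiffAt ℝ ∞ X z.1.1) (hY : ContDiffAt ℝ ∞ Y z.1.1)
    (hX' : ∀ᶠ w in nhds z.1.1, ContDiffAt ℝ ∞ X w) (hY' : ∀ᶠ w in nhds z.1.1, ContDiffAt ℝ ∞ Y w)
    (a b : ℝ) :
    prolongation (a • X + b • Y) z = a • prolongation X z + b • prolongation Y z := by
  have hc2 : ∀ i j, prolongCoeff2 (a • X + b • Y) i j z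
      = a * prolongCoeff2 X i j z + b * prolongCoeff2 Y i j z := by
    intro i j
    obtain ⟨hX2, hX1⟩ := contDiffAt_parts hX
    obtain ⟨hY2, hY1⟩ := contDiffAt_parts hY
    have e1 : ∀ j, (fun w => ((a • X + b • Y) w).1 j)
        = fun w => a * (X w).1 j + b * (Y w).1 j := by
      intro j; funext w; simp
    have hev : prolongCoeff1 (a • X + b • Y) i =ᶠ[nhds z.1]
        fun w => a * prolongCoeff1 X i w + b * prolongCoeff1 Y i w := by
      have t : Filter.Tendsto (fun w : Jet1 n => w.1) (nhds z.1) (nhds z.1.1) :=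
        continuous_fst.continuousAt
      filter_upwards [t.eventually hX', t.eventually hY'] with w h1 h2
      exact prolongCoeff1_lin h1 h2 a b i
    have hT : totalD1 (prolongCoeff1 (a • X + b • Y) i) j z
        = a * totalD1 (prolongCoeff1 X i) j z + b * totalD1 (prolongCoeff1 Y i) j z := by
      rw [← totalD1_lin (prolongCoeff1_diff hX i) (prolongCoeff1_diff hY i)]
      unfold totalD1
      rw [hev.fderiv_eq]
    have hs : ∑ k, z.2 i k * totalD0 (fun w => ((a • X + b • Y) w).1 k) j z.1
        = a * ∑ k, z.2 i k * totalD0 (fun w => (X w).1 k) j z.1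
          + b * ∑ k, z.2 i k * totalD0 (fun w => (Y w).1 k) j z.1 := by
      rw [Finset.mul_sum, Finset.mul_sum, ← Finset.sum_add_distrib]
      refine Finset.sum_congr rfl fun k _ => ?_
      rw [e1, totalD0_lin (hX1 k) (hY1 k)]; ring
    unfold prolongCoeff2
    rw [hs, hT]; ring
  refine Prod.ext (Prod.ext ?_ ?_) ?_
  · rfl
  · funext i
    exact prolongCoeff1_lin hX hY a b i
  · funext i j
    exact hc2 i j

theorem IsLiePointSymmetry.lin {H : Jet2 n → ℝ} {U : Opens (Fin n → ℝ)} {X Y : Jet0 n → Jet0 n}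
    (hX : IsLiePointSymmetry H U X) (hY : IsLiePointSymmetry H U Y) (a b : ℝ) :
    IsLiePointSymmetry H U (a • X + b • Y) := by
  refine ⟨(hX.1.const_smul a).add (hY.1.const_smul b), fun z hz hs h0 => ?_⟩
  have ho : IsOpen ((U : Set (Fin n → ℝ)) ×ˢ (Set.univ : Set ℝ)) := U.isOpen.prod isOpen_univ
  have hm : z.1.1 ∈ (U : Set (Fin n → ℝ)) ×ˢ (Set.univ : Set ℝ) := ⟨hz, trivial⟩
  have key : ∀ {Z : Jet0 n → Jet0 n}, IsLiePointSymmetry H U Z →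
      ∀ᶠ w in nhds z.1.1, ContDiffAt ℝ ∞ Z w := fun hZ => by
    filter_upwards [ho.mem_nhds hm] with w hw
    exact hZ.1.contDiffAt (ho.mem_nhds hw)
  rw [prolongation_lin (key hX).self_of_nhds (key hY).self_of_nhds (key hX) (key hY), map_add,
    map_smul, map_smul, hX.2 z hz hs h0, hY.2 z hz hs h0]
  simp

section Algebras

variable (g : (Fin n → ℝ) → Matrix (Fin n) (Fin n) ℝ) (V : (Fin n → ℝ) → ℝ)
  (U : Opens (Fin n → ℝ))

/-- The space of all Lie point symmetries (generators) of `Δu = V u` on `U`. Vector fields on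
`U × ℝ` are represented by their extension by zero, so that equality is equality on `U × ℝ`. -/
def symmetryAlgebra : Submodule ℝ (Jet0 n → Jet0 n) where
  carrier := {X | IsLiePointSymmetry (kleinGordon g V) U X ∧ ∀ w : Jet0 n, w.1 ∉ U → X w = 0}
  zero_mem' := by
    refine ⟨⟨contDiffOn_const, fun z _ _ _ => ?_⟩, fun _ _ => rfl⟩
    have : prolongation (0 : Jet0 n → Jet0 n) z = 0 := by
      have h := prolongation_lin (X := 0) (Y := 0) (z := z) contDiffAt_const contDiffAt_const
        (Filter.Eventually.of_forall fun _ => contDiffAt_const)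
        (Filter.Eventually.of_forall fun _ => contDiffAt_const) 0 0
      simpa using h
    rw [this, map_zero]
  add_mem' := fun {X Y} hX hY => by
    refine ⟨?_, fun w hw => by simp [hX.2 w hw, hY.2 w hw]⟩
    simpa using hX.1.lin hY.1 1 1
  smul_mem' := fun c X hX => by
    refine ⟨?_, fun w hw => by simp [hX.2 w hw]⟩
    simpa using hX.1.lin hX.1 c 0

open Classical in
/-- The vector field `b(x) ∂_u` on `U × ℝ` (extended by zero). -/
def verticalField (b : (Fin n → ℝ) → ℝ) (w : Jet0 n) : Jet0 n :=
  if w.1 ∈ U then (0, b w.1) else 0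

/-- The trivial symmetries `b(x) ∂_u`, with `b` a solution of `Δb = V b` on `U`. -/
def IsSolutionSymmetry (X : Jet0 n → Jet0 n) : Prop :=
  ∃ b, IsSolution g V U b ∧ X = verticalField U b

/-- The Lie point symmetries of `Δu = V u` modulo the trivial ones `b(x) ∂_u`: those of the form
`ξ^i(x, u) ∂_i + a(x) u ∂_u`, whose `u`-component is homogeneous linear in `u`. -/
def linearSymmetryAlgebra : Submodule ℝ (Jet0 n → Jet0 n) where
  carrier := {X | X ∈ symmetryAlgebra g V U ∧
    ∃ a : (Fin n → ℝ) → ℝ, ∀ x ∈ U, ∀ u : ℝ, (X (x, u)).2 = a x * u}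
  zero_mem' := ⟨Submodule.zero_mem _, 0, fun _ _ _ => by simp⟩
  add_mem' := by
    rintro X Y ⟨hX, a, ha⟩ ⟨hY, b, hb⟩
    exact ⟨Submodule.add_mem _ hX hY, a + b, fun x hx u => by
      simp [ha x hx u, hb x hx u, add_mul]⟩
  smul_mem' := by
    rintro c X ⟨hX, a, ha⟩
    exact ⟨Submodule.smul_mem _ c hX, c • a, fun x hx u => by simp [ha x hx u, mul_assoc]⟩

/-- The size of the symmetry algebra of the conformal Laplace equation on `W` is
`(n+1)(n+2)/2 + 2`, the infinite family `b(x) ∂_u` being counted as one generator: modulo that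
family the dimension is `(n+1)(n+2)/2 + 1`, there are nonzero solutions `b`, and adding `b ∂_u`
for any one of them gives a space of dimension `(n+1)(n+2)/2 + 2`. -/
def HasFullConformalSymmetry (W : Opens (Fin n → ℝ)) : Prop :=
  Module.finrank ℝ (linearSymmetryAlgebra g (conformalPotential g) W)
      = (n + 1) * (n + 2) / 2 + 1 ∧
  (∃ b, IsSolution g (conformalPotential g) W b ∧ ∃ x ∈ W, b x ≠ 0) ∧
  ∀ b, IsSolution g (conformalPotential g) W b → (∃ x ∈ W, b x ≠ 0) →
    Module.finrank ℝ ↥(linearSymmetryAlgebra g (conformalPotential g) W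
      ⊔ Submodule.span ℝ {verticalField W b}) = (n + 1) * (n + 2) / 2 + 2

end Algebras

end ConfKG

end

/-! The tensor calculus is carried out over an arbitrary commutative ℝ-algebra with commuting
derivations `D i`, a symmetric matrix `g` and an inverse `H` of it. Identities between tensors
become matrix identities, free of smoothness side conditions, and are applied to the algebra
`SmoothFun U`, where `Represents` and `evalAt` translate back to functions.

Write c = (2-n)/2 and let ξ be a conformal Killing vector with factor ψ. The Lie derivative of the
Christoffel symbols along ξ is δ^k_j ψ_i + δ^k_i ψ_j - g_{ij} ψ^k (`ConformalKilling.lie_chr`),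
because the difference of the two sides is skew in one pair of indices and symmetric in another.
Contraction gives Δξ - ξΔ = 2ψΔ + (2-n)∇ψ·∇, and replacing ξ by ξ - cψ removes the first order term
(`ConformalKilling.lap_twisted`). Inserted into the curvature, the same formula gives ξS = -2ψS -
2(n-1)Δψ (`ConformalKilling.lie_scal`). The constant (n-2)/(4(n-1)) is the one for which P =
(n-2)/(4(n-1)) S satisfies ξP + 2ψP = cΔψ (`ConformalKilling.lie_confPot`); so P absorbs the term
cΔψ of the symmetry condition and only the remainder of the potential is left in it.

For the classification, fix the point, u and the first jet p, and vary the second jet Q on the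
equation. Trace-free variations of Q show that the inverse metric is preserved up to scale by ξ,
with total derivatives of ξ in place of partial ones. The p-dependent part of this is a multiple of
the inverse metric of rank at most one, which forces ∂_u ξ = 0; the rest says that ξ is conformal
Killing. The part quadratic in p then gives ∂_u² η = 0, so η = αu + b. For such fields
`prolongation_kleinGordon_affine` evaluates the symmetry condition to (α - 2ψ)(Δu - Vu) + p·(2∇α -
(2-n)∇ψ) + u(Δα - ξV - 2ψV) + (Δb - Vb). Since u and p are free, each bracket vanishes separately;
connectedness of U gives α = cψ + a₀. The converse is read off from the same identity.

Brackets of symmetries are handled by closure of conformal Killing vectors under the bracket and by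
the twisted commutator, which maps solutions to solutions. For the conformal Laplace equation the
condition on ξ is empty, for the Laplace equation it is cΔψ = 0; this gives the inclusion, and
equality when all factors are harmonic, which the factors of improper vectors always are.

In conformally flat coordinates y the frame ∂/∂y^a turns the conformal Killing equation into the
flat one, with factor ψ - ξ(N)/N (`conformalKilling_iff_frame`). For n ≥ 3 the third derivatives
make the flat factor affine, and integrating twice gives Liouville's family
(`FlatConformalKilling.exists_liouville`): n translations, n(n-1)/2 rotations, one dilation and n
special conformal fields. The field u∂_u adds one more. A nowhere zero solution is B = |N|^c: the
defect f = ΔB - PB is controlled by the twisted commutators with translations and the dilation, and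
together these force 2f = 0 (`lap_eq_confPot_mul`). -/

namespace ConfKG

open Matrix

/-! ### Metric, Christoffel symbols and curvature over an algebra with derivations. -/

section FormalGeometry

variable {n : ℕ} {A : Type*} [CommRing A] [Algebra ℝ A]

theorem map_derivation_mul (d : Derivation ℝ A A) (M N : Matrix (Fin n) (Fin n) A) :
    (M * N).map d = M.map d * N + M * N.map d := by
  ext i j
  simp only [map_apply, mul_apply, map_sum, Derivation.leibniz, smul_eq_mul, Matrix.add_apply,
    ← Finset.sum_add_distrib]
  exact Finset.sum_congr rfl fun k _ => by ring

theorem map_derivation_add (d : Derivation ℝ A A) (M N : Matrix (Fin n) (Fin n) A) :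
    (M + N).map d = M.map d + N.map d := by
  ext i j; simp

theorem map_derivation_sub (d : Derivation ℝ A A) (M N : Matrix (Fin n) (Fin n) A) :
    (M - N).map d = M.map d - N.map d := by
  ext i j; simp

theorem map_derivation_one (d : Derivation ℝ A A) :
    (1 : Matrix (Fin n) (Fin n) A).map d = 0 := by
  ext i j
  by_cases h : i = j <;> simp [h, one_apply]

theorem map_derivation_smul (d : Derivation ℝ A A) (a : A) (M : Matrix (Fin n) (Fin n) A) :
    (a • M).map d = d a • M + a • M.map d := by
  ext i j
  simp; ring

variable (D : Fin n → Derivation ℝ A A)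

/-- The derivation `ξ^m D_m`. -/
noncomputable def along (ξ : Fin n → A) : Derivation ℝ A A := ∑ m, ξ m • D m

theorem along_apply (ξ : Fin n → A) (a : A) : along D ξ a = ∑ m, ξ m * D m a := by
  rw [along, ← Derivation.coeFnAddMonoidHom_apply, map_sum, Finset.sum_apply]
  rfl

/-- The matrix `D_m ξ^k` with row index `k` and column index `m`. -/
def jac (ξ : Fin n → A) : Matrix (Fin n) (Fin n) A := of fun k m => D m (ξ k)

@[simp] theorem jac_apply (ξ : Fin n → A) (k m : Fin n) : jac D ξ k m = D m (ξ k) := rfl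

theorem derivation_along {D : Fin n → Derivation ℝ A A} (hD : ∀ i j a, D i (D j a) = D j (D i a))
    (ξ : Fin n → A) (i : Fin n) (a : A) :
    D i (along D ξ a) = along D ξ (D i a) + ∑ m, D i (ξ m) * D m a := by
  simp only [along_apply, map_sum, Derivation.leibniz, smul_eq_mul, Finset.sum_add_distrib]
  congr 1
  · exact Finset.sum_congr rfl fun m _ => by rw [hD]
  · exact Finset.sum_congr rfl fun m _ => by ring

/-- The conformal Killing equation `L_ξ g = 2 ψ g`. -/
def ConformalKilling (g : Matrix (Fin n) (Fin n) A) (ξ : Fin n → A) (ψ : A) : Prop :=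
  g.map (along D ξ) + (jac D ξ)ᵀ * g + g * jac D ξ = (2 * ψ) • g

/-- The Christoffel symbols `Γ^k_{ij}` of `g` with inverse `H`. -/
noncomputable def chr (g H : Matrix (Fin n) (Fin n) A) (k i j : Fin n) : A :=
  algebraMap ℝ A (1 / 2) * ∑ l, H k l * (D i (g l j) + D j (g l i) - D l (g i j))

/-- The matrix `Γ^k_{ij}` with row index `k` and column index `i`. -/
noncomputable def chrMat (g H : Matrix (Fin n) (Fin n) A) (j : Fin n) :
    Matrix (Fin n) (Fin n) A := of fun k i => chr D g H k i j

@[simp] theorem chrMat_apply (g H : Matrix (Fin n) (Fin n) A) (j k i : Fin n) :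
    chrMat D g H j k i = chr D g H k i j := rfl

/-- The contraction `H^{ij} Γ^k_{ij}`. -/
noncomputable def cchr (g H : Matrix (Fin n) (Fin n) A) (k : Fin n) : A :=
  ∑ i, ∑ j, H i j * chr D g H k i j

/-- The Laplacian `H^{ij} D_i D_j a - H^{ij} Γ^k_{ij} D_k a`. -/
noncomputable def lap (g H : Matrix (Fin n) (Fin n) A) (a : A) : A :=
  ∑ i, ∑ j, H i j * D j (D i a) - ∑ k, cchr D g H k * D k a

/-- The curvature matrices `D_k Γ_j - D_j Γ_k + [Γ_k, Γ_j]`. -/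
noncomputable def curv (g H : Matrix (Fin n) (Fin n) A) (k j : Fin n) :
    Matrix (Fin n) (Fin n) A :=
  (chrMat D g H j).map (D k) - (chrMat D g H k).map (D j)
    + (chrMat D g H k * chrMat D g H j - chrMat D g H j * chrMat D g H k)

/-- The Ricci tensor. -/
noncomputable def ric (g H : Matrix (Fin n) (Fin n) A) : Matrix (Fin n) (Fin n) A :=
  of fun i j => ∑ k, curv D g H k j k i

/-- The scalar curvature. -/
noncomputable def scal (g H : Matrix (Fin n) (Fin n) A) : A :=
  ∑ i, ∑ j, H i j * ric D g H i j

variable {D} {g H : Matrix (Fin n) (Fin n) A}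

/-- Since `A` is an ℝ-algebra, 2 is invertible even though `A` may have zero divisors. -/
theorem two_mul_cancel {a b : A} (h : 2 * a = 2 * b) : a = b := by
  have h2 : algebraMap ℝ A (1 / 2) * 2 = 1 := by
    rw [show (2 : A) = algebraMap ℝ A 2 from (map_ofNat _ 2).symm, ← map_mul]
    norm_num
  linear_combination algebraMap ℝ A (1 / 2) * h + (b - a) * h2

theorem chr_symm (hs : gᵀ = g) (k i j : Fin n) : chr D g H k i j = chr D g H k j i := by
  have h : g i j = g j i := congrFun (congrFun hs j) i
  unfold chr
  rw [h]
  congr 1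
  exact Finset.sum_congr rfl fun l _ => by ring

theorem two_mul_chr_lower (hgH : g * H = 1) (p i j : Fin n) :
    2 * ∑ l, g p l * chr D g H l i j = D i (g p j) + D j (g p i) - D p (g i j) := by
  have h2 : 2 * algebraMap ℝ A (1 / 2) = 1 := by
    rw [show (2 : A) = algebraMap ℝ A 2 from (map_ofNat _ 2).symm, ← map_mul]
    norm_num
  set c : Fin n → A := fun p => D i (g p j) + D j (g p i) - D p (g i j) with hc
  have h1 : (fun l => chr D g H l i j) = algebraMap ℝ A (1 / 2) • (H *ᵥ c) := by
    funext l
    simp [chr, hc, mulVec, dotProduct]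
  have h3 : ∑ l, g p l * chr D g H l i j = (g *ᵥ fun l => chr D g H l i j) p := rfl
  rw [h3, h1, mulVec_smul, mulVec_mulVec, hgH, one_mulVec]
  simp only [Pi.smul_apply, smul_eq_mul, ← mul_assoc, h2, one_mul, hc]

/-- Adding the two lowered Christoffel formulas with i and j exchanged cancels all derivatives of g
except the one in direction k. -/
theorem metric_compat (hs : gᵀ = g) (hgH : g * H = 1) (k : Fin n) :
    g.map (D k) = (chrMat D g H k)ᵀ * g + g * chrMat D g H k := by
  have hs' : ∀ i j, g i j = g j i := fun i j => congrFun (congrFun hs j) i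
  ext i j
  have e1 := two_mul_chr_lower (D := D) hgH j i k
  have e2 := two_mul_chr_lower (D := D) hgH i j k
  have e3 : ((chrMat D g H k)ᵀ * g) i j = ∑ l, g j l * chr D g H l i k := by
    rw [mul_apply]
    exact Finset.sum_congr rfl fun l _ => by rw [hs' j l]; simp [mul_comm]
  have e4 : (g * chrMat D g H k) i j = ∑ l, g i l * chr D g H l j k := by
    rw [mul_apply]; rfl
  rw [Matrix.add_apply, e3, e4, map_apply]
  apply two_mul_cancel
  rw [hs' i k, hs' i j] at *
  linear_combination - e1 - e2

/-- Obtained by differentiating H g = 1 and substituting `metric_compat`. -/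
theorem inverse_compat (hs : gᵀ = g) (hgH : g * H = 1) (hHg : H * g = 1) (k : Fin n) :
    H.map (D k) = -(chrMat D g H k * H) - H * (chrMat D g H k)ᵀ := by
  have h := map_derivation_mul (D k) H g
  rw [hHg, map_derivation_one, metric_compat hs hgH] at h
  have h' : (0 : Matrix (Fin n) (Fin n) A) = H.map (D k) * (g * H)
      + H * (chrMat D g H k)ᵀ * (g * H) + (H * g) * chrMat D g H k * H := by
    calc (0 : Matrix (Fin n) (Fin n) A) = 0 * H := by simp
      _ = _ := by rw [h]; noncomm_ring
  rw [hgH, hHg] at h'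
  simp only [mul_one, one_mul] at h'
  rw [eq_comm, ← sub_eq_zero, ← neg_eq_zero, h']
  abel

/-- Differentiating H g = 1 along ξ transfers the conformal Killing equation to the inverse metric,
which is what the Laplacian contains. -/
theorem ConformalKilling.inverse (hgH : g * H = 1) (hHg : H * g = 1) {ξ : Fin n → A} {ψ : A}
    (h : ConformalKilling D g ξ ψ) :
    H.map (along D ξ) = -((2 * ψ) • H) + jac D ξ * H + H * (jac D ξ)ᵀ := by
  have h1 := map_derivation_mul (along D ξ) H g
  rw [hHg, map_derivation_one] at h1
  have h2 : g.map (along D ξ) = (2 * ψ) • g - (jac D ξ)ᵀ * g - g * jac D ξ := by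
    rw [← show _ = _ from h]; abel
  rw [h2] at h1
  have h3 : (0 : Matrix (Fin n) (Fin n) A) = H.map (along D ξ) * (g * H)
      + (2 * ψ) • ((H * g) * H) - H * (jac D ξ)ᵀ * (g * H) - (H * g) * jac D ξ * H := by
    calc (0 : Matrix (Fin n) (Fin n) A) = 0 * H := by simp
      _ = _ := by
        rw [h1]
        simp only [mul_sub, sub_mul, add_mul, mul_smul_comm, smul_mul_assoc, Matrix.mul_assoc]
        abel
  rw [hgH, hHg] at h3
  simp only [mul_one, one_mul] at h3
  rw [eq_comm, ← sub_eq_zero, ← neg_eq_zero, h3]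
  abel

end FormalGeometry

/-! ### Lie derivative of the Christoffel symbols. -/

section LieDerivative

variable {n : ℕ} {A : Type*} [CommRing A] [Algebra ℝ A] {D : Fin n → Derivation ℝ A A}
  {g H : Matrix (Fin n) (Fin n) A}

/-- A matrix-valued one-form which is skew in its matrix indices (lowered by `g`) and symmetric in
its lower indices vanishes. -/
theorem eq_zero_of_skew_of_symm (hs : gᵀ = g) (hHg : H * g = 1)
    (T : Fin n → Matrix (Fin n) (Fin n) A) (h1 : ∀ j, (T j)ᵀ * g + g * T j = 0)
    (h2 : ∀ k i j, T j k i = T i k j) (j : Fin n) : T j = 0 := by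
  have hs' : ∀ i j, g i j = g j i := fun i j => congrFun (congrFun hs j) i
  set t : Fin n → Fin n → Fin n → A := fun p i j => (g * T j) p i with ht
  have skew : ∀ p i j, t p i j = - t i p j := by
    intro p i j
    have h := congrFun (congrFun (h1 j) p) i
    have e : ((T j)ᵀ * g) p i = (g * T j) i p := by
      rw [← hs, ← transpose_mul, transpose_apply, hs]
    rw [Matrix.add_apply, e, Matrix.zero_apply] at h
    simp only [ht]
    linear_combination h
  have symm : ∀ p i j, t p i j = t p j i := by
    intro p i j
    simp only [ht, mul_apply]
    exact Finset.sum_congr rfl fun k _ => by rw [h2]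
  have hz : g * T j = 0 := by
    ext p i
    apply two_mul_cancel
    have a1 := skew p i j
    have a2 := symm i p j
    have a3 := skew i j p
    have a4 := symm j i p
    have a5 := skew j p i
    have a6 := symm p i j
    change 2 * t p i j = 2 * 0
    -- Six swaps, alternately of the skew and of the symmetric pair, return t p i j to itself with
    -- an odd number of signs.
    linear_combination a1 - a2 - a3 + a4 + a5 + a6
  calc T j = H * g * T j := by rw [hHg, one_mul]
    _ = 0 := by rw [Matrix.mul_assoc, hz, mul_zero]

theorem map_along_map (hD : ∀ i j a, D i (D j a) = D j (D i a)) (ξ : Fin n → A) (j : Fin n)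
    (M : Matrix (Fin n) (Fin n) A) :
    (M.map (along D ξ)).map (D j) = (M.map (D j)).map (along D ξ)
      + ∑ m, D j (ξ m) • M.map (D m) := by
  ext p q
  simp [derivation_along hD, Matrix.sum_apply]

/-- The gradient `H^{kl} D_l a`. -/
def gradUp (D : Fin n → Derivation ℝ A A) (H : Matrix (Fin n) (Fin n) A) (a : A) (k : Fin n) : A :=
  ∑ l, H k l * D l a

/-- The tensor `δ^k_j ψ_i + δ^k_i ψ_j - g_{ij} ψ^k`, as a matrix in `k`, `i`. -/
def confTensor (D : Fin n → Derivation ℝ A A) (g H : Matrix (Fin n) (Fin n) A) (ψ : A)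
    (j : Fin n) : Matrix (Fin n) (Fin n) A :=
  D j ψ • 1 + vecMulVec (Pi.single j 1) (fun i => D i ψ)
    - vecMulVec (gradUp D H ψ) (fun i => g i j)

theorem lower_gradUp (hgH : g * H = 1) (ψ : A) (p : Fin n) :
    ∑ k, g p k * gradUp D H ψ k = D p ψ := by
  have : (g *ᵥ (H *ᵥ fun l => D l ψ)) p = D p ψ := by
    rw [mulVec_mulVec, hgH, one_mulVec]
  exact this

/-- After lowering the upper index, the two rank-one terms are negative transposes of each other, so
only D_j ψ g survives symmetrization. -/
theorem confTensor_skew (hs : gᵀ = g) (hgH : g * H = 1) (ψ : A) (j : Fin n) :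
    (confTensor D g H ψ j)ᵀ * g + g * confTensor D g H ψ j = (2 * D j ψ) • g := by
  have hs' : ∀ i j, g i j = g j i := fun i j => congrFun (congrFun hs j) i
  have e : g * confTensor D g H ψ j = D j ψ • g + (vecMulVec (fun p => g p j) (fun i => D i ψ)
      - vecMulVec (fun i => D i ψ) (fun p => g p j)) := by
    have h1 : g *ᵥ (Pi.single j 1) = fun p => g p j := by ext p; simp
    have h2 : g *ᵥ gradUp D H ψ = fun i => D i ψ := funext fun p => lower_gradUp hgH ψ p
    rw [confTensor, mul_sub, mul_add, mul_smul_comm, mul_one, mul_vecMulVec, mul_vecMulVec, h1, h2,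
      add_sub_assoc]
  have e' : (confTensor D g H ψ j)ᵀ * g = (g * confTensor D g H ψ j)ᵀ := by
    rw [transpose_mul, hs]
  rw [e', e, transpose_add, transpose_smul, hs, transpose_sub, transpose_vecMulVec,
    transpose_vecMulVec, two_mul, add_smul]
  abel

theorem confTensor_symm (hs : gᵀ = g) (ψ : A) (k i j : Fin n) :
    confTensor D g H ψ j k i = confTensor D g H ψ i k j := by
  have hs' : g i j = g j i := congrFun (congrFun hs j) i
  simp only [confTensor, Matrix.sub_apply, Matrix.add_apply, Matrix.smul_apply, one_apply,
    vecMulVec_apply, Pi.single_apply, smul_eq_mul, hs']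
  ring

/-- The Lie derivative of the Christoffel symbols along a conformal Killing vector. -/
theorem ConformalKilling.lie_chr (hD : ∀ i j a, D i (D j a) = D j (D i a)) (hs : gᵀ = g)
    (hgH : g * H = 1) (hHg : H * g = 1) {ξ : Fin n → A} {ψ : A}
    (h : ConformalKilling D g ξ ψ) (j : Fin n) :
    (chrMat D g H j).map (along D ξ) = jac D ξ * chrMat D g H j - chrMat D g H j * jac D ξ
      - ∑ m, D j (ξ m) • chrMat D g H m - (jac D ξ).map (D j) + confTensor D g H ψ j := by
  rw [← sub_eq_zero]
  -- The difference of the two sides is the tensor to which the skew-symmetric argument applies.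
  refine eq_zero_of_skew_of_symm (g := g) (H := H) hs hHg (fun j =>
    (chrMat D g H j).map (along D ξ) - (jac D ξ * chrMat D g H j - chrMat D g H j * jac D ξ
      - ∑ m, D j (ξ m) • chrMat D g H m - (jac D ξ).map (D j) + confTensor D g H ψ j)) ?_ ?_ j
  · intro j
    set G := chrMat D g H with hG
    set X := along D ξ
    set J := jac D ξ
    have c := metric_compat (D := D) hs hgH
    have hX : g.map X = (2 * ψ) • g - Jᵀ * g - g * J := by
      rw [← show _ = _ from h]; abel
    have b1 : (g.map (D j)).map X = ((G j).map X)ᵀ * g + (G j)ᵀ * g.map X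
        + (g.map X * G j + g * (G j).map X) := by
      rw [c, map_derivation_add, map_derivation_mul, map_derivation_mul, transpose_map]
    -- D_j(ξ g) is computed twice: by commuting D_j with ξ and using metric compatibility, and by
    -- differentiating the conformal Killing equation. Comparing the results gives skewness.
    have b2 := map_along_map hD ξ j g
    have b3 : ∑ m, D j (ξ m) • g.map (D m) = (∑ m, D j (ξ m) • G m)ᵀ * g
        + g * ∑ m, D j (ξ m) • G m := by
      rw [transpose_sum, Finset.sum_mul, Finset.mul_sum, ← Finset.sum_add_distrib]
      refine Finset.sum_congr rfl fun m _ => ?_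
      rw [c, transpose_smul, smul_mul_assoc, mul_smul_comm, smul_add]
    have b4 : (g.map X).map (D j) = (2 * D j ψ) • g + (2 * ψ) • g.map (D j)
        - ((J.map (D j))ᵀ * g + Jᵀ * g.map (D j)) - (g.map (D j) * J + g * J.map (D j)) := by
      rw [hX, map_derivation_sub, map_derivation_sub, map_derivation_mul, map_derivation_mul,
        map_derivation_smul, transpose_map]
      have : D j (2 * ψ) = 2 * D j ψ := by
        have h2 : D j (2 : A) = 0 := by
          simpa using (D j).map_natCast 2
        simp [h2]
      rw [this]
    rw [b4, b1, b3, c, hX] at b2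
    have b5 := confTensor_skew (D := D) hs hgH ψ j
    simp only [transpose_add, transpose_sub, transpose_mul, mul_add, add_mul, mul_sub, sub_mul,
      smul_add, mul_smul_comm, smul_mul_assoc, Matrix.mul_assoc] at b2 b5 ⊢
    rw [← sub_eq_zero] at b2 b5 
    rw [← neg_eq_zero]
    have := congrArg₂ (· + ·) b2 b5
    simp only [add_zero] at this
    rw [← this]
    abel
  · intro k i j
    have e1 : ∀ a b, (chrMat D g H b).map (along D ξ) k a
        = along D ξ (chr D g H k a b) := fun a b => rfl
    have e2 : ∀ a b, (jac D ξ * chrMat D g H b) k a = ∑ m, D m (ξ k) * chr D g H m a b :=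
      fun a b => by rw [mul_apply]; rfl
    have e3 : ∀ a b, (chrMat D g H b * jac D ξ) k a = ∑ m, chr D g H k m b * D a (ξ m) :=
      fun a b => by rw [mul_apply]; rfl
    have e4 : ∀ a b, (∑ m, D b (ξ m) • chrMat D g H m) k a
        = ∑ m, chr D g H k m a * D b (ξ m) := fun a b => by
      rw [Matrix.sum_apply]
      refine Finset.sum_congr rfl fun m _ => ?_
      rw [chr_symm hs k m a]; simp [mul_comm]
    have e5 : ∀ a b, (jac D ξ).map (D b) k a = D b (D a (ξ k)) := fun a b => rfl
    simp only [Matrix.sub_apply, Matrix.add_apply, e1, e2, e3, e4, e5]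
    rw [confTensor_symm hs, hD i j, chr_symm hs k i j]
    rw [show ∑ m, D m (ξ k) * chr D g H m i j = ∑ m, D m (ξ k) * chr D g H m j i from
      Finset.sum_congr rfl fun m _ => by rw [chr_symm hs m i j]]
    ring

end LieDerivative

/-! ### Traces against the inverse metric. -/

section Contractions

variable {n : ℕ} {A : Type*} [CommRing A] {g H : Matrix (Fin n) (Fin n) A}

/-- The full contraction `H^{ij} F_{ij}`. -/
def frob (H F : Matrix (Fin n) (Fin n) A) : A := ∑ i, ∑ j, H i j * F i j

theorem frob_eq_trace (H F : Matrix (Fin n) (Fin n) A) : frob H F = (Hᵀ * F).trace := by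
  simp only [frob, trace, diag, mul_apply, transpose_apply]
  exact Finset.sum_comm

theorem frob_add (H F G : Matrix (Fin n) (Fin n) A) : frob H (F + G) = frob H F + frob H G := by
  simp [frob_eq_trace, mul_add]

theorem frob_sub (H F G : Matrix (Fin n) (Fin n) A) : frob H (F - G) = frob H F - frob H G := by
  simp [frob_eq_trace, mul_sub]

theorem frob_smul (H F : Matrix (Fin n) (Fin n) A) (a : A) : frob H (a • F) = a * frob H F := by
  simp [frob_eq_trace]

theorem frob_sum (H : Matrix (Fin n) (Fin n) A) (F : Fin n → Matrix (Fin n) (Fin n) A) :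
    frob H (∑ m, F m) = ∑ m, frob H (F m) := by
  simp [frob_eq_trace, Finset.mul_sum, trace_sum]

theorem frob_metric (hs : gᵀ = g) (hHg : H * g = 1) : frob H g = n := by
  have : frob H g = (H * g).trace := by
    rw [frob_eq_trace, ← trace_transpose, transpose_mul, transpose_transpose, hs, trace_mul_comm]
  rw [this, hHg, trace_one, Fintype.card_fin]

/-- Cyclicity of the trace moves the Jacobian terms in the Lie derivative of H onto F. -/
theorem frob_comm_jac (H F J : Matrix (Fin n) (Fin n) A) :
    frob (J * H + H * Jᵀ) F = frob H (Jᵀ * F + F * J) := by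
  simp only [frob_eq_trace, transpose_add, transpose_mul, transpose_transpose, add_mul, mul_add,
    trace_add, Matrix.mul_assoc]
  congr 1
  rw [trace_mul_comm, Matrix.mul_assoc]

theorem inverse_symm (hs : gᵀ = g) (hgH : g * H = 1) : Hᵀ = H := by
  have h : Hᵀ * g = 1 := by
    have := congrArg transpose hgH
    rwa [transpose_mul, hs, transpose_one] at this
  calc Hᵀ = Hᵀ * (g * H) := by rw [hgH, mul_one]
    _ = H := by rw [← Matrix.mul_assoc, h, one_mul]

end Contractions

/-! ### Commutators of the Laplacian with conformal Killing vectors. -/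

section Commutators

variable {n : ℕ} {A : Type*} [CommRing A] [Algebra ℝ A] {D : Fin n → Derivation ℝ A A}
  {g H : Matrix (Fin n) (Fin n) A}

theorem derivation_frob (d : Derivation ℝ A A) (H F : Matrix (Fin n) (Fin n) A) :
    d (frob H F) = frob (H.map d) F + frob H (F.map d) := by
  simp only [frob, map_sum, Derivation.leibniz, smul_eq_mul, map_apply,
    ← Finset.sum_add_distrib]
  exact Finset.sum_congr rfl fun i _ => Finset.sum_congr rfl fun j _ => by ring

/-- A contraction with H picks up weight -2ψ, plus the contraction of the Lie derivative of F; this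
reduces every scalar computation below to a Lie derivative of a covariant two-tensor. -/
theorem ConformalKilling.along_frob (hgH : g * H = 1) (hHg : H * g = 1) {ξ : Fin n → A} {ψ : A}
    (h : ConformalKilling D g ξ ψ) (F : Matrix (Fin n) (Fin n) A) :
    along D ξ (frob H F) = -(2 * ψ * frob H F)
      + frob H ((jac D ξ)ᵀ * F + F * jac D ξ + F.map (along D ξ)) := by
  rw [derivation_frob, h.inverse hgH hHg, frob_add, ← frob_comm_jac]
  have e : ∀ M N : Matrix (Fin n) (Fin n) A, frob (M + N) F = frob M F + frob N F := fun M N => by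
    simp [frob_eq_trace, add_mul]
  have e' : frob (-((2 * ψ) • H)) F = -(2 * ψ * frob H F) := by
    simp [frob_eq_trace]
  simp only [e, e']
  ring

/-- The matrix of second derivatives `D_j D_i a`. -/
def hess2 (D : Fin n → Derivation ℝ A A) (a : A) : Matrix (Fin n) (Fin n) A :=
  of fun i j => D j (D i a)

/-- The matrix `Γ^k_{ij}` with indices `i`, `j`. -/
noncomputable def chrLow (D : Fin n → Derivation ℝ A A) (g H : Matrix (Fin n) (Fin n) A)
    (k : Fin n) : Matrix (Fin n) (Fin n) A :=
  of fun i j => chr D g H k i j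

theorem lap_eq (a : A) :
    lap D g H a = frob H (hess2 D a) - ∑ k, cchr D g H k * D k a := rfl

/-- The two δ-terms contribute ψ^k each and the metric term contributes -n ψ^k. -/
theorem frob_confTensor (hs : gᵀ = g) (hgH : g * H = 1) (hHg : H * g = 1) (ψ : A) (k : Fin n) :
    frob H (of fun i j => confTensor D g H ψ j k i) = (2 - n) * gradUp D H ψ k := by
  have hH : ∀ i j, H i j = H j i := fun i j => congrFun (congrFun (inverse_symm hs hgH) j) i
  have e : (of fun i j => confTensor D g H ψ j k i : Matrix (Fin n) (Fin n) A)
      = vecMulVec (Pi.single k 1) (fun j => D j ψ) + vecMulVec (fun i => D i ψ) (Pi.single k 1)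
        - gradUp D H ψ k • g := by
    ext i j
    simp [confTensor, vecMulVec_apply, one_apply, Pi.single_apply, eq_comm]
  have e1 : frob H (vecMulVec (Pi.single k 1) fun j => D j ψ) = gradUp D H ψ k := by
    simp [frob, vecMulVec_apply, gradUp, Pi.single_apply]
  have e2 : frob H (vecMulVec (fun i => D i ψ) (Pi.single k 1)) = gradUp D H ψ k := by
    simp [frob, vecMulVec_apply, gradUp, Pi.single_apply, hH _ k]
  rw [e, frob_sub, frob_add, frob_smul, e1, e2, frob_metric hs hHg]
  ring

/-- The Lie derivative of the contracted Christoffel symbols along a conformal Killing vector. -/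
theorem ConformalKilling.lie_cchr (hD : ∀ i j a, D i (D j a) = D j (D i a)) (hs : gᵀ = g)
    (hgH : g * H = 1) (hHg : H * g = 1) {ξ : Fin n → A} {ψ : A}
    (h : ConformalKilling D g ξ ψ) (k : Fin n) :
    along D ξ (cchr D g H k) = -(2 * ψ * cchr D g H k) + ∑ m, D m (ξ k) * cchr D g H m
      - frob H (hess2 D (ξ k)) + (2 - n) * gradUp D H ψ k := by
  have hc : ∀ k, cchr D g H k = frob H (chrLow D g H k) := fun k => rfl
  have e : (chrLow D g H k).map (along D ξ) = ∑ m, D m (ξ k) • chrLow D g H m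
      - chrLow D g H k * jac D ξ - (jac D ξ)ᵀ * chrLow D g H k - hess2 D (ξ k)
      + of fun i j => confTensor D g H ψ j k i := by
    ext i j
    have h1 := congrFun (congrFun (h.lie_chr hD hs hgH hHg j) k) i
    have e1 : (chrMat D g H j).map (along D ξ) k i = along D ξ (chr D g H k i j) := rfl
    have e2 : (jac D ξ * chrMat D g H j) k i = (∑ m, D m (ξ k) • chrLow D g H m) i j := by
      rw [mul_apply, Matrix.sum_apply]; rfl
    have e3 : (chrMat D g H j * jac D ξ) k i = ((jac D ξ)ᵀ * chrLow D g H k) i j := by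
      rw [mul_apply, mul_apply]
      exact Finset.sum_congr rfl fun m _ => by simp [chrLow, mul_comm]
    have e4 : (∑ m, D j (ξ m) • chrMat D g H m) k i = (chrLow D g H k * jac D ξ) i j := by
      rw [mul_apply, Matrix.sum_apply]
      exact Finset.sum_congr rfl fun m _ => by simp [chrLow, mul_comm]
    simp only [Matrix.sub_apply, Matrix.add_apply, e1, e2, e3, e4] at h1
    simp only [Matrix.sub_apply, Matrix.add_apply]
    change along D ξ (chr D g H k i j) = _
    rw [h1]
    change _ - _ - _ - D j (D i (ξ k)) + _ = _ - _ - _ - D j (D i (ξ k)) + confTensor D g H ψ j k i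
    ring
  rw [hc, h.along_frob hgH hHg, e, ← frob_confTensor hs hgH hHg]
  simp only [frob_add, frob_sub, frob_sum, frob_smul, hc]
  ring

/-- The commutator of the Laplacian with a conformal Killing vector. -/
theorem ConformalKilling.lap_along (hD : ∀ i j a, D i (D j a) = D j (D i a)) (hs : gᵀ = g)
    (hgH : g * H = 1) (hHg : H * g = 1) {ξ : Fin n → A} {ψ : A}
    (h : ConformalKilling D g ξ ψ) (a : A) :
    lap D g H (along D ξ a) = along D ξ (lap D g H a) + 2 * ψ * lap D g H a
      + (2 - n) * ∑ k, gradUp D H ψ k * D k a := by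
  have e1 : hess2 D (along D ξ a) = (jac D ξ)ᵀ * hess2 D a + hess2 D a * jac D ξ
      + (hess2 D a).map (along D ξ) + ∑ m, D m a • hess2 D (ξ m) := by
    ext i j
    simp only [Matrix.add_apply, mul_apply, Matrix.sum_apply, transpose_apply, jac_apply,
      Matrix.smul_apply, map_apply, hess2, of_apply, smul_eq_mul, derivation_along hD, map_add,
      map_sum, Derivation.leibniz, Finset.sum_add_distrib]
    rw [show ∑ m, D j (ξ m) * D m (D i a) = ∑ m, D m (D i a) * D j (ξ m) from
      Finset.sum_congr rfl fun m _ => mul_comm _ _]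
    rw [show ∑ m, D i (ξ m) * D j (D m a) = ∑ m, D i (ξ m) * D j (D m a) from rfl]
    ring
  have e2 := h.along_frob hgH hHg (hess2 D a)
  have e3 : along D ξ (∑ k, cchr D g H k * D k a) = ∑ k, along D ξ (cchr D g H k) * D k a
      + ∑ k, cchr D g H k * along D ξ (D k a) := by
    rw [map_sum, ← Finset.sum_add_distrib]
    refine Finset.sum_congr rfl fun k _ => ?_
    rw [Derivation.leibniz, smul_eq_mul, smul_eq_mul]; ring
  have e4 : ∑ k, cchr D g H k * D k (along D ξ a) = ∑ k, cchr D g H k * along D ξ (D k a)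
      + ∑ k, (∑ m, D m (ξ k) * cchr D g H m) * D k a := by
    simp only [derivation_along hD, mul_add, Finset.sum_add_distrib, Finset.sum_mul,
      Finset.mul_sum]
    congr 1
    rw [Finset.sum_comm]
    exact Finset.sum_congr rfl fun k _ => Finset.sum_congr rfl fun m _ => by ring
  have e5 : ∑ k, along D ξ (cchr D g H k) * D k a = -(2 * ψ * ∑ k, cchr D g H k * D k a)
      + ∑ k, (∑ m, D m (ξ k) * cchr D g H m) * D k a - ∑ k, D k a * frob H (hess2 D (ξ k))
      + (2 - n) * ∑ k, gradUp D H ψ k * D k a := by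
    simp only [Finset.mul_sum, ← Finset.sum_neg_distrib, ← Finset.sum_add_distrib,
      ← Finset.sum_sub_distrib]
    refine Finset.sum_congr rfl fun k _ => ?_
    rw [h.lie_cchr hD hs hgH hHg]
    ring
  rw [lap_eq, lap_eq, map_sub, e3, e1, frob_add, frob_sum, e2, e4, e5]
  simp only [frob_smul]
  ring

theorem lap_sub (a b : A) : lap D g H (a - b) = lap D g H a - lap D g H b := by
  simp only [lap, map_sub, mul_sub, Finset.sum_sub_distrib]
  ring

theorem lap_const_mul (r : ℝ) (a : A) :
    lap D g H (algebraMap ℝ A r * a) = algebraMap ℝ A r * lap D g H a := by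
  have e : ∀ i (b : A), D i (algebraMap ℝ A r * b) = algebraMap ℝ A r * D i b := fun i b => by
    simp
  simp only [lap, e, mul_sub, Finset.mul_sum, mul_left_comm]

theorem lap_mul (hs : gᵀ = g) (hgH : g * H = 1) (a b : A) :
    lap D g H (a * b) = a * lap D g H b + b * lap D g H a
      + 2 * ∑ k, gradUp D H a k * D k b := by
  have hH : Hᵀ = H := inverse_symm hs hgH
  have e1 : hess2 D (a * b) = a • hess2 D b + b • hess2 D a
      + (vecMulVec (fun i => D i b) (fun j => D j a)
        + vecMulVec (fun i => D i a) (fun j => D j b)) := by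
    ext i j
    simp [hess2, vecMulVec_apply]
    ring
  have e2 : frob H (vecMulVec (fun i => D i b) (fun j => D j a))
      = ∑ k, gradUp D H a k * D k b := by
    simp only [frob, vecMulVec_apply, gradUp, Finset.sum_mul]
    exact Finset.sum_congr rfl fun k _ => Finset.sum_congr rfl fun m _ => by ring
  have e3 : frob H (vecMulVec (fun i => D i a) (fun j => D j b))
      = frob H (vecMulVec (fun i => D i b) (fun j => D j a)) := by
    rw [frob_eq_trace, frob_eq_trace, ← trace_transpose, transpose_mul, transpose_transpose, hH,
      transpose_vecMulVec, trace_mul_comm]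
  have e4 : ∑ k, cchr D g H k * D k (a * b) = a * ∑ k, cchr D g H k * D k b
      + b * ∑ k, cchr D g H k * D k a := by
    simp only [Derivation.leibniz, smul_eq_mul, Finset.mul_sum, ← Finset.sum_add_distrib]
    exact Finset.sum_congr rfl fun k _ => by ring
  rw [lap_eq, lap_eq, lap_eq, e1, frob_add, frob_add, frob_add, e3, e2, e4, frob_smul, frob_smul]
  ring

/-- The twisted commutator: for the weight `c = (2 - n) / 2` the first order terms cancel. -/
theorem ConformalKilling.lap_twisted (hD : ∀ i j a, D i (D j a) = D j (D i a)) (hs : gᵀ = g)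
    (hgH : g * H = 1) (hHg : H * g = 1) {ξ : Fin n → A} {ψ : A}
    (h : ConformalKilling D g ξ ψ) (a : A) :
    lap D g H (along D ξ a - algebraMap ℝ A ((2 - n) / 2) * ψ * a)
      = along D ξ (lap D g H a) + 2 * ψ * lap D g H a
        - algebraMap ℝ A ((2 - n) / 2) * ψ * lap D g H a
        - algebraMap ℝ A ((2 - n) / 2) * lap D g H ψ * a := by
  -- The cross term 2c ∇ψ·∇a of Δ(cψa) matches the (2-n) ∇ψ·∇a of the untwisted commutator.
  have hc : 2 * algebraMap ℝ A ((2 - n) / 2) = 2 - n := by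
    rw [show (2 : A) = algebraMap ℝ A 2 from (map_ofNat _ 2).symm, ← map_mul, mul_div_cancel₀]
    · simp
    · norm_num
  rw [lap_sub, h.lap_along hD hs hgH hHg, mul_assoc (algebraMap ℝ A _) ψ a, lap_const_mul, lap_mul hs hgH]
  linear_combination (-(∑ k, gradUp D H ψ k * D k a)) * hc

end Commutators

/-! ### Lie derivatives of the curvature, the scalar curvature and the conformal potential. -/

section Curvature

variable {n : ℕ} {A : Type*} [CommRing A] [Algebra ℝ A] {D : Fin n → Derivation ℝ A A}
  {g H : Matrix (Fin n) (Fin n) A}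

theorem map_map_comm (hD : ∀ i j a, D i (D j a) = D j (D i a)) (M : Matrix (Fin n) (Fin n) A)
    (i j : Fin n) : (M.map (D i)).map (D j) = (M.map (D j)).map (D i) := by
  ext p q; exact hD j i _

theorem map_derivation_sum_smul (d : Derivation ℝ A A) (a : Fin n → A)
    (M : Fin n → Matrix (Fin n) (Fin n) A) :
    (∑ m, a m • M m).map d = ∑ m, d (a m) • M m + ∑ m, a m • (M m).map d := by
  ext p q
  simp [Matrix.sum_apply, ← Finset.sum_add_distrib, add_comm, mul_comm]

/-- The variation of the curvature matrices caused by a variation `C` of the Christoffel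
symbols. -/
noncomputable def curvVar (D : Fin n → Derivation ℝ A A) (g H : Matrix (Fin n) (Fin n) A)
    (C : Fin n → Matrix (Fin n) (Fin n) A) (k j : Fin n) : Matrix (Fin n) (Fin n) A :=
  (C j).map (D k) - (C k).map (D j) + (chrMat D g H k * C j - C j * chrMat D g H k)
    - (chrMat D g H j * C k - C k * chrMat D g H j)

/-- The Lie derivative of the curvature along a conformal Killing vector. -/
theorem ConformalKilling.lie_curv (hD : ∀ i j a, D i (D j a) = D j (D i a)) (hs : gᵀ = g)
    (hgH : g * H = 1) (hHg : H * g = 1) {ξ : Fin n → A} {ψ : A}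
    (h : ConformalKilling D g ξ ψ) (k j : Fin n) :
    (curv D g H k j).map (along D ξ) = jac D ξ * curv D g H k j - curv D g H k j * jac D ξ
      - ∑ m, D k (ξ m) • curv D g H m j - ∑ m, D j (ξ m) • curv D g H k m
      + curvVar D g H (confTensor D g H ψ) k j := by
  set G := chrMat D g H with hG
  set X := along D ξ
  set J := jac D ξ with hJ
  set C := confTensor D g H ψ
  have hX : ∀ j, (G j).map X = J * G j - G j * J - ∑ m, D j (ξ m) • G m - J.map (D j) + C j :=
    fun j => h.lie_chr hD hs hgH hHg j
  -- Differentiate the formula for the Lie derivative of Γ, then exchange D_k and ξ at the price of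
  -- the terms D_k ξ^m D_m Γ.
  have hDX : ∀ k j, ((G j).map (D k)).map X = (J.map (D k) * G j + J * (G j).map (D k))
      - ((G j).map (D k) * J + G j * J.map (D k))
      - (∑ m, D k (D j (ξ m)) • G m + ∑ m, D j (ξ m) • (G m).map (D k))
      - (J.map (D j)).map (D k) + (C j).map (D k) - ∑ m, D k (ξ m) • (G j).map (D m) := by
    intro k j
    have h1 := map_along_map hD ξ k (G j)
    rw [hX j, map_derivation_add, map_derivation_sub, map_derivation_sub, map_derivation_sub,
      map_derivation_mul, map_derivation_mul, map_derivation_sum_smul] at h1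
    rw [eq_sub_iff_add_eq, ← h1]
  have hcurv : ∀ k j, curv D g H k j = (G j).map (D k) - (G k).map (D j)
    + (G k * G j - G j * G k) := fun k j => rfl
  have e1 : ∑ m, D k (ξ m) • curv D g H m j = ∑ m, D k (ξ m) • (G j).map (D m)
      - ∑ m, D k (ξ m) • (G m).map (D j) + ((∑ m, D k (ξ m) • G m) * G j
        - G j * ∑ m, D k (ξ m) • G m) := by
    simp only [hcurv, smul_add, smul_sub, Finset.sum_add_distrib, Finset.sum_sub_distrib,
      Finset.sum_mul, Finset.mul_sum, smul_mul_assoc, mul_smul_comm]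
  have e2 : ∑ m, D j (ξ m) • curv D g H k m = ∑ m, D j (ξ m) • (G m).map (D k)
      - ∑ m, D j (ξ m) • (G k).map (D m) + (G k * (∑ m, D j (ξ m) • G m)
        - (∑ m, D j (ξ m) • G m) * G k) := by
    simp only [hcurv, smul_add, smul_sub, Finset.sum_add_distrib, Finset.sum_sub_distrib,
      Finset.sum_mul, Finset.mul_sum, smul_mul_assoc, mul_smul_comm]
  have e3 : ∑ m, D k (D j (ξ m)) • G m = ∑ m, D j (D k (ξ m)) • G m :=
    Finset.sum_congr rfl fun m _ => by rw [hD]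
  rw [e1, e2, hcurv k j, map_derivation_add, map_derivation_sub, map_derivation_sub,
    map_derivation_mul, map_derivation_mul, hDX, hDX, hX, hX, map_map_comm hD J k j, e3, curvVar]
  simp only [mul_add, add_mul, mul_sub, sub_mul, Matrix.mul_assoc]
  abel

/-- The divergence of the gradient is the Laplacian. -/
theorem div_gradUp (hs : gᵀ = g) (hgH : g * H = 1) (hHg : H * g = 1) (ψ : A) :
    ∑ k, D k (gradUp D H ψ k) + ∑ k, ∑ m, chr D g H k m k * gradUp D H ψ m = lap D g H ψ := by
  have hH : ∀ i j, H i j = H j i := fun i j => congrFun (congrFun (inverse_symm hs hgH) j) i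
  have h1 : ∀ k l, D k (H k l) = -∑ m, chr D g H k m k * H m l
      - ∑ m, H k m * chr D g H l m k := by
    intro k l
    have := congrFun (congrFun (inverse_compat (D := D) hs hgH hHg k) k) l
    simpa [mul_apply, Matrix.sub_apply, Matrix.neg_apply] using this
  have h2 : ∑ k, D k (gradUp D H ψ k) = ∑ k, ∑ l, H k l * D k (D l ψ)
      + ∑ k, ∑ l, D k (H k l) * D l ψ := by
    simp only [gradUp, map_sum, Derivation.leibniz, smul_eq_mul, Finset.sum_add_distrib]
    congr 1
    exact Finset.sum_congr rfl fun k _ => Finset.sum_congr rfl fun l _ => mul_comm _ _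
  have h3 : ∑ k, ∑ l, D k (H k l) * D l ψ = -∑ k, ∑ m, chr D g H k m k * gradUp D H ψ m
      - ∑ l, cchr D g H l * D l ψ := by
    simp only [h1, sub_mul, neg_mul, Finset.sum_sub_distrib, Finset.sum_neg_distrib]
    congr 1
    · congr 1
      refine Finset.sum_congr rfl fun k _ => ?_
      simp only [gradUp, Finset.sum_mul, Finset.mul_sum]
      rw [Finset.sum_comm]
      exact Finset.sum_congr rfl fun l _ => Finset.sum_congr rfl fun m _ => by ring
    · rw [Finset.sum_comm]
      refine Finset.sum_congr rfl fun l _ => ?_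
      simp only [cchr, Finset.sum_mul]
      exact Finset.sum_congr rfl fun k _ => Finset.sum_congr rfl fun m _ => by
        rw [chr_symm hs]
  have h4 : ∑ k, ∑ l, H k l * D k (D l ψ) = frob H (hess2 D ψ) := by
    rw [Finset.sum_comm]
    exact Finset.sum_congr rfl fun l _ => Finset.sum_congr rfl fun m _ => by
      rw [hH m l]; rfl
  rw [h2, h3, h4, lap_eq]
  ring

/-- The covariant Hessian `D_j D_i ψ - Γ^k_{ij} D_k ψ`. -/
noncomputable def covHess (D : Fin n → Derivation ℝ A A) (g H : Matrix (Fin n) (Fin n) A)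
    (ψ : A) : Matrix (Fin n) (Fin n) A :=
  of fun i j => D j (D i ψ) - ∑ k, chr D g H k i j * D k ψ

theorem frob_covHess (ψ : A) : frob H (covHess D g H ψ) = lap D g H ψ := by
  have : covHess D g H ψ = hess2 D ψ - ∑ k, D k ψ • chrLow D g H k := by
    ext i j
    simp [covHess, hess2, chrLow, Matrix.sum_apply, mul_comm]
  rw [this, frob_sub, frob_sum, lap_eq]
  congr 1
  exact Finset.sum_congr rfl fun k _ => by rw [frob_smul, mul_comm]; rfl

/-- The Ricci contraction of the curvature variation caused by `confTensor`. -/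
theorem trace_curvVar_confTensor (hD : ∀ i j a, D i (D j a) = D j (D i a)) (hs : gᵀ = g)
    (hgH : g * H = 1) (hHg : H * g = 1) (ψ : A) (i j : Fin n) :
    ∑ k, curvVar D g H (confTensor D g H ψ) k j k i
      = (2 - n) * covHess D g H ψ i j - lap D g H ψ * g i j := by
  have hs' : ∀ i j, g i j = g j i := fun i j => congrFun (congrFun hs j) i
  set v := gradUp D H ψ with hv
  have hC : ∀ j k i, confTensor D g H ψ j k i = (if k = i then D j ψ else 0)
      + (if k = j then D i ψ else 0) - v k * g i j := by
    intro j k i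
    simp [confTensor, vecMulVec_apply, one_apply, Pi.single_apply, hv]
  have hDC : ∀ l j k i, D l (confTensor D g H ψ j k i) = (if k = i then D l (D j ψ) else 0)
      + (if k = j then D l (D i ψ) else 0) - (D l (v k) * g i j + v k * D l (g i j)) := by
    intro l j k i
    rw [hC, map_sub, map_add, Derivation.leibniz, smul_eq_mul, smul_eq_mul, apply_ite (D l),
      apply_ite (D l), map_zero]
    ring
  have hlow : ∀ i, ∑ k, v k * g i k = D i ψ := fun i => by
    rw [← lower_gradUp hgH ψ i]
    exact Finset.sum_congr rfl fun k _ => mul_comm _ _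
  -- Differentiating v^k g_{ik} = ψ_{,i} yields second derivatives of ψ without differentiating the
  -- inverse metric.
  have hDlow : ∑ k, (D j (v k) * g i k + v k * D j (g i k)) = D j (D i ψ) := by
    rw [← hlow i, map_sum]
    refine Finset.sum_congr rfl fun k _ => ?_
    rw [Derivation.leibniz, smul_eq_mul, smul_eq_mul]; ring
  have hdiv := div_gradUp (D := D) hs hgH hHg ψ
  have hmet : ∀ k, D k (g i j) = ∑ m, chr D g H m i k * g m j + ∑ m, g i m * chr D g H m j k := by
    intro k
    have := congrFun (congrFun (metric_compat (D := D) hs hgH k) i) j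
    simpa [mul_apply, Matrix.add_apply] using this
  have t1 : ∑ k, (confTensor D g H ψ j).map (D k) k i = D i (D j ψ) + D j (D i ψ)
      - (∑ k, D k (v k)) * g i j - ∑ k, v k * D k (g i j) := by
    simp [hDC, Finset.sum_add_distrib, Finset.sum_sub_distrib, Finset.sum_mul]
    ring
  have t2 : ∑ k, (confTensor D g H ψ k).map (D j) k i = n * D j (D i ψ) := by
    have := hDlow
    simp only [Finset.sum_add_distrib] at this
    simp [hDC, Finset.sum_add_distrib, Finset.sum_sub_distrib]
    linear_combination - this
  have t3 : ∑ k, (chrMat D g H k * confTensor D g H ψ j) k i = (∑ k, chr D g H k i k) * D j ψ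
      + (∑ k, chr D g H k j k) * D i ψ - (∑ k, ∑ m, chr D g H k m k * v m) * g i j := by
    simp [mul_apply, hC, mul_add, mul_sub, Finset.sum_add_distrib, Finset.sum_sub_distrib,
      Finset.sum_mul, mul_assoc]
  have t4 : ∑ k, (confTensor D g H ψ j * chrMat D g H k) k i = (∑ k, chr D g H k i k) * D j ψ
      + ∑ m, chr D g H m i j * D m ψ - ∑ k, ∑ m, v k * (g m j * chr D g H m i k) := by
    simp [mul_apply, hC, add_mul, sub_mul, Finset.sum_add_distrib, Finset.sum_sub_distrib,
      Finset.sum_mul, mul_assoc, mul_comm (D _ ψ)]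
  have t5 : ∑ k, (chrMat D g H j * confTensor D g H ψ k) k i = ∑ k, chr D g H k i j * D k ψ
      + (∑ k, chr D g H k k j) * D i ψ - ∑ k, ∑ m, chr D g H k m j * (v m * g i k) := by
    simp [mul_apply, hC, mul_add, mul_sub, Finset.sum_add_distrib, Finset.sum_sub_distrib,
      Finset.sum_mul]
  have t6 : ∑ k, (confTensor D g H ψ k * chrMat D g H j) k i
      = n * ∑ m, chr D g H m i j * D m ψ := by
    have e : ∀ m, ∑ k, confTensor D g H ψ k k m = n * D m ψ := by
      intro m
      simp only [hC, Finset.sum_add_distrib, Finset.sum_sub_distrib, hlow]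
      simp
    have : ∑ k, (confTensor D g H ψ k * chrMat D g H j) k i
        = ∑ m, (∑ k, confTensor D g H ψ k k m) * chr D g H m i j := by
      simp only [mul_apply, Finset.sum_mul, chrMat_apply]
      exact Finset.sum_comm
    rw [this, Finset.mul_sum]
    exact Finset.sum_congr rfl fun m _ => by rw [e]; ring
  -- Metric compatibility turns the remaining derivative of g into exactly the products of v, g and
  -- Γ left over in `t4` and `t5`.
  have t7 : ∑ k, v k * D k (g i j) = ∑ k, ∑ m, v k * (g m j * chr D g H m i k)
      + ∑ k, ∑ m, chr D g H k m j * (v m * g i k) := by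
    rw [Finset.sum_comm (f := fun k m => chr D g H k m j * (v m * g i k)),
      ← Finset.sum_add_distrib]
    refine Finset.sum_congr rfl fun k _ => ?_
    rw [hmet, mul_add, Finset.mul_sum, Finset.mul_sum]
    congr 1
    · exact Finset.sum_congr rfl fun m _ => by ring
    · exact Finset.sum_congr rfl fun m _ => by rw [chr_symm hs m j k]; ring
  have t8 : ∑ k, chr D g H k j k = ∑ k, chr D g H k k j :=
    Finset.sum_congr rfl fun k _ => chr_symm hs k j k
  simp only [curvVar, Matrix.add_apply, Matrix.sub_apply, Finset.sum_add_distrib,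
    Finset.sum_sub_distrib]
  rw [t1, t2, t3, t4, t5, t6, t7, t8, ← hdiv, hD i j]
  simp only [covHess, of_apply]
  ring

/-- The Lie derivative of the scalar curvature along a conformal Killing vector. -/
theorem ConformalKilling.lie_scal (hD : ∀ i j a, D i (D j a) = D j (D i a)) (hs : gᵀ = g)
    (hgH : g * H = 1) (hHg : H * g = 1) {ξ : Fin n → A} {ψ : A}
    (h : ConformalKilling D g ξ ψ) :
    along D ξ (scal D g H) = -(2 * ψ * scal D g H) - 2 * (n - 1) * lap D g H ψ := by
  have e : (ric D g H).map (along D ξ) = -((jac D ξ)ᵀ * ric D g H + ric D g H * jac D ξ)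
      + ((2 - n : A) • covHess D g H ψ - lap D g H ψ • g) := by
    ext i j
    have h1 : along D ξ (ric D g H i j) = ∑ k, (curv D g H k j).map (along D ξ) k i := by
      simp [ric]
    -- After contracting k with the upper index, the Jacobian acting on that index cancels the
    -- Jacobian acting on k.
    have h2 : ∑ k, (jac D ξ * curv D g H k j) k i
        = ∑ k, (∑ m, D k (ξ m) • curv D g H m j) k i := by
      simp only [mul_apply, Matrix.sum_apply, Matrix.smul_apply, smul_eq_mul, jac_apply]
      exact Finset.sum_comm
    have h3 : ∑ k, (curv D g H k j * jac D ξ) k i = ((jac D ξ)ᵀ * ric D g H) i j := by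
      simp only [mul_apply, ric, of_apply, transpose_apply, jac_apply, Finset.mul_sum]
      rw [Finset.sum_comm]
      exact Finset.sum_congr rfl fun m _ => Finset.sum_congr rfl fun k _ => mul_comm _ _
    have h4 : ∑ k, (∑ m, D j (ξ m) • curv D g H k m) k i = (ric D g H * jac D ξ) i j := by
      simp only [mul_apply, ric, of_apply, Matrix.sum_apply, Matrix.smul_apply, smul_eq_mul,
        jac_apply, Finset.sum_mul]
      rw [Finset.sum_comm]
      exact Finset.sum_congr rfl fun m _ => Finset.sum_congr rfl fun k _ => mul_comm _ _
    rw [map_apply, h1]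
    simp only [h.lie_curv hD hs hgH hHg, Matrix.sub_apply, Matrix.add_apply,
      Finset.sum_add_distrib, Finset.sum_sub_distrib]
    rw [h2, h3, h4, trace_curvVar_confTensor hD hs hgH hHg]
    simp only [Matrix.neg_apply, Matrix.add_apply, Matrix.smul_apply, smul_eq_mul]
    ring
  have hsc : scal D g H = frob H (ric D g H) := rfl
  rw [hsc, h.along_frob hgH hHg, e, add_neg_cancel_left, frob_sub, frob_smul, frob_smul,
    frob_covHess, frob_metric hs hHg]
  ring

/-- The multiple `(n - 2) / (4 (n - 1))` of the scalar curvature. -/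
noncomputable def confPot (D : Fin n → Derivation ℝ A A) (g H : Matrix (Fin n) (Fin n) A) : A :=
  algebraMap ℝ A (((n : ℝ) - 2) / (4 * ((n : ℝ) - 1))) * scal D g H

/-- The homogeneous part of `lie_scal` is absorbed by 2ψP. In the inhomogeneous part the coefficient
of S turns -2(n-1) into -(n-2)/2, the weight of the twisted commutator. -/
theorem ConformalKilling.lie_confPot (hn : 2 ≤ n) (hD : ∀ i j a, D i (D j a) = D j (D i a))
    (hs : gᵀ = g) (hgH : g * H = 1) (hHg : H * g = 1) {ξ : Fin n → A} {ψ : A}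
    (h : ConformalKilling D g ξ ψ) :
    along D ξ (confPot D g H) + 2 * ψ * confPot D g H
      = algebraMap ℝ A ((2 - n) / 2) * lap D g H ψ := by
  have hn' : (n : ℝ) - 1 ≠ 0 := by
    have : (2 : ℝ) ≤ n := by exact_mod_cast hn
    intro h0; linarith
  have h2 : algebraMap ℝ A (((n : ℝ) - 2) / (4 * ((n : ℝ) - 1))) * (2 * (n - 1))
      = -algebraMap ℝ A ((2 - n) / 2) := by
    rw [show (2 * ((n : A) - 1)) = algebraMap ℝ A (2 * ((n : ℝ) - 1)) by
        rw [map_mul, map_sub, map_one, map_natCast, map_ofNat],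
      ← map_mul, ← map_neg]
    congr 1
    field_simp
    ring
  have h3 : along D ξ (confPot D g H)
      = algebraMap ℝ A (((n : ℝ) - 2) / (4 * ((n : ℝ) - 1))) * along D ξ (scal D g H) := by
    rw [confPot]; simp
  rw [h3, h.lie_scal hD hs hgH hHg, confPot]
  linear_combination -(lap D g H ψ) * h2

end Curvature

/-! ### The algebra of smooth functions on U and its partial derivatives. -/

section SmoothFunctions

variable {n : ℕ} {U : Opens (Fin n → ℝ)}

theorem pd_congr {F G : (Fin n → ℝ) → ℝ} (h : ∀ x ∈ U, F x = G x) (i : Fin n) {x : Fin n → ℝ}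
    (hx : x ∈ U) : pd i F x = pd i G x := by
  have : F =ᶠ[nhds x] G := by
    filter_upwards [U.isOpen.mem_nhds hx] with y hy using h y hy
  unfold pd
  rw [this.fderiv_eq]

theorem contDiffOn_pd {F : (Fin n → ℝ) → ℝ} (hF : ContDiffOn ℝ ∞ F U) (i : Fin n) :
    ContDiffOn ℝ ∞ (pd i F) U := by
  have h := hF.fderiv_of_isOpen (m := ∞) U.isOpen (by norm_num)
  exact h.clm_apply contDiffOn_const

theorem ContDiffOn.differentiableAt_opens {E : Type*} [NormedAddCommGroup E] [NormedSpace ℝ E]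
    {F : (Fin n → ℝ) → E} (hF : ContDiffOn ℝ ∞ F U) {x : Fin n → ℝ} (hx : x ∈ U) :
    DifferentiableAt ℝ F x :=
  (hF.contDiffAt (U.isOpen.mem_nhds hx)).differentiableAt (by norm_num)

theorem pd_comm {F : (Fin n → ℝ) → ℝ} (hF : ContDiffOn ℝ ∞ F U) (i j : Fin n) {x : Fin n → ℝ}
    (hx : x ∈ U) : pd i (pd j F) x = pd j (pd i F) x := by
  have hc := hF.contDiffAt (U.isOpen.mem_nhds hx)
  have h2 : DifferentiableAt ℝ (fderiv ℝ F) x :=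
    (hc.fderiv_right (m := 1) (by norm_cast)).differentiableAt (by norm_num)
  have e : ∀ i j, pd i (pd j F) x = fderiv ℝ (fderiv ℝ F) x (Pi.single i 1) (Pi.single j 1) := by
    intro i j
    have : pd j F = fun y => fderiv ℝ F y (Pi.single j 1) := rfl
    rw [pd, this, fderiv_clm_apply h2 (differentiableAt_const _)]
    simp
  rw [e, e]
  exact (hc.isSymmSndFDerivAt (by simp; norm_cast)) _ _

open Classical in
/-- Extension by zero of a function on `U`. -/
noncomputable def zeroExtend (f : U → ℝ) (x : Fin n → ℝ) : ℝ := if h : x ∈ U then f ⟨x, h⟩ else 0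

theorem zeroExtend_apply (f : U → ℝ) {x : Fin n → ℝ} (hx : x ∈ U) :
    zeroExtend f x = f ⟨x, hx⟩ := dif_pos hx

theorem contDiffOn_zeroExtend_iff {f : U → ℝ} {F : (Fin n → ℝ) → ℝ} (h : ∀ x : U, f x = F x) :
    ContDiffOn ℝ ∞ (zeroExtend f) U ↔ ContDiffOn ℝ ∞ F U :=
  contDiffOn_congr fun x hx => (zeroExtend_apply f hx).trans (h ⟨x, hx⟩)

variable (U) in
/-- The smooth functions on `U`, as a subalgebra of all functions. -/
def smoothSubalgebra : Subalgebra ℝ (U → ℝ) where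
  carrier := {f | ContDiffOn ℝ ∞ (zeroExtend f) U}
  mul_mem' {f h} hf hh := (contDiffOn_zeroExtend_iff fun x => by
    simp [zeroExtend_apply _ x.2]).2 (ContDiffOn.mul hf hh)
  add_mem' {f h} hf hh := (contDiffOn_zeroExtend_iff fun x => by
    simp [zeroExtend_apply _ x.2]).2 (ContDiffOn.add hf hh)
  algebraMap_mem' r := (contDiffOn_zeroExtend_iff (F := fun _ => r) fun _ => rfl).2 contDiffOn_const

variable (U) in
/-- The algebra of smooth functions on `U`. -/
def SmoothFun : Type := smoothSubalgebra U

noncomputable instance : CommRing (SmoothFun U) := inferInstanceAs (CommRing (smoothSubalgebra U))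

noncomputable instance : Algebra ℝ (SmoothFun U) :=
  inferInstanceAs (Algebra ℝ (smoothSubalgebra U))

/-- The smooth function on `U` given by a function which is smooth on `U`. -/
def toSmooth (F : (Fin n → ℝ) → ℝ) (hF : ContDiffOn ℝ ∞ F U) : SmoothFun U :=
  ⟨fun x => F x, (contDiffOn_zeroExtend_iff fun _ => rfl).2 hF⟩

/-- `F` agrees on `U` with the smooth function `a`. -/
def Represents (F : (Fin n → ℝ) → ℝ) (a : SmoothFun U) : Prop := ∀ x : U, F x = a.1 x

theorem represents_toSmooth (F : (Fin n → ℝ) → ℝ) (hF : ContDiffOn ℝ ∞ F U) :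
    Represents F (toSmooth F hF) := fun _ => rfl

theorem represents_zeroExtend (a : SmoothFun U) : Represents (zeroExtend a.1) a :=
  fun x => zeroExtend_apply _ x.2

theorem Represents.smooth {F : (Fin n → ℝ) → ℝ} {a : SmoothFun U} (h : Represents F a) :
    ContDiffOn ℝ ∞ F U :=
  (contDiffOn_zeroExtend_iff fun x => (h x).symm).1 a.2

/-- Partial derivatives as derivations of the algebra of smooth functions. -/
noncomputable def partialD (i : Fin n) : Derivation ℝ (SmoothFun U) (SmoothFun U) :=
  Derivation.mk'
    { toFun := fun a => toSmooth (pd i (zeroExtend a.1)) (contDiffOn_pd a.2 i)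
      map_add' := fun a b => by
        refine Subtype.ext (funext fun x => ?_)
        have h : ∀ y ∈ U, zeroExtend (a + b).1 y = zeroExtend a.1 y + zeroExtend b.1 y :=
          fun y hy => by simp only [zeroExtend_apply _ hy]; rfl
        change pd i (zeroExtend (a + b).1) x = pd i (zeroExtend a.1) x + pd i (zeroExtend b.1) x
        rw [pd_congr h i x.2, pd, fderiv_fun_add (ContDiffOn.differentiableAt_opens a.2 x.2)
          (ContDiffOn.differentiableAt_opens b.2 x.2)]
        rfl
      map_smul' := fun r a => by
        refine Subtype.ext (funext fun x => ?_)
        have h : ∀ y ∈ U, zeroExtend (r • a).1 y = r * zeroExtend a.1 y :=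
          fun y hy => by simp only [zeroExtend_apply _ hy]; rfl
        change pd i (zeroExtend (r • a).1) x = r * pd i (zeroExtend a.1) x
        rw [pd_congr h i x.2, pd, fderiv_const_mul (ContDiffOn.differentiableAt_opens a.2 x.2)]
        rfl }
    fun a b => by
      refine Subtype.ext (funext fun x => ?_)
      have h : ∀ y ∈ U, zeroExtend (a * b).1 y = zeroExtend a.1 y * zeroExtend b.1 y :=
        fun y hy => by simp only [zeroExtend_apply _ hy]; rfl
      change pd i (zeroExtend (a * b).1) x
        = a.1 x * pd i (zeroExtend b.1) x + b.1 x * pd i (zeroExtend a.1) x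
      rw [pd_congr h i x.2, pd, fderiv_fun_mul (ContDiffOn.differentiableAt_opens a.2 x.2)
        (ContDiffOn.differentiableAt_opens b.2 x.2), zeroExtend_apply _ x.2,
        zeroExtend_apply _ x.2]
      rfl

theorem Represents.pd {F : (Fin n → ℝ) → ℝ} {a : SmoothFun U} (h : Represents F a) (i : Fin n) :
    Represents (pd i F) (partialD i a) := fun x =>
  pd_congr (fun y hy => (h ⟨y, hy⟩).trans (zeroExtend_apply a.1 hy).symm) i x.2

/-- Symmetry of second derivatives, in the form demanded by the hypothesis `hD` of the formal
results. -/
theorem partialD_comm (i j : Fin n) (a : SmoothFun U) :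
    partialD i (partialD j a) = partialD j (partialD i a) := by
  have h := represents_zeroExtend a
  exact Subtype.ext (funext fun x => by
    rw [← (h.pd j).pd i x, ← (h.pd i).pd j x, pd_comm a.2 i j x.2])

/-- Evaluation of a smooth function at a point. -/
noncomputable def evalAt (x : U) : SmoothFun U →ₐ[ℝ] ℝ := (Pi.evalAlgHom ℝ (fun _ : U => ℝ) x).comp
  (smoothSubalgebra U).val

theorem evalAt_apply (x : U) (a : SmoothFun U) : evalAt x a = a.1 x := rfl

theorem SmoothFun.ext_evalAt {a b : SmoothFun U} (h : ∀ x, evalAt x a = evalAt x b) : a = b :=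
  Subtype.ext (funext h)

theorem Represents.eval {F : (Fin n → ℝ) → ℝ} {a : SmoothFun U} (h : Represents F a) (x : U) :
    F x = evalAt x a := h x

/-- Used to invert the determinant of the metric, the Jacobian determinant of coordinates and the
conformal factor inside the algebra. -/
theorem SmoothFun.isUnit_of_ne_zero {a : SmoothFun U} (h : ∀ x, evalAt x a ≠ 0) : IsUnit a := by
  have hs : ContDiffOn ℝ ∞ (fun x => (zeroExtend a.1 x)⁻¹) U :=
    ContDiffOn.inv a.2 fun x hx => by
      rw [zeroExtend_apply _ hx]; exact h ⟨x, hx⟩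
  refine IsUnit.of_mul_eq_one (toSmooth _ hs) (SmoothFun.ext_evalAt fun x => ?_)
  rw [map_mul, map_one]
  change evalAt x a * (zeroExtend a.1 x)⁻¹ = 1
  rw [zeroExtend_apply _ x.2]
  exact mul_inv_cancel₀ (h x)

theorem fderiv_apply_eq_sum (F : (Fin n → ℝ) → ℝ) (x v : Fin n → ℝ) :
    fderiv ℝ F x v = ∑ k, v k * pd k F x := by
  have : v = ∑ k, v k • (Pi.single k 1 : Fin n → ℝ) := by
    ext i; simp [Finset.sum_apply, Pi.single_apply]
  conv_lhs => rw [this]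
  simp [pd]

/-- A smooth function with vanishing partial derivatives on a connected set is constant. -/
theorem exists_eq_algebraMap (hU : IsConnected (U : Set (Fin n → ℝ))) {a : SmoothFun U}
    (h : ∀ i, partialD i a = 0) : ∃ r : ℝ, a = algebraMap ℝ (SmoothFun U) r := by
  have hd : DifferentiableOn ℝ (zeroExtend a.1) U := fun x hx =>
    (ContDiffOn.differentiableAt_opens a.2 hx).differentiableWithinAt
  have hz : (U : Set (Fin n → ℝ)).EqOn (fderiv ℝ (zeroExtend a.1)) 0 := by
    intro x hx
    ext v
    rw [fderiv_apply_eq_sum]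
    refine Finset.sum_eq_zero fun k _ => ?_
    rw [(represents_zeroExtend a).pd k ⟨x, hx⟩, h k]
    exact mul_zero _
  obtain ⟨r, hr⟩ := U.isOpen.exists_is_const_of_fderiv_eq_zero hU.isPreconnected hd hz
  exact ⟨r, SmoothFun.ext_evalAt fun x => by
    rw [AlgHom.commutes, ← (represents_zeroExtend a).eval x]; exact hr x x.2⟩

end SmoothFunctions

/-! ### Translating between pointwise geometry and the formal calculus. -/

section Representation

variable {n : ℕ} {U : Opens (Fin n → ℝ)} {g : (Fin n → ℝ) → Matrix (Fin n) (Fin n) ℝ}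

/-- The metric as a matrix over the algebra of smooth functions. -/
def IsMetricOn.mat (hg : IsMetricOn g U) : Matrix (Fin n) (Fin n) (SmoothFun U) :=
  of fun i j => toSmooth (fun x => g x i j) (hg.smooth i j)

/-- The inverse metric as a matrix over the algebra of smooth functions. -/
noncomputable def IsMetricOn.inv (hg : IsMetricOn g U) : Matrix (Fin n) (Fin n) (SmoothFun U) :=
  hg.mat⁻¹

variable (hg : IsMetricOn g U)

theorem IsMetricOn.map_evalAt (x : U) : hg.mat.map (evalAt x) = g x := rfl

theorem IsMetricOn.isUnit_det : IsUnit hg.mat.det := by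
  refine SmoothFun.isUnit_of_ne_zero fun x => ?_
  have h := (evalAt x).map_det hg.mat
  rw [h]
  exact hg.nondegenerate x x.2

theorem IsMetricOn.mat_mul_inv : hg.mat * hg.inv = 1 := mul_nonsing_inv _ hg.isUnit_det

theorem IsMetricOn.inv_mul_mat : hg.inv * hg.mat = 1 := nonsing_inv_mul _ hg.isUnit_det

theorem IsMetricOn.mat_symm : hg.matᵀ = hg.mat := by
  refine Matrix.ext fun i j => SmoothFun.ext_evalAt fun x => ?_
  exact (hg.symm x x.2 i j).symm

theorem IsMetricOn.represents_mat (i j : Fin n) :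
    Represents (fun x => g x i j) (hg.mat i j) := fun _ => rfl

/-- A left inverse of a square matrix is unique, so inverting over the algebra and then evaluating
agrees with inverting pointwise. -/
theorem IsMetricOn.map_evalAt_inv (x : U) : hg.inv.map (evalAt x) = (g x)⁻¹ := by
  have h : hg.inv.map (evalAt x) * g x = 1 := by
    rw [← hg.map_evalAt x, ← Matrix.map_mul, hg.inv_mul_mat]
    simp [Matrix.map_one]
  exact (inv_eq_left_inv h).symm

theorem IsMetricOn.represents_inv (i j : Fin n) :
    Represents (fun x => (g x)⁻¹ i j) (hg.inv i j) := fun x => by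
  change (g x)⁻¹ i j = _
  rw [← hg.map_evalAt_inv x]; rfl

theorem IsMetricOn.represents_christoffel (k i j : Fin n) :
    Represents (christoffel g k i j) (chr partialD hg.mat hg.inv k i j) := fun x => by
  rw [← evalAt_apply]
  simp only [chr, map_mul, map_sum, map_sub, map_add, AlgHom.commutes, christoffel,
    (hg.represents_inv _ _).eval x, ((hg.represents_mat _ _).pd _).eval x]
  rfl

theorem IsMetricOn.represents_contractedChristoffel (k : Fin n) :
    Represents (contractedChristoffel g k) (cchr partialD hg.mat hg.inv k) := fun x => by
  rw [← evalAt_apply]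
  simp only [cchr, map_mul, map_sum, contractedChristoffel,
    (hg.represents_inv _ _).eval x, (hg.represents_christoffel _ _ _).eval x]

theorem IsMetricOn.represents_laplacian {F : (Fin n → ℝ) → ℝ} {a : SmoothFun U}
    (h : Represents F a) : Represents (laplacian g F) (lap partialD hg.mat hg.inv a) := fun x => by
  rw [← evalAt_apply]
  simp only [lap, map_mul, map_sum, map_sub, laplacian, (hg.represents_inv _ _).eval x,
    (hg.represents_contractedChristoffel _).eval x, ((h.pd _).pd _).eval x, (h.pd _).eval x]

theorem IsMetricOn.represents_hessian {F : (Fin n → ℝ) → ℝ} {a : SmoothFun U}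
    (h : Represents F a) (i j : Fin n) :
    Represents (hessian g F i j) (covHess partialD hg.mat hg.inv a i j) := fun x => by
  rw [← evalAt_apply]
  simp only [covHess, of_apply, map_mul, map_sum, map_sub, hessian,
    (hg.represents_christoffel _ _ _).eval x, ((h.pd _).pd _).eval x, (h.pd _).eval x]

theorem IsMetricOn.represents_ricci (i j : Fin n) :
    Represents (ricci g i j) (ric partialD hg.mat hg.inv i j) := fun x => by
  rw [← evalAt_apply]
  simp only [ric, curv, of_apply, map_mul, map_sum, map_sub, map_add, ricci, Matrix.add_apply,
    Matrix.sub_apply, mul_apply, Matrix.map_apply, chrMat_apply,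
    ← (hg.represents_christoffel _ _ _).eval x,
    ← ((hg.represents_christoffel _ _ _).pd _).eval x]
  refine Finset.sum_congr rfl fun k _ => ?_
  rw [Finset.sum_sub_distrib]
  -- The matrix products have the lower indices of Γ in the opposite order to `ricci`; symmetry of Γ
  -- reconciles them.
  have e : ∀ l m p, christoffel g l m p x = christoffel g l p m x := fun l m p => by
    rw [(hg.represents_christoffel l m p).eval x, (hg.represents_christoffel l p m).eval x,
      chr_symm hg.mat_symm]
  congr 2
  · exact Finset.sum_congr rfl fun l _ => by rw [e k k l]
  · exact Finset.sum_congr rfl fun l _ => by rw [e k j l]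

theorem IsMetricOn.represents_scalarCurvature :
    Represents (scalarCurvature g) (scal partialD hg.mat hg.inv) := fun x => by
  rw [← evalAt_apply]
  simp only [scal, map_mul, map_sum, scalarCurvature, (hg.represents_inv _ _).eval x,
    (hg.represents_ricci _ _).eval x]

theorem represents_along {F : (Fin n → ℝ) → ℝ} {a : SmoothFun U} (h : Represents F a)
    {ξ : (Fin n → ℝ) → (Fin n → ℝ)} {v : Fin n → SmoothFun U}
    (hv : ∀ k, Represents (fun x => ξ x k) (v k)) :
    Represents (fun x => ∑ k, ξ x k * pd k F x) (along partialD v a) := fun x => by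
  rw [← evalAt_apply]
  simp only [along_apply, map_sum, map_mul, (h.pd _).eval x, (hv _).eval x]

/-- The bridge by which every formal result on `ConformalKilling` applies to actual vector fields,
and back. -/
theorem IsMetricOn.isCKV_iff {ξ : (Fin n → ℝ) → (Fin n → ℝ)} {ψ : (Fin n → ℝ) → ℝ}
    {v : Fin n → SmoothFun U} {p : SmoothFun U}
    (hv : ∀ k, Represents (fun x => ξ x k) (v k)) (hp : Represents ψ p) :
    IsCKV g U ξ ψ ↔ ConformalKilling partialD hg.mat v p := by
  have hs : ContDiffOn ℝ ∞ ξ U := contDiffOn_pi.2 fun k => (hv k).smooth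
  have e : ∀ (x : U) i j, evalAt x ((hg.mat.map (along partialD v) + (jac partialD v)ᵀ * hg.mat
      + hg.mat * jac partialD v) i j) = ∑ k, (ξ x k * pd k (fun y => g y i j) x
        + g x k j * pd i (fun y => ξ y k) x + g x i k * pd j (fun y => ξ y k) x) := by
    intro x i j
    simp only [Matrix.add_apply, Matrix.map_apply, mul_apply, along_apply, transpose_apply,
      jac_apply, map_add, map_sum, map_mul, ← ((hv _).pd _).eval x, ← (hv _).eval x,
      ← ((hg.represents_mat _ _).pd _).eval x, ← (hg.represents_mat _ _).eval x,
      Finset.sum_add_distrib]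
    congr 2
    exact Finset.sum_congr rfl fun k _ => mul_comm _ _
  have e' : ∀ (x : U) i j, evalAt x (((2 * p) • hg.mat) i j) = 2 * ψ x * g x i j := by
    intro x i j
    rw [Matrix.smul_apply, smul_eq_mul, map_mul, map_mul, ← hp.eval x,
      ← (hg.represents_mat _ _).eval x, map_ofNat]
  constructor
  · intro h
    refine Matrix.ext fun i j => SmoothFun.ext_evalAt fun x => ?_
    rw [e, e']
    exact h.lie_deriv x x.2 i j
  · intro h
    refine ⟨hs, hp.smooth, fun x hx i j => ?_⟩
    rw [← e ⟨x, hx⟩ i j, ← e' ⟨x, hx⟩ i j]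
    exact congrArg _ (congrFun (congrFun h i) j)

theorem IsCKV.represents {ξ : (Fin n → ℝ) → (Fin n → ℝ)} {ψ : (Fin n → ℝ) → ℝ}
    (h : IsCKV g U ξ ψ) : ∃ (v : Fin n → SmoothFun U) (p : SmoothFun U),
      (∀ k, Represents (fun x => ξ x k) (v k)) ∧ Represents ψ p :=
  ⟨fun k => toSmooth _ (contDiffOn_pi.1 h.smooth_field k), toSmooth _ h.smooth_factor,
    fun _ => represents_toSmooth _ _, represents_toSmooth _ _⟩

theorem IsMetricOn.represents_confPot :
    Represents (conformalPotential g) (confPot partialD hg.mat hg.inv) := fun x => by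
  rw [← evalAt_apply, confPot, map_mul, AlgHom.commutes, ← hg.represents_scalarCurvature.eval x]
  simp [conformalPotential, ricciScalar]

theorem IsMetricOn.represents_kgSymmetryExpr {V ψ : (Fin n → ℝ) → ℝ}
    {ξ : (Fin n → ℝ) → (Fin n → ℝ)} {v : Fin n → SmoothFun U} {w p : SmoothFun U}
    (hV : Represents V w) (hv : ∀ k, Represents (fun x => ξ x k) (v k)) (hp : Represents ψ p) :
    Represents (kgSymmetryExpr g V ξ ψ) (along partialD v w + 2 * p * w
      - algebraMap ℝ _ ((2 - (n : ℝ)) / 2) * lap partialD hg.mat hg.inv p) := fun x => by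
  rw [← evalAt_apply]
  simp only [kgSymmetryExpr, map_sub, map_add, map_mul, AlgHom.commutes, map_ofNat,
    ← (represents_along hV hv).eval x, ← hV.eval x, ← hp.eval x,
    ← (hg.represents_laplacian hp).eval x]
  rfl

/-- The symmetry condition for a potential of the form `-(n-2)/(4(n-1)) R + Vbar`. -/
theorem IsMetricOn.kgSymmetryExpr_eq (hg : IsMetricOn g U) (hn : 2 ≤ n) {V Vbar : (Fin n → ℝ) → ℝ}
    (hVbar : ContDiffOn ℝ ∞ Vbar U)
    (hV : ∀ x ∈ U, V x = -(((n : ℝ) - 2) / (4 * ((n : ℝ) - 1))) * ricciScalar g x + Vbar x)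
    {ξ : (Fin n → ℝ) → (Fin n → ℝ)} {ψ : (Fin n → ℝ) → ℝ} (h : IsCKV g U ξ ψ) {x : Fin n → ℝ}
    (hx : x ∈ U) :
    kgSymmetryExpr g V ξ ψ x = ∑ k, ξ x k * pd k Vbar x + 2 * ψ x * Vbar x := by
  obtain ⟨v, p, hv, hp⟩ := h.represents
  have hc := (hg.isCKV_iff hv hp).1 h
  have hb := represents_toSmooth Vbar hVbar
  have hVr : Represents V (confPot partialD hg.mat hg.inv + toSmooth Vbar hVbar) := fun y => by
    rw [hV y y.2, ← evalAt_apply, map_add, ← hg.represents_confPot.eval y, ← hb.eval y]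
    rfl
  rw [(hg.represents_kgSymmetryExpr hVr hv hp).eval ⟨x, hx⟩,
    (represents_along hb hv).eval ⟨x, hx⟩, hp.eval ⟨x, hx⟩, hb.eval ⟨x, hx⟩]
  have h1 := congrArg (evalAt ⟨x, hx⟩) (hc.lie_confPot hn partialD_comm hg.mat_symm
    hg.mat_mul_inv hg.inv_mul_mat)
  simp only [map_sub, map_add, map_mul, map_ofNat] at h1 ⊢
  linear_combination h1

end Representation

/-! ### Explicit formulas for second prolongations. -/

section Prolongation

variable {n : ℕ} {U : Opens (Fin n → ℝ)}

/-- A total derivative depends on the jet through the point where dF is taken and through the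
direction; the product rule gives one term for each. -/
theorem fderiv_totalD0 {F : Jet0 n → ℝ} {z : Jet1 n} (hF : ContDiffAt ℝ ∞ F z.1) (i : Fin n)
    (δ : Jet1 n) :
    fderiv ℝ (totalD0 F i) z δ
      = fderiv ℝ (fderiv ℝ F) z.1 δ.1 (Pi.single i 1, z.2 i) + δ.2 i * fderiv ℝ F z.1 (0, 1) := by
  have h1 : DifferentiableAt ℝ (fderiv ℝ F) z.1 :=
    (hF.fderiv_right (m := 1) (by norm_cast)).differentiableAt (by norm_num)
  have h2 : HasFDerivAt (fun w : Jet1 n => fderiv ℝ F w.1)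
      ((fderiv ℝ (fderiv ℝ F) z.1).comp (ContinuousLinearMap.fst ℝ _ _)) z :=
    HasFDerivAt.comp (g := fderiv ℝ F) z h1.hasFDerivAt hasFDerivAt_fst
  have h3 : HasFDerivAt (fun w : Jet1 n => ((Pi.single i 1, w.2 i) : Jet0 n))
      ((0 : Jet1 n →L[ℝ] (Fin n → ℝ)).prod ((ContinuousLinearMap.proj i).comp
        (ContinuousLinearMap.snd ℝ _ _))) z :=
    (hasFDerivAt_const _ _).prodMk
      ((ContinuousLinearMap.proj (R := ℝ) (φ := fun _ : Fin n => ℝ) i).comp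
        (ContinuousLinearMap.snd ℝ (Jet0 n) (Fin n → ℝ))).hasFDerivAt
  have h4 := (h2.clm_apply h3).fderiv
  change fderiv ℝ (fun w : Jet1 n => fderiv ℝ F w.1 (Pi.single i 1, w.2 i)) z δ = _
  rw [h4]
  have h5 : ((0, δ.2 i) : Jet0 n) = δ.2 i • ((0, 1) : Jet0 n) := by simp
  simp only [_root_.add_apply, ContinuousLinearMap.comp_apply,
    ContinuousLinearMap.flip_apply, ContinuousLinearMap.prod_apply, _root_.zero_apply,
    ContinuousLinearMap.coe_fst', ContinuousLinearMap.coe_snd', ContinuousLinearMap.proj_apply]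
  rw [h5, map_smul, smul_eq_mul, add_comm]

/-- The second prolongation coefficient in terms of derivatives of the vector field. -/
theorem prolongCoeff2_eq {X : Jet0 n → Jet0 n} {z : Jet2 n} (hX : ContDiffAt ℝ ∞ X z.1.1)
    (i j : Fin n) :
    prolongCoeff2 X i j z
      = fderiv ℝ (fderiv ℝ fun w => (X w).2) z.1.1 (Pi.single j 1, z.1.2 j)
          (Pi.single i 1, z.1.2 i)
        + z.2 j i * fderiv ℝ (fun w => (X w).2) z.1.1 (0, 1)
        - ∑ m, (z.2 j m * fderiv ℝ (fun w => (X w).1 m) z.1.1 (Pi.single i 1, z.1.2 i)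
          + z.1.2 m * (fderiv ℝ (fderiv ℝ fun w => (X w).1 m) z.1.1 (Pi.single j 1, z.1.2 j)
              (Pi.single i 1, z.1.2 i)
            + z.2 j i * fderiv ℝ (fun w => (X w).1 m) z.1.1 (0, 1)))
        - ∑ m, z.2 i m * fderiv ℝ (fun w => (X w).1 m) z.1.1 (Pi.single j 1, z.1.2 j) := by
  obtain ⟨h2, h1⟩ := contDiffAt_parts hX
  have hp : ∀ m, HasFDerivAt (fun w : Jet1 n => w.2 m)
      ((ContinuousLinearMap.proj m).comp (ContinuousLinearMap.snd ℝ (Jet0 n) (Fin n → ℝ))) z.1 :=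
    fun m => ((ContinuousLinearMap.proj (R := ℝ) (φ := fun _ : Fin n => ℝ) m).comp
        (ContinuousLinearMap.snd ℝ (Jet0 n) (Fin n → ℝ))).hasFDerivAt
  have hd := ((totalD0_diff h2 i).hasFDerivAt.fun_sub (HasFDerivAt.fun_sum (u := Finset.univ)
    fun m _ => (hp m).fun_mul (totalD0_diff (h1 m) i).hasFDerivAt)).fderiv
  have e : totalD1 (prolongCoeff1 X i) j z
      = fderiv ℝ (fun w : Jet1 n => totalD0 (fun w => (X w).2) i w -
        ∑ m, w.2 m * totalD0 (fun w => (X w).1 m) i w) z.1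
          ((Pi.single j 1, z.1.2 j), fun m => z.2 j m) := rfl
  unfold prolongCoeff2
  rw [e, hd]
  simp only [_root_.sub_apply, _root_.sum_apply,
    _root_.add_apply, _root_.smul_apply, smul_eq_mul,
    ContinuousLinearMap.comp_apply, ContinuousLinearMap.coe_snd', ContinuousLinearMap.proj_apply,
    fderiv_totalD0 h2, fderiv_totalD0 (h1 _)]
  congr 2
  refine Finset.sum_congr rfl fun m _ => ?_
  simp only [totalD0]
  ring

theorem prolongCoeff1_eq (X : Jet0 n → Jet0 n) (z : Jet1 n) (i : Fin n) :
    prolongCoeff1 X i z = fderiv ℝ (fun w => (X w).2) z.1 (Pi.single i 1, z.2 i)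
      - ∑ m, z.2 m * fderiv ℝ (fun w => (X w).1 m) z.1 (Pi.single i 1, z.2 i) := rfl

/-- The derivative of the Klein-Gordon function on the second jet space. -/
theorem fderiv_kleinGordon {g : (Fin n → ℝ) → Matrix (Fin n) (Fin n) ℝ} (hg : IsMetricOn g U)
    {V : (Fin n → ℝ) → ℝ} (hV : ContDiffOn ℝ ∞ V U) {z : Jet2 n} (hz : z.1.1.1 ∈ U)
    (δ : Jet2 n) :
    fderiv ℝ (kleinGordon g V) z δ
      = ∑ i, ∑ j, (fderiv ℝ (fun x => (g x)⁻¹ i j) z.1.1.1 δ.1.1.1 * z.2 i j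
          + (g z.1.1.1)⁻¹ i j * δ.2 i j)
        - ∑ k, (fderiv ℝ (contractedChristoffel g k) z.1.1.1 δ.1.1.1 * z.1.2 k
          + contractedChristoffel g k z.1.1.1 * δ.1.2 k)
        - (fderiv ℝ V z.1.1.1 δ.1.1.1 * z.1.1.2 + V z.1.1.1 * δ.1.1.2) := by
  have h0 : HasFDerivAt (fun w : Jet2 n => w) (.id ℝ (Jet2 n)) z := hasFDerivAt_id z
  have hx : HasFDerivAt (fun w : Jet2 n => w.1.1.1) _ z := h0.fst.fst.fst
  have hu : HasFDerivAt (fun w : Jet2 n => w.1.1.2) _ z := h0.fst.fst.snd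
  have hp : ∀ k, HasFDerivAt (fun w : Jet2 n => w.1.2 k) _ z :=
    hasFDerivAt_pi'.1 h0.fst.snd
  have hq : ∀ i j, HasFDerivAt (fun w : Jet2 n => w.2 i j) _ z := fun i =>
    hasFDerivAt_pi'.1 (hasFDerivAt_pi'.1 h0.snd i)
  have hc : ∀ {F : (Fin n → ℝ) → ℝ}, ContDiffOn ℝ ∞ F U →
      HasFDerivAt (fun w : Jet2 n => F w.1.1.1) ((fderiv ℝ F z.1.1.1).comp _) z := fun hF =>
    HasFDerivAt.comp (g := _) z (ContDiffOn.differentiableAt_opens hF hz).hasFDerivAt hx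
  have h := (((HasFDerivAt.fun_sum (u := Finset.univ) fun i _ =>
    HasFDerivAt.fun_sum (u := Finset.univ) fun j _ =>
      (hc (hg.represents_inv i j).smooth).fun_mul (hq i j)).fun_sub
    (HasFDerivAt.fun_sum (u := Finset.univ) fun k _ =>
      (hc (hg.represents_contractedChristoffel k).smooth).fun_mul (hp k))).fun_sub
    ((hc hV).fun_mul hu)).fderiv
  have e : kleinGordon g V = fun w : Jet2 n => ∑ i, ∑ j, (g w.1.1.1)⁻¹ i j * w.2 i j
      - ∑ k, contractedChristoffel g k w.1.1.1 * w.1.2 k - V w.1.1.1 * w.1.1.2 := rfl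
  rw [e, h]
  simp only [_root_.sub_apply, _root_.sum_apply,
    _root_.add_apply, _root_.smul_apply, smul_eq_mul,
    ContinuousLinearMap.comp_apply, ContinuousLinearMap.coe_fst', ContinuousLinearMap.coe_snd',
    ContinuousLinearMap.proj_apply, ContinuousLinearMap.id_apply]
  congr 1
  · congr 1
    · exact Finset.sum_congr rfl fun i _ => Finset.sum_congr rfl fun j _ => by ring
    · exact Finset.sum_congr rfl fun i _ => by ring
  · ring

/-- The prolongation of a vector field `ξ(x) ∂_x + (α(x) u + b(x)) ∂_u`, first order. -/
theorem prolongCoeff1_affine {X : Jet0 n → Jet0 n} {ξ : (Fin n → ℝ) → (Fin n → ℝ)}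
    {α b : (Fin n → ℝ) → ℝ} (hξ : ContDiffOn ℝ ∞ ξ U) (hα : ContDiffOn ℝ ∞ α U)
    (hb : ContDiffOn ℝ ∞ b U)
    (hX : ∀ x ∈ U, ∀ u : ℝ, X (x, u) = (ξ x, α x * u + b x)) (i : Fin n) {z : Jet1 n}
    (hz : z.1.1 ∈ U) :
    prolongCoeff1 X i z = pd i α z.1.1 * z.1.2 + pd i b z.1.1 + α z.1.1 * z.2 i
      - ∑ m, z.2 m * pd i (fun x => ξ x m) z.1.1 := by
  have hev : ∀ᶠ w : Jet0 n in nhds z.1, w.1 ∈ U :=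
    (continuous_fst.tendsto z.1).eventually (U.isOpen.mem_nhds hz)
  have e1 : (fun w => (X w).2) =ᶠ[nhds z.1] fun w => α w.1 * w.2 + b w.1 := by
    filter_upwards [hev] with w hw
    rw [show w = (w.1, w.2) from rfl, hX _ hw]
  have e2 : ∀ m, (fun w => (X w).1 m) =ᶠ[nhds z.1] fun w => ξ w.1 m := fun m => by
    filter_upwards [hev] with w hw
    rw [show w = (w.1, w.2) from rfl, hX _ hw]
  have hc : ∀ {F : (Fin n → ℝ) → ℝ}, ContDiffOn ℝ ∞ F U →
      HasFDerivAt (fun w : Jet0 n => F w.1) ((fderiv ℝ F z.1.1).comp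
        (ContinuousLinearMap.fst ℝ (Fin n → ℝ) ℝ)) z.1 := fun hF =>
    HasFDerivAt.comp (g := _) z.1 (ContDiffOn.differentiableAt_opens hF hz).hasFDerivAt
      hasFDerivAt_fst
  have h1 : fderiv ℝ (fun w : Jet0 n => α w.1 * w.2 + b w.1) z.1 = _ :=
    (((hc hα).fun_mul hasFDerivAt_snd).fun_add (hc hb)).fderiv
  have h2 : ∀ m, fderiv ℝ (fun w : Jet0 n => ξ w.1 m) z.1 = _ := fun m =>
    (hc (contDiffOn_pi.1 hξ m)).fderiv
  rw [prolongCoeff1_eq, e1.fderiv_eq, h1]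
  simp only [(e2 _).fderiv_eq, h2]
  simp only [_root_.add_apply, _root_.smul_apply, smul_eq_mul,
    ContinuousLinearMap.comp_apply, ContinuousLinearMap.coe_fst', ContinuousLinearMap.coe_snd']
  simp only [pd]
  ring

/-- The prolongation of a vector field `ξ(x) ∂_x + (α(x) u + b(x)) ∂_u`, second order. -/
theorem prolongCoeff2_affine {X : Jet0 n → Jet0 n} {ξ : (Fin n → ℝ) → (Fin n → ℝ)}
    {α b : (Fin n → ℝ) → ℝ} (hξ : ContDiffOn ℝ ∞ ξ U) (hα : ContDiffOn ℝ ∞ α U)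
    (hb : ContDiffOn ℝ ∞ b U)
    (hX : ∀ x ∈ U, ∀ u : ℝ, X (x, u) = (ξ x, α x * u + b x)) (i j : Fin n) {z : Jet2 n}
    (hz : z.1.1.1 ∈ U) :
    prolongCoeff2 X i j z = pd j (pd i α) z.1.1.1 * z.1.1.2 + pd j (pd i b) z.1.1.1
      + (z.1.2 j * pd i α z.1.1.1 + z.1.2 i * pd j α z.1.1.1) + α z.1.1.1 * z.2 j i
      - ∑ m, z.1.2 m * pd j (pd i (fun x => ξ x m)) z.1.1.1
      - ∑ m, z.2 j m * pd i (fun x => ξ x m) z.1.1.1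
      - ∑ m, z.2 i m * pd j (fun x => ξ x m) z.1.1.1 := by
  have hev : ∀ᶠ w : Jet1 n in nhds z.1, w.1.1 ∈ U :=
    ((continuous_fst.comp continuous_fst).tendsto z.1).eventually (U.isOpen.mem_nhds hz)
  have hev0 : ∀ᶠ w : Jet0 n in nhds z.1.1, w.1 ∈ U :=
    (continuous_fst.tendsto z.1.1).eventually (U.isOpen.mem_nhds hz)
  have e1 : prolongCoeff1 X i =ᶠ[nhds z.1] fun w => pd i α w.1.1 * w.1.2 + pd i b w.1.1
      + α w.1.1 * w.2 i - ∑ m, w.2 m * pd i (fun x => ξ x m) w.1.1 := by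
    filter_upwards [hev] with w hw
    exact prolongCoeff1_affine hξ hα hb hX i hw
  have e2 : ∀ m, totalD0 (fun w => (X w).1 m) j z.1 = pd j (fun x => ξ x m) z.1.1.1 := fun m => by
    have : (fun w => (X w).1 m) =ᶠ[nhds z.1.1] fun w => ξ w.1 m := by
      filter_upwards [hev0] with w hw
      rw [show w = (w.1, w.2) from rfl, hX _ hw]
    have h : HasFDerivAt (fun w : Jet0 n => ξ w.1 m) ((fderiv ℝ (fun x => ξ x m) z.1.1.1).comp
        (ContinuousLinearMap.fst ℝ (Fin n → ℝ) ℝ)) z.1.1 :=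
      HasFDerivAt.comp (g := fun x => ξ x m) z.1.1 (ContDiffOn.differentiableAt_opens
        (contDiffOn_pi.1 hξ m) hz).hasFDerivAt hasFDerivAt_fst
    rw [totalD0, this.fderiv_eq, h.fderiv]
    rfl
  have h0 : HasFDerivAt (fun w : Jet1 n => w) (.id ℝ (Jet1 n)) z.1 := hasFDerivAt_id z.1
  have hx : HasFDerivAt (fun w : Jet1 n => w.1.1) _ z.1 := h0.fst.fst
  have hu : HasFDerivAt (fun w : Jet1 n => w.1.2) _ z.1 := h0.fst.snd
  have hp : ∀ k, HasFDerivAt (fun w : Jet1 n => w.2 k) _ z.1 := hasFDerivAt_pi'.1 h0.snd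
  have hc : ∀ {F : (Fin n → ℝ) → ℝ}, ContDiffOn ℝ ∞ F U →
      HasFDerivAt (fun w : Jet1 n => F w.1.1) ((fderiv ℝ F z.1.1.1).comp _) z.1 := fun hF =>
    HasFDerivAt.comp (g := _) z.1 (ContDiffOn.differentiableAt_opens hF hz).hasFDerivAt hx
  have h : fderiv ℝ (fun w : Jet1 n => pd i α w.1.1 * w.1.2 + pd i b w.1.1
      + α w.1.1 * w.2 i - ∑ m, w.2 m * pd i (fun x => ξ x m) w.1.1) z.1 = _ :=
    (((((hc (contDiffOn_pd hα i)).fun_mul hu).fun_add (hc (contDiffOn_pd hb i))).fun_add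
      ((hc hα).fun_mul (hp i))).fun_sub (HasFDerivAt.fun_sum (u := Finset.univ) fun m _ =>
        (hp m).fun_mul (hc (contDiffOn_pd (contDiffOn_pi.1 hξ m) i)))).fderiv
  unfold prolongCoeff2
  simp only [e2]
  rw [totalD1, e1.fderiv_eq, h]
  simp only [_root_.sub_apply, _root_.sum_apply,
    _root_.add_apply, _root_.smul_apply, smul_eq_mul,
    ContinuousLinearMap.comp_apply, ContinuousLinearMap.coe_fst', ContinuousLinearMap.coe_snd',
    ContinuousLinearMap.proj_apply, ContinuousLinearMap.id_apply, Finset.sum_add_distrib]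
  have e3 : ∀ F : (Fin n → ℝ) → ℝ, fderiv ℝ F z.1.1.1 (Pi.single j 1) = pd j F z.1.1.1 :=
    fun F => rfl
  simp only [e3, mul_comm (z.2 _ _)]
  ring

end Prolongation

/-! ### Prolonging fields that are affine in u. -/

section AffineSymmetries

/-- The linear algebra at one jet: K and Λ are the derivatives along ξ of H and of the contracted
Christoffel symbols. The conformal formulas for them cancel all Jacobian and second-derivative terms
of ξ coming from the prolongation, leaving the equation times (α - 2ψ) and a polynomial in u and p.
-/
theorem affine_prolongation_identity {n : ℕ} {H Q J K B C : Matrix (Fin n) (Fin n) ℝ}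
    {S : Fin n → Matrix (Fin n) (Fin n) ℝ} {Γ Λ p a b s : Fin n → ℝ} {ψ α u w V β : ℝ}
    (hH : Hᵀ = H) (hQ : Qᵀ = Q) (hK : K = -((2 * ψ) • H) + J * H + H * Jᵀ)
    (hΛ : ∀ k, Λ k = -(2 * ψ * Γ k) + ∑ m, J k m * Γ m - frob H (S k) + (2 - n) * s k) :
    ∑ i, ∑ j, (K i j * Q i j + H i j * (B i j * u + C i j + (p j * a i + p i * a j) + α * Q j i
        - ∑ m, p m * S m i j - ∑ m, Q j m * J m i - ∑ m, Q i m * J m j))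
      - ∑ k, (Λ k * p k + Γ k * (a k * u + b k + α * p k - ∑ m, p m * J m k))
      - (w * u + V * (α * u + β))
      = (α - 2 * ψ) * (frob H Q - ∑ k, Γ k * p k - V * u)
        + ∑ k, p k * (2 * ∑ l, H k l * a l - (2 - n) * s k)
        + u * (frob H B - ∑ k, Γ k * a k - (w + 2 * ψ * V))
        + (frob H C - ∑ k, Γ k * b k - V * β) := by
  have hQ' : ∀ i j, Q j i = Q i j := fun i j => congrFun (congrFun hQ i) j
  have hH' : ∀ i j, H j i = H i j := fun i j => congrFun (congrFun hH i) j
  have e1 : ∑ i, ∑ j, (K i j * Q i j + H i j * (B i j * u + C i j + (p j * a i + p i * a j)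
        + α * Q j i - ∑ m, p m * S m i j - ∑ m, Q j m * J m i - ∑ m, Q i m * J m j))
      = frob K Q + frob H (u • B + C + (vecMulVec a p + vecMulVec p a) + α • Q
        - ∑ m, p m • S m - (Jᵀ * Q + Q * J)) := by
    simp only [frob, ← Finset.sum_add_distrib]
    refine Finset.sum_congr rfl fun i _ => Finset.sum_congr rfl fun j _ => ?_
    simp only [Matrix.sub_apply, Matrix.add_apply, Matrix.smul_apply, Matrix.sum_apply,
      vecMulVec_apply, mul_apply, transpose_apply, smul_eq_mul]
    rw [hQ' i j, show ∑ m, Q j m * J m i = ∑ m, J m i * Q m j from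
      Finset.sum_congr rfl fun m _ => by rw [hQ' m j, mul_comm]]
    ring
  have e2 : frob K Q = -(2 * ψ * frob H Q) + frob H (Jᵀ * Q + Q * J) := by
    rw [← frob_comm_jac, hK]
    simp only [frob_eq_trace, transpose_add, transpose_neg, transpose_smul, add_mul, neg_mul,
      smul_mul_assoc, trace_add, trace_neg, trace_smul, smul_eq_mul]
    ring
  have e3 : frob H (vecMulVec a p + vecMulVec p a) = ∑ k, p k * (2 * ∑ l, H k l * a l) := by
    have h1 : frob H (vecMulVec p a) = ∑ k, p k * ∑ l, H k l * a l := by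
      simp only [frob, vecMulVec_apply, Finset.mul_sum]
      exact Finset.sum_congr rfl fun i _ => Finset.sum_congr rfl fun j _ => by ring
    have h2 : frob H (vecMulVec a p) = frob H (vecMulVec p a) := by
      simp only [frob, vecMulVec_apply]
      rw [Finset.sum_comm]
      exact Finset.sum_congr rfl fun i _ => Finset.sum_congr rfl fun j _ => by rw [hH']; ring
    rw [frob_add, h2, h1, ← Finset.sum_add_distrib]
    exact Finset.sum_congr rfl fun i _ => by ring
  have e4 : ∑ k, Γ k * ∑ m, p m * J m k = ∑ k, p k * ∑ m, J k m * Γ m := by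
    simp only [Finset.mul_sum]
    rw [Finset.sum_comm]
    exact Finset.sum_congr rfl fun i _ => Finset.sum_congr rfl fun j _ => by ring
  have e5 : ∑ k, (Λ k * p k + Γ k * (a k * u + b k + α * p k - ∑ m, p m * J m k))
      = -(2 * ψ * ∑ k, Γ k * p k) - ∑ k, p k * frob H (S k) + (2 - n) * ∑ k, p k * s k
        + u * ∑ k, Γ k * a k + ∑ k, Γ k * b k + α * ∑ k, Γ k * p k := by
    have : ∑ k, (Λ k * p k + Γ k * (a k * u + b k + α * p k - ∑ m, p m * J m k))
        = ∑ k, Λ k * p k + u * ∑ k, Γ k * a k + ∑ k, Γ k * b k + α * ∑ k, Γ k * p k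
          - ∑ k, Γ k * ∑ m, p m * J m k := by
      simp only [Finset.mul_sum, ← Finset.sum_add_distrib, ← Finset.sum_sub_distrib]
      exact Finset.sum_congr rfl fun k _ => by rw [← Finset.mul_sum]; ring
    rw [this, e4]
    have h2 : ∑ k, Λ k * p k = -(2 * ψ * ∑ k, Γ k * p k) + ∑ k, p k * ∑ m, J k m * Γ m
        - ∑ k, p k * frob H (S k) + (2 - n) * ∑ k, p k * s k := by
      rw [Finset.mul_sum, Finset.mul_sum, ← Finset.sum_neg_distrib, ← Finset.sum_add_distrib,
        ← Finset.sum_sub_distrib, ← Finset.sum_add_distrib]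
      exact Finset.sum_congr rfl fun k _ => by rw [hΛ]; ring
    rw [h2]; ring
  have e6 : ∑ k, p k * (2 * ∑ l, H k l * a l - (2 - n) * s k)
      = ∑ k, p k * (2 * ∑ l, H k l * a l) - (2 - n) * ∑ k, p k * s k := by
    rw [Finset.mul_sum, ← Finset.sum_sub_distrib]
    exact Finset.sum_congr rfl fun k _ => by ring
  rw [e1, e2, e5, e6]
  simp only [frob_sub, frob_add _ (_ + _ + _), frob_add _ (_ • _),
    frob_add _ (_ + _) (_ + _), frob_smul, frob_sum, e3]
  ring

variable {n : ℕ} {U : Opens (Fin n → ℝ)} {g : (Fin n → ℝ) → Matrix (Fin n) (Fin n) ℝ}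

/-- The action on `Δu - Vu` of the prolongation of `ξ(x) ∂_x + (α(x) u + b(x)) ∂_u`, for a
conformal Killing vector `ξ`. -/
theorem prolongation_kleinGordon_affine (hg : IsMetricOn g U) {V : (Fin n → ℝ) → ℝ}
    (hV : ContDiffOn ℝ ∞ V U) {X : Jet0 n → Jet0 n} {ξ : (Fin n → ℝ) → (Fin n → ℝ)}
    {ψ α b : (Fin n → ℝ) → ℝ} (h : IsCKV g U ξ ψ) (hα : ContDiffOn ℝ ∞ α U)
    (hb : ContDiffOn ℝ ∞ b U) (hX : ∀ x ∈ U, ∀ u : ℝ, X (x, u) = (ξ x, α x * u + b x))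
    {z : Jet2 n} (hz : z.1.1.1 ∈ U) (hs : ∀ i j, z.2 i j = z.2 j i) :
    fderiv ℝ (kleinGordon g V) z (prolongation X z)
      = (α z.1.1.1 - 2 * ψ z.1.1.1) * kleinGordon g V z
        + ∑ k, z.1.2 k * (2 * ∑ l, (g z.1.1.1)⁻¹ k l * pd l α z.1.1.1
          - (2 - n) * ∑ l, (g z.1.1.1)⁻¹ k l * pd l ψ z.1.1.1)
        + z.1.1.2 * (laplacian g α z.1.1.1
          - (∑ k, ξ z.1.1.1 k * pd k V z.1.1.1 + 2 * ψ z.1.1.1 * V z.1.1.1))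
        + (laplacian g b z.1.1.1 - V z.1.1.1 * b z.1.1.1) := by
  obtain ⟨⟨⟨x, u⟩, p⟩, Q⟩ := z
  simp only at hz hs ⊢
  obtain ⟨v, q, hv, hq⟩ := h.represents
  have hc := (hg.isCKV_iff hv hq).1 h
  set y : U := ⟨x, hz⟩ with hy
  have hH := fun i j => (hg.represents_inv i j)
  have hinv := hc.inverse hg.mat_mul_inv hg.inv_mul_mat
  have hch := hc.lie_cchr partialD_comm hg.mat_symm hg.mat_mul_inv hg.inv_mul_mat
  have hXx : X (x, u) = (ξ x, α x * u + b x) := hX x hz u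
  have key := affine_prolongation_identity (H := (g x)⁻¹) (Q := of fun i j => Q i j)
    (J := of fun k m => pd m (fun x => ξ x k) x)
    (K := of fun i j => ∑ k, ξ x k * pd k (fun x => (g x)⁻¹ i j) x)
    (B := of fun i j => pd j (pd i α) x) (C := of fun i j => pd j (pd i b) x)
    (S := fun m => of fun i j => pd j (pd i (fun x => ξ x m)) x)
    (Γ := fun k => contractedChristoffel g k x)
    (Λ := fun k => ∑ l, ξ x l * pd l (contractedChristoffel g k) x) (p := p)
    (a := fun k => pd k α x) (b := fun k => pd k b x)
    (s := fun k => ∑ l, (g x)⁻¹ k l * pd l ψ x) (ψ := ψ x) (α := α x) (u := u)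
    (w := ∑ k, ξ x k * pd k V x) (V := V x) (β := b x) ?_ ?_ ?_ ?_
  · rw [fderiv_kleinGordon hg hV hz]
    simp only [prolongation, hXx, prolongCoeff1_affine h.smooth_field hα hb hX _
      (z := ((x, u), p)) hz, prolongCoeff2_affine h.smooth_field hα hb hX _ _
      (z := (((x, u), p), Q)) hz, fderiv_apply_eq_sum]
    simp only [of_apply] at key
    rw [key]
    rfl
  · have := inverse_symm hg.mat_symm hg.mat_mul_inv
    rw [← hg.map_evalAt_inv y, ← transpose_map, this]
  · exact Matrix.ext fun i j => hs j i
  · ext i j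
    have := congrArg (evalAt y) (congrFun (congrFun hinv i) j)
    simp only [Matrix.map_apply, Matrix.add_apply, Matrix.neg_apply, Matrix.smul_apply, map_add,
      map_neg, mul_apply, map_sum, map_mul, smul_eq_mul, transpose_apply, jac_apply, map_ofNat,
      ← (represents_along (hH _ _) hv).eval y, ← (hH _ _).eval y, ← hq.eval y,
      ← ((hv _).pd _).eval y] at this
    simpa [mul_apply] using this
  · intro k
    have := congrArg (evalAt y) (hch k)
    simp only [map_add, map_neg, map_sub, map_sum, map_mul, frob, hess2, of_apply, gradUp,
      map_ofNat, map_natCast,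
      ← (represents_along (hg.represents_contractedChristoffel _) hv).eval y, ← (hH _ _).eval y,
      ← hq.eval y, ← ((hv _).pd _).eval y, ← (((hv _).pd _).pd _).eval y, ← (hq.pd _).eval y,
      ← (hg.represents_contractedChristoffel _).eval y] at this
    simpa [frob] using this

end AffineSymmetries

/-! ### Linear algebra of the determining equations. -/

section DeterminingEquations

variable {n : ℕ} {H G : Matrix (Fin n) (Fin n) ℝ}

/-- A symmetric matrix which annihilates the symmetric trace-free matrices is pure trace. -/
theorem eq_smul_of_annihilates_traceFree (hn : 2 ≤ n) (hG : Gᵀ = G) (hHs : Hᵀ = H)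
    (hHG : H * G = 1) {M : Matrix (Fin n) (Fin n) ℝ} (hM : Mᵀ = M)
    (h : ∀ Q : Matrix (Fin n) (Fin n) ℝ, Qᵀ = Q → frob H Q = 0 → frob M Q = 0) :
    M = (frob M G / n) • H := by
  have hn' : (n : ℝ) ≠ 0 := by positivity
  have hs : ∀ (N : Matrix (Fin n) (Fin n) ℝ) i j, frob N (Matrix.single i j 1) = N i j := by
    intro N i j
    simp [frob, Matrix.single_apply, ite_and]
  ext i j
  -- The symmetrized elementary matrix, made trace-free by subtracting a multiple of G, using H : G
  -- = n.
  have h1 := h (Matrix.single i j 1 + Matrix.single j i 1 - (2 * H i j / n) • G) (by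
    rw [transpose_sub, transpose_add, transpose_smul, hG, Matrix.transpose_single,
      Matrix.transpose_single, add_comm]) (by
    have : H j i = H i j := congrFun (congrFun hHs i) j
    rw [frob_sub, frob_add, frob_smul, hs, hs, frob_metric hG hHG, this]
    field_simp
    ring)
  have : M j i = M i j := congrFun (congrFun hM i) j
  rw [frob_sub, frob_add, frob_smul, hs, hs, this] at h1
  rw [Matrix.smul_apply, smul_eq_mul]
  field_simp at h1 ⊢
  linarith

/-- A matrix of rank at most one is a multiple of an invertible matrix of size at least two only if
the multiple is zero. -/
theorem eq_zero_of_vecMulVec_self (hn : 2 ≤ n) (hHG : H * G = 1) {q : Fin n → ℝ} {c : ℝ}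
    (h : vecMulVec q q = c • H) : q = 0 := by
  have h1 : vecMulVec q (q ᵥ* G) = c • 1 := by
    rw [← hHG, ← smul_mul_assoc, ← h, vecMulVec_mul]
  set r := q ᵥ* G
  have h2 : ∀ i k, q i * r k = if i = k then c else 0 := fun i k => by
    have := congrFun (congrFun h1 i) k
    simpa [vecMulVec_apply, one_apply] using this
  have hc : c = 0 := by
    by_contra hc
    -- The off-diagonal entry q_0 r_1 = 0 contradicts the nonzero diagonal entries q_0 r_0 = q_1 r_1
    -- = c.
    have h3 := h2 ⟨0, by omega⟩ ⟨1, by omega⟩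
    have h4 := h2 ⟨0, by omega⟩ ⟨0, by omega⟩
    have h5 := h2 ⟨1, by omega⟩ ⟨1, by omega⟩
    simp only [Fin.mk.injEq, zero_ne_one, if_false, if_true, mul_eq_zero] at h3 h4 h5
    rcases h3 with h3 | h3
    · rw [h3, zero_mul] at h4; exact hc h4.symm
    · rw [h3, mul_zero] at h5; exact hc h5.symm
  ext i
  have := congrFun (congrFun h i) i
  simpa [vecMulVec_apply, hc] using this

/-- For fixed p the admissible Q form an affine space over the trace-free matrices. Subtracting the
identity at the base point (s p / n) G removes everything independent of Q, as well as the terms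
proportional to the trace. -/
theorem traceFree_identity (hn : 2 ≤ n) (hG : Gᵀ = G) (hHG : H * G = 1)
    {K a : Matrix (Fin n) (Fin n) ℝ} {q : Fin n → ℝ} {c : ℝ} {R s : (Fin n → ℝ) → ℝ}
    (h : ∀ (p : Fin n → ℝ) (Q : Matrix (Fin n) (Fin n) ℝ), Qᵀ = Q → frob H Q = s p →
      ∑ i, ∑ j, (K i j * Q i j + H i j * (Q j i * c - ∑ m, (Q j m * (a m i + p i * q m)
        + p m * (Q j i * q m)) - ∑ m, Q i m * (a m j + p j * q m))) + R p = 0)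
    (p : Fin n → ℝ) (Q : Matrix (Fin n) (Fin n) ℝ) (hQ : Qᵀ = Q) (hHQ : frob H Q = 0) :
    frob (K - (a + vecMulVec q p) * H - H * (a + vecMulVec q p)ᵀ) Q = 0 := by
  have hn' : (n : ℝ) ≠ 0 := by positivity
  set l := a + vecMulVec q p with hl
  have e : ∀ Q : Matrix (Fin n) (Fin n) ℝ, Qᵀ = Q →
      ∑ i, ∑ j, (K i j * Q i j + H i j * (Q j i * c - ∑ m, (Q j m * (a m i + p i * q m)
        + p m * (Q j i * q m)) - ∑ m, Q i m * (a m j + p j * q m)))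
      = frob K Q + (c - ∑ m, p m * q m) * frob H Q - frob H (lᵀ * Q + Q * l) := by
    intro Q hQ
    have hQ' : ∀ i j, Q j i = Q i j := fun i j => congrFun (congrFun hQ i) j
    have hl' : ∀ m i, a m i + p i * q m = l m i := fun m i => by
      simp [hl, vecMulVec_apply, mul_comm]
    rw [← frob_smul, add_sub_assoc, ← frob_sub]
    simp only [frob, ← Finset.sum_add_distrib]
    refine Finset.sum_congr rfl fun i _ => Finset.sum_congr rfl fun j _ => ?_
    simp only [Matrix.sub_apply, Matrix.smul_apply, Matrix.add_apply, mul_apply, transpose_apply,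
      smul_eq_mul, hl', Finset.sum_add_distrib]
    rw [show ∑ m, l m i * Q m j = ∑ m, Q j m * l m i from
      Finset.sum_congr rfl fun m _ => by rw [hQ' m j, mul_comm], hQ' i j, sub_mul, Finset.sum_mul,
      show ∑ m, p m * (Q i j * q m) = ∑ m, p m * q m * Q i j from
      Finset.sum_congr rfl fun m _ => by ring]
    ring
  have hG0 : ((s p / n) • G)ᵀ = (s p / n) • G := by rw [transpose_smul, hG]
  have h0 := h p ((s p / n) • G) hG0 (by
    rw [frob_smul, frob_metric hG hHG]; field_simp)
  have hQ1 : ((s p / n) • G + Q)ᵀ = (s p / n) • G + Q := by rw [transpose_add, hG0, hQ]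
  have h1 := h p ((s p / n) • G + Q) hQ1 (by
    rw [frob_add, frob_smul, frob_metric hG hHG, hHQ]; field_simp; ring)
  rw [e _ hG0] at h0
  rw [e _ hQ1] at h1
  have e2 : frob (K - l * H - H * lᵀ) Q = frob K Q - frob H (lᵀ * Q + Q * l) := by
    rw [← frob_comm_jac]
    simp only [frob_eq_trace, transpose_add, transpose_sub, add_mul, sub_mul, trace_add, trace_sub]
    ring
  rw [e2]
  simp only [mul_add, add_mul, frob_add] at h0 h1 ⊢
  rw [hHQ] at h1
  linear_combination h1 - h0

/-- The identities at p = 0 and p = G q differ by twice q qᵀ, which therefore annihilates trace-free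
matrices and is a multiple of H. -/
theorem eq_zero_of_traceFree_identity (hn : 2 ≤ n) (hG : Gᵀ = G) (hHs : Hᵀ = H) (hHG : H * G = 1)
    {K a : Matrix (Fin n) (Fin n) ℝ} {q : Fin n → ℝ}
    (h : ∀ (p : Fin n → ℝ) (Q : Matrix (Fin n) (Fin n) ℝ), Qᵀ = Q → frob H Q = 0 →
      frob (K - (a + vecMulVec q p) * H - H * (a + vecMulVec q p)ᵀ) Q = 0) : q = 0 := by
  have h2 := eq_smul_of_annihilates_traceFree hn hG hHs hHG (M := vecMulVec q q)
    (by rw [transpose_vecMulVec]) fun Q hQ hHQ => by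
      have h0 := h 0 Q hQ hHQ
      have h1 := h (G *ᵥ q) Q hQ hHQ
      have e1 : vecMulVec q (G *ᵥ q) * H = vecMulVec q q := by
        rw [vecMulVec_mul]
        congr 1
        rw [← mulVec_transpose, hHs, mulVec_mulVec, hHG, one_mulVec]
      have e2 : H * (vecMulVec q (G *ᵥ q))ᵀ = vecMulVec q q := by
        rw [transpose_vecMulVec, mul_vecMulVec, mulVec_mulVec, hHG, one_mulVec]
      rw [transpose_add, add_mul, mul_add, e1, e2] at h1
      have e3 : vecMulVec q (0 : Fin n → ℝ) = 0 := by ext; simp [vecMulVec_apply]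
      rw [e3, add_zero] at h0
      simp only [frob_eq_trace, transpose_add, transpose_sub, add_mul, sub_mul, trace_add,
        trace_sub] at h0 h1 ⊢
      linarith
  exact eq_zero_of_vecMulVec_self hn hHG h2

/-- The sole term quadratic in p is γ H(p,p); the second difference h(p) + h(-p) - 2h(0) isolates
it. -/
theorem quadratic_coeff_eq_zero (hn : 2 ≤ n) (hHs : Hᵀ = H) (hHG : H * G = 1)
    {B a : Matrix (Fin n) (Fin n) ℝ} {b : Fin n → Matrix (Fin n) (Fin n) ℝ}
    {Γ Λ η β β' : Fin n → ℝ} {γ c d e f : ℝ}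
    (h : ∀ p : Fin n → ℝ, d * (∑ k, Γ k * p k + e)
      + ∑ i, ∑ j, H i j * (B i j + p j * β i + p i * β' j + p i * p j * γ - ∑ m, p m * b m i j)
      - ∑ k, (Λ k * p k + Γ k * (η k + p k * c - ∑ m, p m * a m k)) - f = 0) : γ = 0 := by
  by_contra hγ
  have h1 : ∀ p : Fin n → ℝ, ∑ i, ∑ j, H i j * (p i * p j) = 0 := by
    intro p
    have e1 := h p
    have e2 := h (-p)
    have e3 := h 0
    have : 2 * γ * ∑ i, ∑ j, H i j * (p i * p j) = 0 := by
      have s1 : ∀ p : Fin n → ℝ, ∑ i, ∑ j, H i j * (B i j + p j * β i + p i * β' j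
          + p i * p j * γ - ∑ m, p m * b m i j) = ∑ i, ∑ j, H i j * B i j
          + ∑ i, ∑ j, H i j * (p j * β i + p i * β' j - ∑ m, p m * b m i j)
          + γ * ∑ i, ∑ j, H i j * (p i * p j) := by
        intro p
        simp only [Finset.mul_sum _ _ γ, ← Finset.sum_add_distrib]
        exact Finset.sum_congr rfl fun i _ => Finset.sum_congr rfl fun j _ => by ring
      have s2 : ∀ p : Fin n → ℝ, ∑ k, (Λ k * p k + Γ k * (η k + p k * c - ∑ m, p m * a m k))
          = ∑ k, Γ k * η k + ∑ k, (Λ k * p k + Γ k * (p k * c - ∑ m, p m * a m k)) := by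
        intro p
        simp only [← Finset.sum_add_distrib]
        exact Finset.sum_congr rfl fun i _ => by ring
      rw [s1, s2] at e1 e2 e3
      have s3 : ∑ i, ∑ j, H i j * ((-p) j * β i + (-p) i * β' j - ∑ m, (-p) m * b m i j)
          = -∑ i, ∑ j, H i j * (p j * β i + p i * β' j - ∑ m, p m * b m i j) := by
        simp only [← Finset.sum_neg_distrib, Pi.neg_apply]
        refine Finset.sum_congr rfl fun i _ => Finset.sum_congr rfl fun j _ => ?_
        simp only [neg_mul, Finset.sum_neg_distrib]
        ring
      have s4 : ∑ k, (Λ k * (-p) k + Γ k * ((-p) k * c - ∑ m, (-p) m * a m k))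
          = -∑ k, (Λ k * p k + Γ k * (p k * c - ∑ m, p m * a m k)) := by
        simp only [← Finset.sum_neg_distrib, Pi.neg_apply]
        refine Finset.sum_congr rfl fun i _ => ?_
        simp only [neg_mul, Finset.sum_neg_distrib]
        ring
      rw [s3, s4] at e2
      simp only [Pi.neg_apply, neg_mul, mul_neg, neg_neg, Finset.sum_neg_distrib] at e2
      simp at e3
      linear_combination e1 + e2 - 2 * e3
    simpa [hγ] using this
  -- Polarization of the vanishing quadratic form, contradicting the invertibility of H.
  have hH0 : ∀ i j, H i j = 0 := by
    intro i j
    have hd : ∀ i, H i i = 0 := fun i => by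
      simpa [Pi.single_apply] using h1 (Pi.single i 1)
    have h2 := h1 (Pi.single i 1 + Pi.single j 1)
    have h3 : H j i = H i j := congrFun (congrFun hHs i) j
    simp only [Pi.add_apply, Pi.single_apply, add_mul, mul_add, Finset.sum_add_distrib] at h2
    simp [hd, h3] at h2
    linarith
  have h4 := congrFun (congrFun hHG ⟨0, by omega⟩) ⟨0, by omega⟩
  simp [mul_apply, hH0] at h4

end DeterminingEquations

/-! ### Formal complements: conformal Killing vectors from the inverse metric. -/

section Formal

variable {n : ℕ} {A : Type*} [CommRing A] [Algebra ℝ A] {D : Fin n → Derivation ℝ A A}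
  {g H : Matrix (Fin n) (Fin n) A}

/-- Converse of `ConformalKilling.inverse`: jets yield the equation for the inverse metric first,
and differentiating g H = 1 returns it to g. -/
theorem ConformalKilling.of_inverse (hgH : g * H = 1) (hHg : H * g = 1) {ξ : Fin n → A} {ψ : A}
    (h : H.map (along D ξ) - jac D ξ * H - H * (jac D ξ)ᵀ = -((2 * ψ) • H)) :
    ConformalKilling D g ξ ψ := by
  have h1 := map_derivation_mul (along D ξ) g H
  have h2 : H.map (along D ξ) = -((2 * ψ) • H) + jac D ξ * H + H * (jac D ξ)ᵀ := by
    rw [← h]; abel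
  rw [hgH, map_derivation_one, h2] at h1
  have h3 : (0 : Matrix (Fin n) (Fin n) A) = g.map (along D ξ) * (H * g)
      - (2 * ψ) • (g * (H * g)) + g * jac D ξ * (H * g) + (g * H) * (jac D ξ)ᵀ * g := by
    calc (0 : Matrix (Fin n) (Fin n) A) = 0 * g := by simp
      _ = _ := by
        rw [h1]
        simp only [mul_add, add_mul, mul_neg, neg_mul, mul_smul_comm, smul_mul_assoc,
          Matrix.mul_assoc]
        abel
  rw [hgH, hHg] at h3
  simp only [mul_one, one_mul] at h3
  unfold ConformalKilling
  rw [← sub_eq_zero, h3]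
  abel

theorem lap_add (a b : A) : lap D g H (a + b) = lap D g H a + lap D g H b := by
  simp only [lap, map_add, mul_add, Finset.sum_add_distrib]
  ring

theorem lap_algebraMap (r : ℝ) : lap D g H (algebraMap ℝ A r) = 0 := by
  simp [lap]

end Formal

/-! ### The base component of a symmetry is conformal Killing and independent of u. -/

section Classification

variable {n : ℕ} {U : Opens (Fin n → ℝ)} {g : (Fin n → ℝ) → Matrix (Fin n) (Fin n) ℝ}
  {V : (Fin n → ℝ) → ℝ} {X : Jet0 n → Jet0 n}

theorem kleinGordon_eq_zero_iff {w : Jet0 n} {p : Fin n → ℝ} {Q : Matrix (Fin n) (Fin n) ℝ} :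
    kleinGordon g V ((w, p), Q) = 0 ↔
      frob (g w.1)⁻¹ Q = ∑ k, contractedChristoffel g k w.1 * p k + V w.1 * w.2 := by
  change frob (g w.1)⁻¹ Q - ∑ k, contractedChristoffel g k w.1 * p k - V w.1 * w.2 = 0 ↔ _
  rw [sub_sub, sub_eq_zero]

theorem contDiffAt_of_mem {E : Type*} [NormedAddCommGroup E] [NormedSpace ℝ E] {X : Jet0 n → E}
    (hX : ContDiffOn ℝ ∞ X ((U : Set (Fin n → ℝ)) ×ˢ Set.univ)) {w : Jet0 n} (hw : w.1 ∈ U) :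
    ContDiffAt ℝ ∞ X w :=
  hX.contDiffAt ((U.isOpen.prod isOpen_univ).mem_nhds ⟨hw, trivial⟩)

/-- The basis vector of the jet of a function splits into its base and vertical parts. -/
theorem fderiv_split (L : Jet0 n →L[ℝ] ℝ) (i : Fin n) (t : ℝ) :
    L (Pi.single i 1, t) = L (Pi.single i 1, 0) + t * L (0, 1) := by
  have : ((Pi.single i 1, t) : Jet0 n) = (Pi.single i 1, 0) + t • (0, 1) := by simp
  rw [this, map_add, map_smul, smul_eq_mul]

theorem hasDerivAt_vertical {F : Jet0 n → ℝ} {x : Fin n → ℝ} {t : ℝ}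
    (hF : DifferentiableAt ℝ F (x, t)) :
    HasDerivAt (fun t => F (x, t)) (fderiv ℝ F (x, t) (0, 1)) t := by
  have h := HasFDerivAt.comp_hasDerivAt t (f := fun t : ℝ => ((x, t) : Jet0 n)) hF.hasFDerivAt
    ((hasDerivAt_const t x).prodMk (hasDerivAt_id t))
  exact h

/-- The equations obtained from the jets with given base point. -/
theorem IsLiePointSymmetry.jet_identity (hg : IsMetricOn g U) (hV : ContDiffOn ℝ ∞ V U)
    (h : IsLiePointSymmetry (kleinGordon g V) U X) {w : Jet0 n} (hw : w.1 ∈ U) (p : Fin n → ℝ)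
    {Q : Matrix (Fin n) (Fin n) ℝ} (hQ : Qᵀ = Q)
    (hs : frob (g w.1)⁻¹ Q = ∑ k, contractedChristoffel g k w.1 * p k + V w.1 * w.2) :
    ∑ i, ∑ j, (fderiv ℝ (fun x => (g x)⁻¹ i j) w.1 (X w).1 * Q i j + (g w.1)⁻¹ i j *
        (fderiv ℝ (fderiv ℝ fun w => (X w).2) w (Pi.single j 1, p j) (Pi.single i 1, p i)
        + Q j i * fderiv ℝ (fun w => (X w).2) w (0, 1)
        - ∑ m, (Q j m * fderiv ℝ (fun w => (X w).1 m) w (Pi.single i 1, p i)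
          + p m * (fderiv ℝ (fderiv ℝ fun w => (X w).1 m) w (Pi.single j 1, p j)
              (Pi.single i 1, p i) + Q j i * fderiv ℝ (fun w => (X w).1 m) w (0, 1)))
        - ∑ m, Q i m * fderiv ℝ (fun w => (X w).1 m) w (Pi.single j 1, p j)))
      - ∑ k, (fderiv ℝ (contractedChristoffel g k) w.1 (X w).1 * p k
        + contractedChristoffel g k w.1 * (fderiv ℝ (fun w => (X w).2) w (Pi.single k 1, p k)
          - ∑ m, p m * fderiv ℝ (fun w => (X w).1 m) w (Pi.single k 1, p k)))
      - (fderiv ℝ V w.1 (X w).1 * w.2 + V w.1 * (X w).2) = 0 := by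
  have h1 := h.2 ((w, p), Q) hw (fun i j => congrFun (congrFun hQ j) i)
    (kleinGordon_eq_zero_iff.2 hs)
  rw [fderiv_kleinGordon hg hV hw] at h1
  simp only [prolongation, prolongCoeff1_eq,
    prolongCoeff2_eq (z := ((w, p), Q)) (contDiffAt_of_mem h.1 hw)] at h1
  exact h1

/-- The matrix ∂_i ξ^m + p_i ∂_u ξ^m is the total derivative of ξ^m, so this is the conformal
Killing condition with total derivatives, tested against trace-free matrices. -/
theorem IsLiePointSymmetry.traceFree (hn : 2 ≤ n) (hg : IsMetricOn g U) (hV : ContDiffOn ℝ ∞ V U)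
    (h : IsLiePointSymmetry (kleinGordon g V) U X) {w : Jet0 n} (hw : w.1 ∈ U)
    (hG : (g w.1)ᵀ = g w.1) (hHG : (g w.1)⁻¹ * g w.1 = 1) (p : Fin n → ℝ)
    (Q : Matrix (Fin n) (Fin n) ℝ) (hQ : Qᵀ = Q) (hHQ : frob (g w.1)⁻¹ Q = 0) :
    frob ((of fun i j => fderiv ℝ (fun x => (g x)⁻¹ i j) w.1 (X w).1)
      - (of (fun m i => fderiv ℝ (fun w => (X w).1 m) w (Pi.single i 1, 0))
        + vecMulVec (fun m => fderiv ℝ (fun w => (X w).1 m) w (0, 1)) p) * (g w.1)⁻¹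
      - (g w.1)⁻¹ * (of (fun m i => fderiv ℝ (fun w => (X w).1 m) w (Pi.single i 1, 0))
        + vecMulVec (fun m => fderiv ℝ (fun w => (X w).1 m) w (0, 1)) p)ᵀ) Q = 0 := by
  refine traceFree_identity (s := fun p => ∑ k, contractedChristoffel g k w.1 * p k + V w.1 * w.2)
    (c := fderiv ℝ (fun w => (X w).2) w (0, 1))
    (R := fun p => ∑ i, ∑ j, (g w.1)⁻¹ i j * (fderiv ℝ (fderiv ℝ fun w => (X w).2) w
        (Pi.single j 1, p j) (Pi.single i 1, p i) - ∑ m, p m *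
          (fderiv ℝ (fderiv ℝ fun w => (X w).1 m) w (Pi.single j 1, p j) (Pi.single i 1, p i)))
      - ∑ k, (fderiv ℝ (contractedChristoffel g k) w.1 (X w).1 * p k
        + contractedChristoffel g k w.1 * (fderiv ℝ (fun w => (X w).2) w (Pi.single k 1, p k)
          - ∑ m, p m * fderiv ℝ (fun w => (X w).1 m) w (Pi.single k 1, p k)))
      - (fderiv ℝ V w.1 (X w).1 * w.2 + V w.1 * (X w).2)) hn hG hHG ?_ p Q hQ hHQ
  intro p Q hQ hs
  refine Eq.trans ?_ (h.jet_identity hg hV hw p hQ hs)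
  rw [← add_sub_assoc, ← add_sub_assoc]
  congr 2
  simp only [← Finset.sum_add_distrib]
  refine Finset.sum_congr rfl fun i _ => Finset.sum_congr rfl fun j _ => ?_
  simp only [of_apply, ← fderiv_split, mul_add, Finset.sum_add_distrib]
  ring

/-- The base component of a Lie point symmetry does not depend on `u`. -/
theorem IsLiePointSymmetry.fderiv_vertical (hn : 2 ≤ n) (hg : IsMetricOn g U)
    (hV : ContDiffOn ℝ ∞ V U) (h : IsLiePointSymmetry (kleinGordon g V) U X) {w : Jet0 n}
    (hw : w.1 ∈ U) (m : Fin n) : fderiv ℝ (fun w => (X w).1 m) w (0, 1) = 0 := by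
  have hG : (g w.1)ᵀ = g w.1 := Matrix.ext fun i j => hg.symm w.1 hw j i
  have hdet : IsUnit (g w.1).det := (hg.nondegenerate w.1 hw).isUnit
  have hHG : (g w.1)⁻¹ * g w.1 = 1 := nonsing_inv_mul _ hdet
  have hHs : ((g w.1)⁻¹)ᵀ = (g w.1)⁻¹ := by rw [transpose_nonsing_inv, hG]
  exact congrFun (eq_zero_of_traceFree_identity hn hG hHs hHG
    (q := fun m => fderiv ℝ (fun w => (X w).1 m) w (0, 1))
    fun p Q hQ hHQ => h.traceFree hn hg hV hw hG hHG p Q hQ hHQ) m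

theorem IsLiePointSymmetry.base_eq (hn : 2 ≤ n) (hg : IsMetricOn g U)
    (hV : ContDiffOn ℝ ∞ V U) (h : IsLiePointSymmetry (kleinGordon g V) U X) {x : Fin n → ℝ}
    (hx : x ∈ U) (u : ℝ) : (X (x, u)).1 = (X (x, 0)).1 := by
  ext m
  have hd : ∀ t : ℝ, HasDerivAt (fun t => (X (x, t)).1 m) 0 t := fun t => by
    have h1 := hasDerivAt_vertical (F := fun w => (X w).1 m) (x := x) (t := t)
      (((contDiffAt_parts (contDiffAt_of_mem h.1 hx)).2 m).differentiableAt (by norm_num))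
    rwa [h.fderiv_vertical hn hg hV hx m] at h1
  exact is_const_of_deriv_eq_zero (fun t => (hd t).differentiableAt) (fun t => (hd t).deriv) u 0

theorem contDiffOn_slice {E : Type*} [NormedAddCommGroup E] [NormedSpace ℝ E] {X : Jet0 n → E}
    (hX : ContDiffOn ℝ ∞ X ((U : Set (Fin n → ℝ)) ×ˢ Set.univ)) :
    ContDiffOn ℝ ∞ (fun x => X (x, 0)) U :=
  hX.comp (contDiff_id.prodMk contDiff_const).contDiffOn fun _ hx => ⟨hx, trivial⟩

theorem pd_slice {F : Jet0 n → ℝ} {x : Fin n → ℝ} (hF : DifferentiableAt ℝ F (x, 0)) (i : Fin n) :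
    pd i (fun x => F (x, 0)) x = fderiv ℝ F (x, 0) (Pi.single i 1, 0) := by
  have h := HasFDerivAt.comp x (f := fun x : Fin n → ℝ => ((x, 0) : Jet0 n)) hF.hasFDerivAt
    ((hasFDerivAt_id x).prodMk (hasFDerivAt_const 0 x))
  have h' : fderiv ℝ (fun x => F (x, 0)) x = _ := h.fderiv
  rw [pd, h']
  rfl

/-- The base component of a Lie point symmetry is a conformal Killing vector. -/
theorem IsLiePointSymmetry.exists_isCKV (hn : 2 ≤ n) (hg : IsMetricOn g U)
    (hV : ContDiffOn ℝ ∞ V U) (h : IsLiePointSymmetry (kleinGordon g V) U X) :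
    ∃ ψ, IsCKV g U (fun x => (X (x, 0)).1) ψ := by
  have hs := contDiffOn_slice h.1.fst
  set v : Fin n → SmoothFun U := fun k => toSmooth _ (contDiffOn_pi.1 hs k) with hv'
  have hv : ∀ k, Represents (fun x => (X (x, 0)).1 k) (v k) := fun k => represents_toSmooth _ _
  set M := hg.inv.map (along partialD v) - jac partialD v * hg.inv
    - hg.inv * (jac partialD v)ᵀ with hM
  -- Tracing the desired equation M = -2ψH against g, with H : g = n, prescribes this factor.
  set ψ : SmoothFun U := algebraMap ℝ _ (-(1 / (2 * n))) * frob M hg.mat with hψ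
  refine ⟨zeroExtend ψ.1, (hg.isCKV_iff hv (represents_zeroExtend ψ)).2
    (ConformalKilling.of_inverse hg.mat_mul_inv hg.inv_mul_mat ?_)⟩
  rw [← hM]
  have hn' : (n : ℝ) ≠ 0 := by positivity
  have hpt : ∀ y : U, M.map (evalAt y) = (frob (M.map (evalAt y)) (g y) / n) • (g y)⁻¹ := by
    intro y
    have hG : (g y)ᵀ = g y := Matrix.ext fun i j => hg.symm y y.2 j i
    have hdet : IsUnit (g y).det := (hg.nondegenerate y y.2).isUnit
    have hHG : (g y)⁻¹ * g y = 1 := nonsing_inv_mul _ hdet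
    have hHs : ((g y)⁻¹)ᵀ = (g y)⁻¹ := by rw [transpose_nonsing_inv, hG]
    have hMs : Mᵀ = M := by
      have hi := inverse_symm hg.mat_symm hg.mat_mul_inv
      rw [hM, transpose_sub, transpose_sub, transpose_mul, transpose_mul, transpose_transpose,
        ← transpose_map, hi]
      abel
    refine eq_smul_of_annihilates_traceFree hn hG hHs hHG (by rw [← transpose_map, hMs]) ?_
    intro Q hQ hHQ
    -- At p = 0 the total derivatives of ξ reduce to its partial derivatives along the slice u = 0.
    have h1 := h.traceFree hn hg hV (w := ((y : Fin n → ℝ), 0)) y.2 hG hHG 0 Q hQ hHQ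
    have e3 : ∀ q : Fin n → ℝ, vecMulVec q (0 : Fin n → ℝ) = 0 := fun q => by
      ext; simp [vecMulVec_apply]
    rw [e3, add_zero] at h1
    rw [← h1]
    congr 1
    ext i j
    have hpd : ∀ m i, fderiv ℝ (fun w => (X w).1 m) ((y : Fin n → ℝ), 0) (Pi.single i 1, 0)
        = evalAt y (partialD i (v m)) := fun m i => by
      rw [← ((hv m).pd i).eval y]
      exact (pd_slice (((contDiffAt_parts (contDiffAt_of_mem h.1 y.2)).2 m).differentiableAt
        (by norm_num)) i).symm
    simp only [hM, Matrix.map_apply, Matrix.sub_apply, of_apply, mul_apply, transpose_apply,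
      map_sub, map_sum, map_mul, jac_apply, hpd, fderiv_apply_eq_sum,
      ← (represents_along (hg.represents_inv _ _) hv).eval y, ← (hg.represents_inv _ _).eval y]
  refine Matrix.ext fun i j => SmoothFun.ext_evalAt fun y => ?_
  have h1 := congrFun (congrFun (hpt y) i) j
  have h2 : evalAt y (frob M hg.mat) = frob (M.map (evalAt y)) (g y) := by
    simp only [frob, map_sum, map_mul, ← (hg.represents_mat _ _).eval y, Matrix.map_apply]
  rw [Matrix.map_apply, Matrix.smul_apply, smul_eq_mul] at h1
  rw [h1, Matrix.neg_apply, Matrix.smul_apply, smul_eq_mul, map_neg, map_mul, map_mul, hψ, map_mul,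
    AlgHom.commutes, h2, ← (hg.represents_inv i j).eval y, map_ofNat]
  simp only [Algebra.algebraMap_self, RingHom.id_apply]
  field_simp

end Classification

/-! ### The vertical component and the full classification. -/

section VerticalComponent

variable {n : ℕ} {U : Opens (Fin n → ℝ)} {g : (Fin n → ℝ) → Matrix (Fin n) (Fin n) ℝ}
  {V : (Fin n → ℝ) → ℝ} {X : Jet0 n → Jet0 n}

theorem fderiv_fderiv_apply {F : Jet0 n → ℝ} {w : Jet0 n} (hF : ContDiffAt ℝ ∞ F w)
    (δ v : Jet0 n) : fderiv ℝ (fun w => fderiv ℝ F w v) w δ = fderiv ℝ (fderiv ℝ F) w δ v := by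
  have h1 : DifferentiableAt ℝ (fderiv ℝ F) w :=
    (hF.fderiv_right (m := 1) (by norm_cast)).differentiableAt (by norm_num)
  rw [fderiv_clm_apply h1 (differentiableAt_const _)]
  simp

/-- The vertical component of a Lie point symmetry is affine in `u`, infinitesimally. -/
theorem IsLiePointSymmetry.fderiv_fderiv_vertical (hn : 2 ≤ n) (hg : IsMetricOn g U)
    (hV : ContDiffOn ℝ ∞ V U) (h : IsLiePointSymmetry (kleinGordon g V) U X) {w : Jet0 n}
    (hw : w.1 ∈ U) : fderiv ℝ (fderiv ℝ fun w => (X w).2) w (0, 1) (0, 1) = 0 := by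
  have hG : (g w.1)ᵀ = g w.1 := Matrix.ext fun i j => hg.symm w.1 hw j i
  have hdet : IsUnit (g w.1).det := (hg.nondegenerate w.1 hw).isUnit
  have hHG : (g w.1)⁻¹ * g w.1 = 1 := nonsing_inv_mul _ hdet
  have hHs : ((g w.1)⁻¹)ᵀ = (g w.1)⁻¹ := by rw [transpose_nonsing_inv, hG]
  have hn' : (n : ℝ) ≠ 0 := by positivity
  obtain ⟨h2, h1⟩ := contDiffAt_parts (contDiffAt_of_mem h.1 hw)
  have hv : ∀ m, fderiv ℝ (fun w => (X w).1 m) w (0, 1) = 0 := h.fderiv_vertical hn hg hV hw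
  have hsymm : ∀ m δ v, fderiv ℝ (fderiv ℝ fun w => (X w).1 m) w δ v
      = fderiv ℝ (fderiv ℝ fun w => (X w).1 m) w v δ := fun m δ v =>
    (h1 m).isSymmSndFDerivAt (by simp; norm_cast) _ _
  -- The u-derivative of ξ vanishes near the point, hence so do all second derivatives involving u.
  have hv2 : ∀ m δ, fderiv ℝ (fderiv ℝ fun w => (X w).1 m) w δ (0, 1) = 0 := fun m δ => by
    rw [← fderiv_fderiv_apply (h1 m)]
    have : (fun w => fderiv ℝ (fun w => (X w).1 m) w (0, 1)) =ᶠ[nhds w] fun _ => 0 := by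
      filter_upwards [(continuous_fst.tendsto w).eventually (U.isOpen.mem_nhds hw)] with w' hw'
      exact h.fderiv_vertical hn hg hV hw' m
    rw [this.fderiv_eq]; simp
  have hB : ∀ m (p : Fin n → ℝ) i j, fderiv ℝ (fderiv ℝ fun w => (X w).1 m) w
      (Pi.single j 1, p j) (Pi.single i 1, p i)
      = fderiv ℝ (fderiv ℝ fun w => (X w).1 m) w (Pi.single j 1, 0) (Pi.single i 1, 0) := by
    intro m p i j
    rw [fderiv_split, hv2, mul_zero, add_zero, hsymm, fderiv_split, hv2, mul_zero, add_zero, hsymm]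
  have hE : ∀ (p : Fin n → ℝ) i j, fderiv ℝ (fderiv ℝ fun w => (X w).2) w
      (Pi.single j 1, p j) (Pi.single i 1, p i)
      = fderiv ℝ (fderiv ℝ fun w => (X w).2) w (Pi.single j 1, 0) (Pi.single i 1, 0)
        + p j * fderiv ℝ (fderiv ℝ fun w => (X w).2) w (0, 1) (Pi.single i 1, 0)
        + p i * fderiv ℝ (fderiv ℝ fun w => (X w).2) w (Pi.single j 1, 0) (0, 1)
        + p i * p j * fderiv ℝ (fderiv ℝ fun w => (X w).2) w (0, 1) (0, 1) := by
    intro p i j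
    have hsp : ((Pi.single j 1, p j) : Jet0 n) = (Pi.single j 1, 0) + p j • (0, 1) := by simp
    rw [fderiv_split, hsp, map_add, map_smul]
    simp only [_root_.add_apply, _root_.smul_apply, smul_eq_mul]
    ring
  set K : Matrix (Fin n) (Fin n) ℝ := of fun i j => fderiv ℝ (fun x => (g x)⁻¹ i j) w.1 (X w).1
  set a : Matrix (Fin n) (Fin n) ℝ :=
    of fun m i => fderiv ℝ (fun w => (X w).1 m) w (Pi.single i 1, 0) with ha
  set c := fderiv ℝ (fun w => (X w).2) w (0, 1) with hc
  refine quadratic_coeff_eq_zero (H := (g w.1)⁻¹) (G := g w.1) hn hHs hHG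
    (B := of fun i j => fderiv ℝ (fderiv ℝ fun w => (X w).2) w (Pi.single j 1, 0)
      (Pi.single i 1, 0)) (a := a)
    (b := fun m => of fun i j => fderiv ℝ (fderiv ℝ fun w => (X w).1 m) w (Pi.single j 1, 0)
      (Pi.single i 1, 0))
    (Γ := fun k => contractedChristoffel g k w.1)
    (Λ := fun k => fderiv ℝ (contractedChristoffel g k) w.1 (X w).1)
    (η := fun k => fderiv ℝ (fun w => (X w).2) w (Pi.single k 1, 0))
    (β := fun i => fderiv ℝ (fderiv ℝ fun w => (X w).2) w (0, 1) (Pi.single i 1, 0))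
    (β' := fun j => fderiv ℝ (fderiv ℝ fun w => (X w).2) w (Pi.single j 1, 0) (0, 1))
    (c := c) (e := V w.1 * w.2) (f := fderiv ℝ V w.1 (X w).1 * w.2 + V w.1 * (X w).2)
    (d := 1 / n * ∑ i, ∑ j, (K i j * g w.1 i j + (g w.1)⁻¹ i j * (g w.1 j i * c
      - ∑ m, g w.1 j m * a m i - ∑ m, g w.1 i m * a m j))) fun p => ?_
  -- The jet Q = (s/n) g lies on the equation. The terms linear in Q become s times the constant
  -- `d`, hence affine in p, so ∂_u² η is the only coefficient of a quadratic term.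
  set s := ∑ k, contractedChristoffel g k w.1 * p k + V w.1 * w.2 with hs
  have key := h.jet_identity hg hV hw p (Q := (s / n) • g w.1) (by rw [transpose_smul, hG])
    (by rw [frob_smul, frob_metric hG hHG, div_mul_cancel₀ _ hn'])
  refine Eq.trans ?_ key
  have hL : ∀ m i t, fderiv ℝ (fun w => (X w).1 m) w (Pi.single i 1, t) = a m i := fun m i t => by
    rw [fderiv_split, hv, mul_zero, add_zero]; rfl
  simp only [hL, hB, hv, hE, mul_zero, add_zero, Matrix.smul_apply, smul_eq_mul]
  have hη : ∀ k, fderiv ℝ (fun w => (X w).2) w (Pi.single k 1, p k)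
      = fderiv ℝ (fun w => (X w).2) w (Pi.single k 1, 0) + p k * c := fun k => fderiv_split _ _ _
  simp only [hη]
  congr 2
  simp only [mul_comm (1 / (n : ℝ)), mul_assoc, mul_comm _ s]
  rw [mul_comm _ (1 / (n : ℝ)), ← mul_assoc, show s * (1 / (n : ℝ)) = s / n by ring]
  simp only [Finset.mul_sum (Finset.univ) _ (s / n), ← Finset.sum_add_distrib]
  refine Finset.sum_congr rfl fun i _ => Finset.sum_congr rfl fun j _ => ?_
  simp only [of_apply, Finset.sum_add_distrib, ← Finset.mul_sum]
  change s / n * (K i j * _ + _) + _ = K i j * _ + _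
  ring

theorem IsLiePointSymmetry.vertical_eq (hn : 2 ≤ n) (hg : IsMetricOn g U)
    (hV : ContDiffOn ℝ ∞ V U) (h : IsLiePointSymmetry (kleinGordon g V) U X) {x : Fin n → ℝ}
    (hx : x ∈ U) (u : ℝ) :
    (X (x, u)).2 = fderiv ℝ (fun w => (X w).2) (x, 0) (0, 1) * u + (X (x, 0)).2 := by
  have hc : ∀ t : ℝ, ContDiffAt ℝ ∞ (fun w => (X w).2) (x, t) := fun t =>
    (contDiffAt_parts (contDiffAt_of_mem h.1 hx)).1
  have h1 : ∀ t : ℝ, HasDerivAt (fun t => (X (x, t)).2)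
      (fderiv ℝ (fun w => (X w).2) (x, t) (0, 1)) t := fun t =>
    hasDerivAt_vertical ((hc t).differentiableAt (by norm_num))
  have h2 : ∀ t : ℝ, HasDerivAt (fun t => fderiv ℝ (fun w => (X w).2) (x, t) (0, 1)) 0 t :=
    fun t => by
      have hd : DifferentiableAt ℝ (fun w => fderiv ℝ (fun w => (X w).2) w (0, 1)) (x, t) :=
        (((hc t).fderiv_right (m := 1) (by norm_cast)).differentiableAt (by norm_num)).clm_apply
          (differentiableAt_const _)
      have := hasDerivAt_vertical hd
      rwa [fderiv_fderiv_apply (hc t), h.fderiv_fderiv_vertical hn hg hV hx] at this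
  have h3 : ∀ t : ℝ, fderiv ℝ (fun w => (X w).2) (x, t) (0, 1)
      = fderiv ℝ (fun w => (X w).2) (x, 0) (0, 1) := fun t =>
    is_const_of_deriv_eq_zero (fun t => (h2 t).differentiableAt) (fun t => (h2 t).deriv) t 0
  set φ := fderiv ℝ (fun w => (X w).2) (x, 0) (0, 1)
  have h4 : ∀ t : ℝ, HasDerivAt (fun t => (X (x, t)).2 - φ * t) 0 t := fun t => by
    have := (h1 t).sub ((hasDerivAt_id t).const_mul φ)
    rw [h3 t, mul_one, sub_self] at this
    exact this
  have h5 := is_const_of_deriv_eq_zero (fun t => (h4 t).differentiableAt) (fun t => (h4 t).deriv)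
    u 0
  simp only [mul_zero, sub_zero] at h5
  linarith

/-- Evaluating the Klein-Gordon equation at a suitable second jet. -/
theorem exists_jet (hn : 2 ≤ n) (hg : IsMetricOn g U) {w : Jet0 n} (hw : w.1 ∈ U)
    (p : Fin n → ℝ) : ∃ Q : Matrix (Fin n) (Fin n) ℝ, (∀ i j, Q i j = Q j i) ∧
      kleinGordon g V ((w, p), Q) = 0 := by
  have hG : (g w.1)ᵀ = g w.1 := Matrix.ext fun i j => hg.symm w.1 hw j i
  have hdet : IsUnit (g w.1).det := (hg.nondegenerate w.1 hw).isUnit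
  have hHG : (g w.1)⁻¹ * g w.1 = 1 := nonsing_inv_mul _ hdet
  have hn' : (n : ℝ) ≠ 0 := by positivity
  refine ⟨((∑ k, contractedChristoffel g k w.1 * p k + V w.1 * w.2) / n) • g w.1, fun i j => ?_,
    kleinGordon_eq_zero_iff.2 ?_⟩
  · rw [Matrix.smul_apply, Matrix.smul_apply, hg.symm w.1 hw]
  · rw [frob_smul, frob_metric hG hHG]; field_simp

theorem weight_lap (hg : IsMetricOn g U) {ψ : (Fin n → ℝ) → ℝ} (hψ : ContDiffOn ℝ ∞ ψ U)
    (c a₀ : ℝ) {x : Fin n → ℝ} (hx : x ∈ U) :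
    laplacian g (fun x => c * ψ x + a₀) x = c * laplacian g ψ x ∧
      ∀ i, pd i (fun x => c * ψ x + a₀) x = c * pd i ψ x := by
  have hr := represents_toSmooth ψ hψ
  have hr' : Represents (fun x => c * ψ x + a₀)
      (algebraMap ℝ _ c * toSmooth ψ hψ + algebraMap ℝ _ a₀) := fun y => by
    rw [← evalAt_apply]
    simp [← hr.eval y]
  constructor
  · rw [(hg.represents_laplacian hr').eval ⟨x, hx⟩, (hg.represents_laplacian hr).eval ⟨x, hx⟩,
      lap_add, lap_algebraMap, lap_const_mul]
    simp
  · intro i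
    rw [(hr'.pd i).eval ⟨x, hx⟩, (hr.pd i).eval ⟨x, hx⟩]
    simp

/-- The Lie point symmetries of the Klein-Gordon equation. -/
theorem isLiePointSymmetry_iff (hn : 2 ≤ n) (hU : IsConnected (U : Set (Fin n → ℝ)))
    (hg : IsMetricOn g U) (hV : ContDiffOn ℝ ∞ V U) :
    IsLiePointSymmetry (kleinGordon g V) U X ↔
      ∃ (ξ : (Fin n → ℝ) → (Fin n → ℝ)) (ψ : (Fin n → ℝ) → ℝ) (a₀ : ℝ) (b : (Fin n → ℝ) → ℝ),
        IsCKV g U ξ ψ ∧ IsSolution g V U b ∧ (∀ x ∈ U, kgSymmetryExpr g V ξ ψ x = 0) ∧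
        ∀ x ∈ U, ∀ u : ℝ, X (x, u) = (ξ x, (2 - (n : ℝ)) / 2 * ψ x * u + a₀ * u + b x) := by
  constructor
  · intro h
    obtain ⟨ψ, hψ⟩ := h.exists_isCKV hn hg hV
    set ξ : (Fin n → ℝ) → (Fin n → ℝ) := fun x => (X (x, 0)).1 with hξ
    set α : (Fin n → ℝ) → ℝ := fun x => fderiv ℝ (fun w => (X w).2) (x, 0) (0, 1) with hα'
    set b : (Fin n → ℝ) → ℝ := fun x => (X (x, 0)).2 with hb'
    have hb : ContDiffOn ℝ ∞ b U := contDiffOn_slice h.1.snd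
    have hα : ContDiffOn ℝ ∞ α U := by
      have h1 : ContDiffOn ℝ ∞ (fun w => fderiv ℝ (fun w => (X w).2) w (0, 1))
          ((U : Set (Fin n → ℝ)) ×ˢ Set.univ) :=
        (h.1.snd.fderiv_of_isOpen (m := ∞) (U.isOpen.prod isOpen_univ) (by norm_num)).clm_apply
          contDiffOn_const
      exact contDiffOn_slice h1
    have hX : ∀ x ∈ U, ∀ u : ℝ, X (x, u) = (ξ x, α x * u + b x) := fun x hx u =>
      Prod.ext (h.base_eq hn hg hV hx u) (h.vertical_eq hn hg hV hx u)
    -- Every (x, u, p) extends to a jet on the equation, where the term (α - 2ψ)(Δu - Vu) drops out;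
    -- the rest is a polynomial in the free variables u and p.
    have key : ∀ x ∈ U, ∀ (u : ℝ) (p : Fin n → ℝ),
        ∑ k, p k * (2 * ∑ l, (g x)⁻¹ k l * pd l α x - (2 - n) * ∑ l, (g x)⁻¹ k l * pd l ψ x)
        + u * (laplacian g α x - (∑ k, ξ x k * pd k V x + 2 * ψ x * V x))
        + (laplacian g b x - V x * b x) = 0 := by
      intro x hx u p
      obtain ⟨Q, hQ, hQ0⟩ := exists_jet (V := V) hn hg (w := (x, u)) hx p
      have h1 := h.2 (((x, u), p), Q) hx hQ hQ0
      rw [prolongation_kleinGordon_affine hg hV hψ hα hb hX (z := (((x, u), p), Q)) hx hQ, hQ0,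
        mul_zero, zero_add] at h1
      exact h1
    have k0 : ∀ x ∈ U, laplacian g b x - V x * b x = 0 := fun x hx => by
      simpa using key x hx 0 0
    have k1 : ∀ x ∈ U, laplacian g α x - (∑ k, ξ x k * pd k V x + 2 * ψ x * V x) = 0 :=
      fun x hx => by simpa [k0 x hx] using key x hx 1 0
    have k2 : ∀ x ∈ U, ∀ k, 2 * ∑ l, (g x)⁻¹ k l * pd l α x
        - (2 - n) * ∑ l, (g x)⁻¹ k l * pd l ψ x = 0 := fun x hx k => by
      have := key x hx 0 (Pi.single k 1)
      rw [k0 x hx] at this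
      simpa [Pi.single_apply] using this
    have hαr := represents_toSmooth α hα
    have hψr := represents_toSmooth ψ hψ.smooth_factor
    -- The p-coefficient says that the gradient of α - cψ vanishes; lowering its index and using
    -- connectedness make this function the constant a₀.
    set d : SmoothFun U := toSmooth α hα
      - algebraMap ℝ _ ((2 - n) / 2) * toSmooth ψ hψ.smooth_factor with hd
    have hgrad : ∀ k, gradUp partialD hg.inv d k = 0 := fun k => SmoothFun.ext_evalAt fun y => by
      have h1 := k2 y y.2 k
      have e : evalAt y (gradUp partialD hg.inv d k) = ∑ l, (g y)⁻¹ k l * pd l α y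
          - (2 - n) / 2 * ∑ l, (g y)⁻¹ k l * pd l ψ y := by
        rw [Finset.mul_sum, ← Finset.sum_sub_distrib]
        simp only [gradUp, map_sum, map_mul, ← (hg.represents_inv _ _).eval y, hd, map_sub,
          Derivation.leibniz, Derivation.map_algebraMap, mul_zero, add_zero, smul_eq_mul, map_mul,
          AlgHom.commutes, ← (hαr.pd _).eval y, ← (hψr.pd _).eval y]
        refine Finset.sum_congr rfl fun l _ => ?_
        simp only [Algebra.algebraMap_self, RingHom.id_apply]
        ring
      rw [e, map_zero]
      linarith
    obtain ⟨a₀, ha₀⟩ := exists_eq_algebraMap hU (a := d) fun i => by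
      rw [← lower_gradUp hg.mat_mul_inv d i]
      simp [hgrad]
    have hα2 : ∀ x ∈ U, α x = (2 - n) / 2 * ψ x + a₀ := fun x hx => by
      have := congrArg (evalAt ⟨x, hx⟩) ha₀
      simp only [hd, map_sub, map_mul, AlgHom.commutes, ← hαr.eval ⟨x, hx⟩,
        ← hψr.eval ⟨x, hx⟩, Algebra.algebraMap_self, RingHom.id_apply] at this
      linarith
    have hlap : ∀ x ∈ U, laplacian g α x = (2 - n) / 2 * laplacian g ψ x := fun x hx => by
      have hr2 : Represents (fun x => (2 - (n : ℝ)) / 2 * ψ x + a₀) (toSmooth α hα) := fun y =>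
        ((hα2 y y.2).symm.trans (hαr y))
      rw [(hg.represents_laplacian hαr).eval ⟨x, hx⟩,
        ← (hg.represents_laplacian hr2).eval ⟨x, hx⟩]
      exact (weight_lap hg hψ.smooth_factor _ a₀ hx).1
    refine ⟨ξ, ψ, a₀, b, hψ, ⟨hb, fun x hx => by linarith [k0 x hx]⟩, fun x hx => ?_,
      fun x hx u => ?_⟩
    · have := k1 x hx
      rw [hlap x hx] at this
      unfold kgSymmetryExpr
      linarith
    · rw [hX x hx u, hα2 x hx]
      congr 1
      ring
  · rintro ⟨ξ, ψ, a₀, b, hξ, hb, hk, hX⟩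
    set α : (Fin n → ℝ) → ℝ := fun x => (2 - (n : ℝ)) / 2 * ψ x + a₀ with hα'
    have hα : ContDiffOn ℝ ∞ α U := (contDiffOn_const.mul hξ.smooth_factor).add contDiffOn_const
    have hX' : ∀ x ∈ U, ∀ u : ℝ, X (x, u) = (ξ x, α x * u + b x) := fun x hx u => by
      rw [hX x hx u]; congr 1; simp only [hα']; ring
    refine ⟨?_, fun z hz hs h0 => ?_⟩
    · have hm : Set.MapsTo (Prod.fst : Jet0 n → _) ((U : Set (Fin n → ℝ)) ×ˢ Set.univ) U :=
        fun w hw => hw.1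
      have : ContDiffOn ℝ ∞ (fun w : Jet0 n => (ξ w.1, α w.1 * w.2 + b w.1))
          ((U : Set (Fin n → ℝ)) ×ˢ Set.univ) :=
        (hξ.smooth_field.comp contDiffOn_fst hm).prodMk
          (((hα.comp contDiffOn_fst hm).mul contDiffOn_snd).add (hb.1.comp contDiffOn_fst hm))
      exact this.congr fun w hw => hX' w.1 hw.1 w.2
    · rw [prolongation_kleinGordon_affine hg hV hξ hα hb.1 hX' hz hs, h0]
      obtain ⟨e1, e2⟩ := weight_lap hg hξ.smooth_factor ((2 - (n : ℝ)) / 2) a₀ hz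
      have e3 := hk _ hz
      have e4 := hb.2 _ hz
      unfold kgSymmetryExpr at e3
      have e5 : ∑ k, z.1.2 k * (2 * ∑ l, (g z.1.1.1)⁻¹ k l * pd l α z.1.1.1
          - (2 - n) * ∑ l, (g z.1.1.1)⁻¹ k l * pd l ψ z.1.1.1) = 0 := by
        refine Finset.sum_eq_zero fun k _ => ?_
        have : ∑ l, (g z.1.1.1)⁻¹ k l * pd l α z.1.1.1
            = (2 - n) / 2 * ∑ l, (g z.1.1.1)⁻¹ k l * pd l ψ z.1.1.1 := by
          rw [Finset.mul_sum]
          exact Finset.sum_congr rfl fun l _ => by rw [e2 l]; ring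
        rw [this]; ring
      rw [e5, e4, e1]
      linear_combination -z.1.1.2 * e3

end VerticalComponent

/-! ### Lie brackets of conformal Killing vectors. -/

section FormalBracket

variable {n : ℕ} {A : Type*} [CommRing A] [Algebra ℝ A] {D : Fin n → Derivation ℝ A A}
  {g H : Matrix (Fin n) (Fin n) A}

/-- The Lie bracket of vector fields. -/
noncomputable def brk (D : Fin n → Derivation ℝ A A) (ξ ζ : Fin n → A) (k : Fin n) : A :=
  along D ξ (ζ k) - along D ζ (ξ k)

/-- The second-order parts of the two compositions agree because the D_i commute. -/
theorem along_brk (hD : ∀ i j a, D i (D j a) = D j (D i a)) (ξ ζ : Fin n → A) (a : A) :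
    along D (brk D ξ ζ) a = along D ξ (along D ζ a) - along D ζ (along D ξ a) := by
  have h : ∀ ξ ζ : Fin n → A, along D ξ (along D ζ a)
      = ∑ k, along D ξ (ζ k) * D k a + ∑ k, ∑ m, ζ k * (ξ m * D m (D k a)) := by
    intro ξ ζ
    rw [along_apply D ζ, map_sum, ← Finset.sum_add_distrib]
    refine Finset.sum_congr rfl fun k _ => ?_
    rw [Derivation.leibniz, along_apply D ξ (D k a), smul_eq_mul, smul_eq_mul, Finset.mul_sum,
      mul_comm (D k a), add_comm]
  rw [h, h, along_apply]
  simp only [brk, sub_mul, Finset.sum_sub_distrib]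
  rw [Finset.sum_comm (f := fun k m => ζ k * (ξ m * D m (D k a)))]
  have : ∑ y, ∑ x, ζ x * (ξ y * D y (D x a)) = ∑ k, ∑ m, ξ k * (ζ m * D m (D k a)) :=
    Finset.sum_congr rfl fun k _ => Finset.sum_congr rfl fun m _ => by rw [hD k m]; ring
  rw [this]
  ring

theorem jac_brk (hD : ∀ i j a, D i (D j a) = D j (D i a)) (ξ ζ : Fin n → A) :
    jac D (brk D ξ ζ) = (jac D ζ).map (along D ξ) + jac D ζ * jac D ξ
      - ((jac D ξ).map (along D ζ) + jac D ξ * jac D ζ) := by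
  ext k m
  simp only [brk, jac_apply, map_sub, derivation_along hD, Matrix.sub_apply, Matrix.add_apply,
    Matrix.map_apply, mul_apply]
  congr 2 <;> exact Finset.sum_congr rfl fun l _ => mul_comm _ _

/-- Conformal Killing vectors are closed under the Lie bracket. -/
theorem ConformalKilling.brk (hD : ∀ i j a, D i (D j a) = D j (D i a)) {ξ ζ : Fin n → A}
    {ψ φ : A} (h1 : ConformalKilling D g ξ ψ) (h2 : ConformalKilling D g ζ φ) :
    ConformalKilling D g (brk D ξ ζ) (along D ξ φ - along D ζ ψ) := by
  -- Applying ξ to the equation of ζ; antisymmetrizing in the two vectors leaves the equation of the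
  -- bracket with factor ξφ - ζψ.
  have key : ∀ {ξ ζ : Fin n → A} {ψ φ : A}, ConformalKilling D g ξ ψ → ConformalKilling D g ζ φ →
      (g.map (along D ζ)).map (along D ξ) = (2 * along D ξ φ) • g
        + (2 * φ) • ((2 * ψ) • g - (jac D ξ)ᵀ * g - g * jac D ξ)
        - (((jac D ζ).map (along D ξ))ᵀ * g
          + (jac D ζ)ᵀ * ((2 * ψ) • g - (jac D ξ)ᵀ * g - g * jac D ξ))
        - (((2 * ψ) • g - (jac D ξ)ᵀ * g - g * jac D ξ) * jac D ζ
          + g * (jac D ζ).map (along D ξ)) := by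
    intro ξ ζ ψ φ h1 h2
    have e1 : g.map (along D ξ) = (2 * ψ) • g - (jac D ξ)ᵀ * g - g * jac D ξ := by
      rw [← show _ = _ from h1]; abel
    have e2 : g.map (along D ζ) = (2 * φ) • g - (jac D ζ)ᵀ * g - g * jac D ζ := by
      rw [← show _ = _ from h2]; abel
    have e3 : along D ξ (2 * φ) = 2 * along D ξ φ := by
      have : along D ξ (2 : A) = 0 := by simpa using (along D ξ).map_natCast 2
      simp [this]
    rw [e2, map_derivation_sub, map_derivation_sub, map_derivation_mul, map_derivation_mul,
      map_derivation_smul, transpose_map, e1, e3]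
  have e4 : g.map (along D (ConfKG.brk D ξ ζ))
      = (g.map (along D ζ)).map (along D ξ) - (g.map (along D ξ)).map (along D ζ) := by
    ext i j; exact along_brk hD ξ ζ _
  unfold ConformalKilling
  rw [e4, key h1 h2, key h2 h1, jac_brk hD]
  simp only [transpose_add, transpose_sub, transpose_mul, mul_add, add_mul, mul_sub, sub_mul,
    smul_sub, sub_smul, mul_smul_comm, smul_mul_assoc, Matrix.mul_assoc]
  rw [smul_comm (2 * ψ) (2 * φ) g]
  abel

end FormalBracket

/-! ### Linear and trivial symmetries. -/

section SymmetryAlgebras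

variable {n : ℕ} {U : Opens (Fin n → ℝ)} {g : (Fin n → ℝ) → Matrix (Fin n) (Fin n) ℝ}
  {V : (Fin n → ℝ) → ℝ}

theorem pd_const (i : Fin n) (c : ℝ) : pd i (fun _ => c) = fun _ => 0 :=
  funext fun x => by simp [pd]

theorem laplacian_const (c : ℝ) (x : Fin n → ℝ) : laplacian g (fun _ => c) x = 0 := by
  simp [laplacian, pd_const]

/-- The linear Lie point symmetries of the Klein-Gordon equation. -/
theorem mem_linearSymmetryAlgebra_iff (hn : 2 ≤ n) (hU : IsConnected (U : Set (Fin n → ℝ)))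
    (hg : IsMetricOn g U) (hV : ContDiffOn ℝ ∞ V U) {X : Jet0 n → Jet0 n} :
    X ∈ linearSymmetryAlgebra g V U ↔ (∀ w : Jet0 n, w.1 ∉ U → X w = 0) ∧
      ∃ (ξ : (Fin n → ℝ) → (Fin n → ℝ)) (ψ : (Fin n → ℝ) → ℝ) (a₀ : ℝ),
        IsCKV g U ξ ψ ∧ (∀ x ∈ U, kgSymmetryExpr g V ξ ψ x = 0) ∧
        ∀ x ∈ U, ∀ u : ℝ, X (x, u) = (ξ x, ((2 - (n : ℝ)) / 2 * ψ x + a₀) * u) := by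
  constructor
  · rintro ⟨⟨h1, h2⟩, a, ha⟩
    obtain ⟨ξ, ψ, a₀, b, hξ, hb, hk, hX⟩ := (isLiePointSymmetry_iff hn hU hg hV).1 h1
    refine ⟨h2, ξ, ψ, a₀, hξ, hk, fun x hx u => ?_⟩
    have h0 := ha x hx 0
    rw [hX x hx 0] at h0
    -- Evaluating the linear vertical component at u = 0 removes the inhomogeneous term b.
    have hb0 : b x = 0 := by simpa using h0
    rw [hX x hx u, hb0]
    congr 1; ring
  · rintro ⟨h2, ξ, ψ, a₀, hξ, hk, hX⟩
    refine ⟨⟨(isLiePointSymmetry_iff hn hU hg hV).2 ⟨ξ, ψ, a₀, fun _ => 0, hξ,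
      ⟨contDiffOn_const, fun x _ => ?_⟩, hk, fun x hx u => ?_⟩, h2⟩,
      fun x => (2 - (n : ℝ)) / 2 * ψ x + a₀, fun x hx u => by rw [hX x hx u]⟩
    · rw [laplacian_const, mul_zero]
    · rw [hX x hx u]; congr 1; ring

theorem isCKV_zero : IsCKV g U (fun _ => 0) (fun _ => 0) :=
  ⟨contDiffOn_const, contDiffOn_const, fun x _ i j => by simp [pd]⟩

theorem verticalField_mem (hn : 2 ≤ n) (hU : IsConnected (U : Set (Fin n → ℝ)))
    (hg : IsMetricOn g U) (hV : ContDiffOn ℝ ∞ V U) {b : (Fin n → ℝ) → ℝ}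
    (hb : IsSolution g V U b) : verticalField U b ∈ symmetryAlgebra g V U := by
  refine ⟨(isLiePointSymmetry_iff hn hU hg hV).2 ⟨fun _ => 0, fun _ => 0, 0, b, isCKV_zero, hb,
    fun x _ => ?_, fun x hx u => ?_⟩, fun w hw => if_neg hw⟩
  · simp [kgSymmetryExpr, laplacian_const]
  · rw [verticalField, if_pos hx]; simp

theorem mem_symmetryAlgebra_iff (hn : 2 ≤ n) (hU : IsConnected (U : Set (Fin n → ℝ)))
    (hg : IsMetricOn g U) (hV : ContDiffOn ℝ ∞ V U) {X : Jet0 n → Jet0 n} :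
    X ∈ symmetryAlgebra g V U ↔ ∃ Y ∈ linearSymmetryAlgebra g V U,
      ∃ Z, IsSolutionSymmetry g V U Z ∧ X = Y + Z := by
  constructor
  · rintro ⟨h1, h2⟩
    obtain ⟨ξ, ψ, a₀, b, hξ, hb, hk, hX⟩ := (isLiePointSymmetry_iff hn hU hg hV).1 h1
    refine ⟨X - verticalField U b, (mem_linearSymmetryAlgebra_iff hn hU hg hV).2
      ⟨fun w hw => ?_, ξ, ψ, a₀, hξ, hk, fun x hx u => ?_⟩, verticalField U b, ⟨b, hb, rfl⟩,
      (sub_add_cancel _ _).symm⟩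
    · rw [Pi.sub_apply, h2 w hw, verticalField, if_neg hw, sub_zero]
    · rw [Pi.sub_apply, hX x hx u, verticalField, if_pos hx, Prod.mk_sub_mk, sub_zero]
      congr 1; ring
  · rintro ⟨Y, hY, Z, ⟨b, hb, rfl⟩, rfl⟩
    exact Submodule.add_mem _ hY.1 (verticalField_mem hn hU hg hV hb)

/-- The Lie bracket of two vector fields which are affine in the fibre coordinate. -/
theorem lieBracket_affine {X Y : Jet0 n → Jet0 n} {ξ ζ : (Fin n → ℝ) → (Fin n → ℝ)}
    {α β b d : (Fin n → ℝ) → ℝ} (hξ : ContDiffOn ℝ ∞ ξ U) (hζ : ContDiffOn ℝ ∞ ζ U)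
    (hα : ContDiffOn ℝ ∞ α U) (hβ : ContDiffOn ℝ ∞ β U) (hb : ContDiffOn ℝ ∞ b U)
    (hd : ContDiffOn ℝ ∞ d U)
    (hX : ∀ x ∈ U, ∀ u : ℝ, X (x, u) = (ξ x, α x * u + b x))
    (hY : ∀ x ∈ U, ∀ u : ℝ, Y (x, u) = (ζ x, β x * u + d x)) {x : Fin n → ℝ} (hx : x ∈ U) (u : ℝ) :
    VectorField.lieBracket ℝ X Y (x, u)
      = (fun k => ∑ l, ξ x l * pd l (fun x => ζ x k) x - ∑ l, ζ x l * pd l (fun x => ξ x k) x,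
        (∑ l, ξ x l * pd l β x - ∑ l, ζ x l * pd l α x) * u
          + (β x * b x + ∑ l, ξ x l * pd l d x - α x * d x - ∑ l, ζ x l * pd l b x)) := by
  have key : ∀ {Y : Jet0 n → Jet0 n} {ζ : (Fin n → ℝ) → (Fin n → ℝ)} {β d : (Fin n → ℝ) → ℝ},
      ContDiffOn ℝ ∞ ζ U → ContDiffOn ℝ ∞ β U → ContDiffOn ℝ ∞ d U →
      (∀ x ∈ U, ∀ u : ℝ, Y (x, u) = (ζ x, β x * u + d x)) → ∀ v : Jet0 n,
      fderiv ℝ Y (x, u) v = (fun k => ∑ l, v.1 l * pd l (fun x => ζ x k) x,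
        (∑ l, v.1 l * pd l β x) * u + β x * v.2 + ∑ l, v.1 l * pd l d x) := by
    intro Y ζ β d hζ hβ hd hY v
    have e : Y =ᶠ[nhds (x, u)] fun w => (ζ w.1, β w.1 * w.2 + d w.1) := by
      filter_upwards [(continuous_fst.tendsto ((x, u) : Jet0 n)).eventually
        (U.isOpen.mem_nhds hx)] with w hw
      exact hY w.1 hw w.2
    have hc : ∀ {E : Type} [NormedAddCommGroup E] [NormedSpace ℝ E] {F : (Fin n → ℝ) → E},
        ContDiffOn ℝ ∞ F U → HasFDerivAt (fun w : Jet0 n => F w.1) ((fderiv ℝ F x).comp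
        (ContinuousLinearMap.fst ℝ (Fin n → ℝ) ℝ)) (x, u) := fun hF =>
      HasFDerivAt.comp (g := _) (x, u) (ContDiffOn.differentiableAt_opens hF hx).hasFDerivAt
        hasFDerivAt_fst
    have h : fderiv ℝ (fun w : Jet0 n => (ζ w.1, β w.1 * w.2 + d w.1)) (x, u) = _ :=
      ((hc hζ).prodMk (((hc hβ).fun_mul hasFDerivAt_snd).fun_add (hc hd))).fderiv
    rw [e.fderiv_eq, h]
    refine Prod.ext (funext fun k => ?_) ?_
    · have h1 := fderiv_apply_eq_sum (fun x => ζ x k) x v.1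
      refine Eq.trans ?_ h1
      rw [(hasFDerivAt_pi'.1 (ContDiffOn.differentiableAt_opens hζ hx).hasFDerivAt k).fderiv]
      rfl
    · simp only [ContinuousLinearMap.prod_apply, _root_.add_apply, _root_.smul_apply, smul_eq_mul,
        ContinuousLinearMap.comp_apply, ContinuousLinearMap.coe_fst',
        ContinuousLinearMap.coe_snd', fderiv_apply_eq_sum]
      ring
  rw [VectorField.lieBracket, key hζ hβ hd hY, key hξ hα hb hX, hX x hx, hY x hx]
  refine Prod.ext (funext fun k => rfl) ?_
  simp only [Prod.snd_sub]
  ring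

theorem contDiffOn_weight {ψ : (Fin n → ℝ) → ℝ} (hψ : ContDiffOn ℝ ∞ ψ U) (c a₀ : ℝ) :
    ContDiffOn ℝ ∞ (fun x => c * ψ x + a₀) U :=
  (contDiffOn_const.mul hψ).add contDiffOn_const

theorem lieBracket_eq_zero {X Y : Jet0 n → Jet0 n} {w : Jet0 n} (hX : X w = 0) (hY : Y w = 0) :
    VectorField.lieBracket ℝ X Y w = 0 := by
  rw [VectorField.lieBracket, hX, hY, map_zero, map_zero, sub_zero]

/-- Apply each vector to the other's condition and subtract; the products with ψφ cancel. -/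
theorem kgSymmetryExpr_brk {Vbar : SmoothFun U} {v w : Fin n → SmoothFun U} {p q : SmoothFun U}
    (k1 : along partialD v Vbar + 2 * p * Vbar = 0) (k2 : along partialD w Vbar + 2 * q * Vbar = 0) :
    along partialD (brk partialD v w) Vbar
      + 2 * (along partialD v q - along partialD w p) * Vbar = 0 := by
  have two : ∀ u : Fin n → SmoothFun U, along partialD u (2 : SmoothFun U) = 0 := fun u => by
    simpa using (along partialD u).map_natCast 2
  have e1 := congrArg (along partialD w) k1
  have e2 := congrArg (along partialD v) k2
  simp only [map_add, Derivation.leibniz, map_zero, smul_eq_mul, two] at e1 e2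
  rw [along_brk partialD_comm]
  linear_combination e2 - e1 - 2 * q * k1 + 2 * p * k2

end SymmetryAlgebras

/-! ### Closure of the symmetries under the bracket. -/

section BracketsOfSymmetries

variable {n : ℕ} {U : Opens (Fin n → ℝ)} {g : (Fin n → ℝ) → Matrix (Fin n) (Fin n) ℝ}
  {V : (Fin n → ℝ) → ℝ}

/-- Passing from V to V minus the conformal potential removes Δψ, so the condition becomes first
order in ψ and ξ and is visibly stable under brackets. -/
theorem IsMetricOn.kgSymmetryExpr_eq_zero_iff (hg : IsMetricOn g U) (hn : 2 ≤ n)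
    {ψ : (Fin n → ℝ) → ℝ} {ξ : (Fin n → ℝ) → (Fin n → ℝ)} {v : Fin n → SmoothFun U}
    {w p : SmoothFun U} (hV : Represents V w) (hv : ∀ k, Represents (fun x => ξ x k) (v k))
    (hp : Represents ψ p) (h : ConformalKilling partialD hg.mat v p) :
    (∀ x ∈ U, kgSymmetryExpr g V ξ ψ x = 0) ↔
      along partialD v (w - confPot partialD hg.mat hg.inv)
        + 2 * p * (w - confPot partialD hg.mat hg.inv) = 0 := by
  have hr := hg.represents_kgSymmetryExpr hV hv hp
  have e : along partialD v (w - confPot partialD hg.mat hg.inv)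
      + 2 * p * (w - confPot partialD hg.mat hg.inv) = along partialD v w + 2 * p * w
        - algebraMap ℝ _ ((2 - (n : ℝ)) / 2) * lap partialD hg.mat hg.inv p := by
    rw [map_sub]
    linear_combination
      -h.lie_confPot hn partialD_comm hg.mat_symm hg.mat_mul_inv hg.inv_mul_mat
  rw [e]
  constructor
  · exact fun h0 => SmoothFun.ext_evalAt fun x => by rw [← hr.eval x, h0 x x.2, map_zero]
  · exact fun h0 x hx => by rw [hr.eval ⟨x, hx⟩, h0, map_zero]

/-- The linear Lie point symmetries form a Lie algebra. -/
theorem lieBracket_mem_linearSymmetryAlgebra (hn : 2 ≤ n)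
    (hU : IsConnected (U : Set (Fin n → ℝ))) (hg : IsMetricOn g U) (hV : ContDiffOn ℝ ∞ V U)
    {X Y : Jet0 n → Jet0 n} (hX : X ∈ linearSymmetryAlgebra g V U)
    (hY : Y ∈ linearSymmetryAlgebra g V U) :
    VectorField.lieBracket ℝ X Y ∈ linearSymmetryAlgebra g V U := by
  obtain ⟨hX0, ξ, ψ, a₀, hξ, hk, hX1⟩ := (mem_linearSymmetryAlgebra_iff hn hU hg hV).1 hX
  obtain ⟨hY0, ζ, φ, b₀, hζ, hl, hY1⟩ := (mem_linearSymmetryAlgebra_iff hn hU hg hV).1 hY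
  obtain ⟨v, p, hv, hp⟩ := hξ.represents
  obtain ⟨w, q, hw, hq⟩ := hζ.represents
  have cv := (hg.isCKV_iff hv hp).1 hξ
  have cw := (hg.isCKV_iff hw hq).1 hζ
  have hVr := represents_toSmooth V hV
  rw [hg.kgSymmetryExpr_eq_zero_iff hn hVr hv hp cv] at hk
  rw [hg.kgSymmetryExpr_eq_zero_iff hn hVr hw hq cw] at hl
  have hc := cv.brk partialD_comm cw
  have hb : ∀ k, Represents (fun x => ∑ l, ξ x l * pd l (fun x => ζ x k) x
      - ∑ l, ζ x l * pd l (fun x => ξ x k) x) (brk partialD v w k) := fun k x => by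
    rw [← evalAt_apply, brk, map_sub, ← (represents_along (hw k) hv).eval x,
      ← (represents_along (hv k) hw).eval x]
  have hf : Represents (fun x => ∑ l, ξ x l * pd l φ x - ∑ l, ζ x l * pd l ψ x)
      (along partialD v q - along partialD w p) := fun x => by
    rw [← evalAt_apply, map_sub, ← (represents_along hq hv).eval x,
      ← (represents_along hp hw).eval x]
  -- The additive constant of the bracket is 0, since the constants a₀ and b₀ are differentiated
  -- away.
  refine (mem_linearSymmetryAlgebra_iff hn hU hg hV).2
    ⟨fun z hz => lieBracket_eq_zero (hX0 z hz) (hY0 z hz), _, _, 0,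
      (hg.isCKV_iff (ξ := fun x k => _) hb hf).2 hc,
      (hg.kgSymmetryExpr_eq_zero_iff hn hVr hb hf hc).2 (kgSymmetryExpr_brk hk hl),
      fun x hx u => ?_⟩
  rw [lieBracket_affine hξ.smooth_field hζ.smooth_field
    (contDiffOn_weight hξ.smooth_factor ((2 - (n : ℝ)) / 2) a₀)
    (contDiffOn_weight hζ.smooth_factor ((2 - (n : ℝ)) / 2) b₀)
    (contDiffOn_const (c := (0 : ℝ))) (contDiffOn_const (c := (0 : ℝ)))
    (fun x hx u => by rw [hX1 x hx u, add_zero]) (fun x hx u => by rw [hY1 x hx u, add_zero]) hx u]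
  simp only [(weight_lap hg hξ.smooth_factor _ _ hx).2, (weight_lap hg hζ.smooth_factor _ _ hx).2,
    pd_const, mul_zero, Finset.sum_const_zero, add_zero, sub_zero]
  congr 2
  rw [mul_sub, Finset.mul_sum, Finset.mul_sum]
  congr 1 <;> exact Finset.sum_congr rfl fun l _ => by ring

/-- The trivial symmetries form an ideal. -/
theorem isSolutionSymmetry_lieBracket (hn : 2 ≤ n)
    (hU : IsConnected (U : Set (Fin n → ℝ))) (hg : IsMetricOn g U) (hV : ContDiffOn ℝ ∞ V U)
    {X Z : Jet0 n → Jet0 n} (hX : X ∈ symmetryAlgebra g V U)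
    (hZ : IsSolutionSymmetry g V U Z) :
    IsSolutionSymmetry g V U (VectorField.lieBracket ℝ X Z) := by
  obtain ⟨h1, h2⟩ := hX
  obtain ⟨ξ, ψ, a₀, b, hξ, hb, hk, hX⟩ := (isLiePointSymmetry_iff hn hU hg hV).1 h1
  obtain ⟨d, hd, rfl⟩ := hZ
  obtain ⟨v, p, hv, hp⟩ := hξ.represents
  have hc := (hg.isCKV_iff hv hp).1 hξ
  have hVr := represents_toSmooth V hV
  have hdr := represents_toSmooth d hd.1
  set e := toSmooth d hd.1
  have hr : Represents (fun x => ∑ l, ξ x l * pd l d x - ((2 - (n : ℝ)) / 2 * ψ x + a₀) * d x)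
      (along partialD v e - algebraMap ℝ _ ((2 - (n : ℝ)) / 2) * p * e
        - algebraMap ℝ _ a₀ * e) := fun x => by
    rw [← evalAt_apply]
    simp only [map_sub, map_mul, AlgHom.commutes, ← (represents_along hdr hv).eval x,
      ← hp.eval x, ← hdr.eval x, Algebra.algebraMap_self, RingHom.id_apply]
    ring
  have he : lap partialD hg.mat hg.inv e = toSmooth V hV * e := SmoothFun.ext_evalAt fun x => by
    rw [map_mul, ← hVr.eval x, ← hdr.eval x, ← (hg.represents_laplacian hdr).eval x]
    exact hd.2 x x.2
  have hk' : along partialD v (toSmooth V hV) + 2 * p * toSmooth V hV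
      - algebraMap ℝ _ ((2 - (n : ℝ)) / 2) * lap partialD hg.mat hg.inv p = 0 :=
    SmoothFun.ext_evalAt fun x => by
      rw [← (hg.represents_kgSymmetryExpr hVr hv hp).eval x, hk x x.2, map_zero]
  refine ⟨_, ⟨hr.smooth, fun x hx => ?_⟩, funext fun z => ?_⟩
  · rw [(hg.represents_laplacian hr).eval ⟨x, hx⟩, hVr.eval ⟨x, hx⟩, hr.eval ⟨x, hx⟩, ← map_mul]
    congr 1
    rw [lap_sub, lap_const_mul, hc.lap_twisted partialD_comm hg.mat_symm hg.mat_mul_inv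
      hg.inv_mul_mat, he, Derivation.leibniz, smul_eq_mul, smul_eq_mul]
    -- What remains after the twisted commutator is d times the symmetry expression of ξ, which
    -- vanishes.
    linear_combination e * hk'
  · by_cases hz : z.1 ∈ U
    · rw [verticalField, if_pos hz, ← Prod.mk.eta (p := z), lieBracket_affine hξ.smooth_field
        (contDiffOn_const (c := (0 : Fin n → ℝ)))
        (contDiffOn_weight hξ.smooth_factor ((2 - (n : ℝ)) / 2) a₀)
        (contDiffOn_const (c := (0 : ℝ))) hb.1 hd.1
        (fun x hx u => by rw [hX x hx u]; congr 1; ring)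
        (fun x hx u => by rw [verticalField, if_pos hx, zero_mul, zero_add]) hz]
      refine Prod.ext (funext fun k => ?_) ?_
      · simp [pd_const]
      · simp [pd_const]
    · rw [lieBracket_eq_zero (h2 z hz) (if_neg hz), verticalField, if_neg hz]

end BracketsOfSymmetries

/-! ### Laplace equation versus conformal Laplace equation. -/

section LaplaceEquation

variable {n : ℕ} {U : Opens (Fin n → ℝ)} {g : (Fin n → ℝ) → Matrix (Fin n) (Fin n) ℝ}

theorem IsMetricOn.contDiffOn_potential (hg : IsMetricOn g U) {V Vbar : (Fin n → ℝ) → ℝ}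
    (hVbar : ContDiffOn ℝ ∞ Vbar U)
    (hV : ∀ x ∈ U, V x = -(((n : ℝ) - 2) / (4 * ((n : ℝ) - 1))) * ricciScalar g x + Vbar x) :
    ContDiffOn ℝ ∞ V U :=
  (hg.represents_confPot.smooth.add hVbar).congr hV

theorem kgSymmetryExpr_zero (ξ : (Fin n → ℝ) → (Fin n → ℝ)) (ψ : (Fin n → ℝ) → ℝ)
    (x : Fin n → ℝ) :
    kgSymmetryExpr g (fun _ => 0) ξ ψ x = -((2 - (n : ℝ)) / 2 * laplacian g ψ x) := by
  simp [kgSymmetryExpr, pd_const]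

/-- A vector field is in the linear symmetry algebra of the conformal Laplace equation if and only if
it comes from a conformal Killing vector. -/
theorem mem_linearSymmetryAlgebra_conformal_iff (hn : 2 ≤ n)
    (hU : IsConnected (U : Set (Fin n → ℝ))) (hg : IsMetricOn g U) {X : Jet0 n → Jet0 n} :
    X ∈ linearSymmetryAlgebra g (conformalPotential g) U ↔
      (∀ w : Jet0 n, w.1 ∉ U → X w = 0) ∧
      ∃ (ξ : (Fin n → ℝ) → (Fin n → ℝ)) (ψ : (Fin n → ℝ) → ℝ) (a₀ : ℝ), IsCKV g U ξ ψ ∧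
        ∀ x ∈ U, ∀ u : ℝ, X (x, u) = (ξ x, ((2 - (n : ℝ)) / 2 * ψ x + a₀) * u) := by
  rw [mem_linearSymmetryAlgebra_iff hn hU hg hg.represents_confPot.smooth]
  refine and_congr_right fun _ => ⟨?_, ?_⟩
  · rintro ⟨ξ, ψ, a₀, h, _, hX⟩
    exact ⟨ξ, ψ, a₀, h, hX⟩
  · rintro ⟨ξ, ψ, a₀, h, hX⟩
    refine ⟨ξ, ψ, a₀, h, fun x hx => ?_, hX⟩
    -- The remainder of the potential is 0, so the symmetry condition holds for every conformal
    -- Killing vector.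
    rw [hg.kgSymmetryExpr_eq hn (V := conformalPotential g) (Vbar := fun _ => 0) contDiffOn_const
      (fun x _ => (add_zero _).symm) h hx]
    simp [pd_const]

theorem linearSymmetryAlgebra_laplace_le (hn : 2 ≤ n)
    (hU : IsConnected (U : Set (Fin n → ℝ))) (hg : IsMetricOn g U) :
    linearSymmetryAlgebra g (fun _ => 0) U
      ≤ linearSymmetryAlgebra g (conformalPotential g) U := fun X hX => by
  obtain ⟨h0, ξ, ψ, a₀, h, _, h1⟩ :=
    (mem_linearSymmetryAlgebra_iff hn hU hg contDiffOn_const).1 hX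
  exact (mem_linearSymmetryAlgebra_conformal_iff hn hU hg).2 ⟨h0, ξ, ψ, a₀, h, h1⟩

theorem linearSymmetryAlgebra_laplace_eq (hn : 2 ≤ n)
    (hU : IsConnected (U : Set (Fin n → ℝ))) (hg : IsMetricOn g U)
    (h : ∀ ξ ψ, IsCKV g U ξ ψ → ∀ x ∈ U, laplacian g ψ x = 0) :
    linearSymmetryAlgebra g (fun _ => 0) U = linearSymmetryAlgebra g (conformalPotential g) U := by
  refine le_antisymm (linearSymmetryAlgebra_laplace_le hn hU hg) fun X hX => ?_
  obtain ⟨h0, ξ, ψ, a₀, hc, h1⟩ := (mem_linearSymmetryAlgebra_conformal_iff hn hU hg).1 hX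
  refine (mem_linearSymmetryAlgebra_iff hn hU hg contDiffOn_const).2
    ⟨h0, ξ, ψ, a₀, hc, fun x hx => ?_, h1⟩
  rw [kgSymmetryExpr_zero, h ξ ψ hc x hx, mul_zero, neg_zero]

/-- The factor of an improper conformal Killing vector is harmonic. -/
theorem IsCKV.laplacian_eq_zero (hg : IsMetricOn g U) {ξ : (Fin n → ℝ) → (Fin n → ℝ)}
    {ψ : (Fin n → ℝ) → ℝ} (h : IsCKV g U ξ ψ) (hp : ¬ IsProperCKV g U ξ ψ) {x : Fin n → ℝ}
    (hx : x ∈ U) : laplacian g ψ x = 0 := by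
  have hr := represents_toSmooth ψ h.smooth_factor
  rw [(hg.represents_laplacian hr).eval ⟨x, hx⟩, ← map_zero (evalAt ⟨x, hx⟩)]
  congr 1
  have h3 : (∀ x ∈ U, ψ x = 0) ∨ (∀ x ∈ U, ∀ i, pd i ψ x = 0) ∨
      ∀ x ∈ U, ∀ i j, hessian g ψ i j x = 0 := by
    unfold IsProperCKV at hp
    tauto
  rcases h3 with h0 | h0 | h0
  · have : toSmooth ψ h.smooth_factor = 0 :=
      SmoothFun.ext_evalAt fun x => by rw [← hr.eval x, h0 x x.2, map_zero]
    simp [this, lap]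
  · have : ∀ i, partialD i (toSmooth ψ h.smooth_factor) = 0 := fun i =>
      SmoothFun.ext_evalAt fun x => by rw [← (hr.pd i).eval x, h0 x x.2 i, map_zero]
    simp [this, lap]
  · have : ∀ i j, covHess partialD hg.mat hg.inv (toSmooth ψ h.smooth_factor) i j = 0 :=
      fun i j => SmoothFun.ext_evalAt fun x => by
        rw [← (hg.represents_hessian hr i j).eval x, h0 x x.2 i j, map_zero]
    rw [← frob_covHess]
    simp [frob, this]

end LaplaceEquation

/-! ### Coordinate frames and the conformal Killing equation in them. -/

section Frame

variable {n : ℕ} {A : Type*} [CommRing A] [Algebra ℝ A] {D : Fin n → Derivation ℝ A A}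

/-- The Jacobian matrix of the functions `y`. -/
def jacobian (D : Fin n → Derivation ℝ A A) (y : Fin n → A) : Matrix (Fin n) (Fin n) A :=
  of fun a i => D i (y a)

/-- The derivations given by the columns of a matrix. -/
noncomputable def frame (D : Fin n → Derivation ℝ A A) (E : Matrix (Fin n) (Fin n) A) (a : Fin n) :
    Derivation ℝ A A := along D fun i => E i a

variable {y : Fin n → A} {E : Matrix (Fin n) (Fin n) A}

theorem frame_coord (hJE : jacobian D y * E = 1) (a b : Fin n) :
    frame D E a (y b) = if a = b then 1 else 0 := by
  have h := congrFun (congrFun hJE b) a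
  rw [one_apply, mul_apply] at h
  rw [frame, along_apply]
  simp only [eq_comm (a := a)]
  rw [← h]
  exact Finset.sum_congr rfl fun k _ => mul_comm _ _

/-- The chain rule ∂_i = (∂y^a/∂x^i) ∂/∂y^a, with E the inverse Jacobian. -/
theorem derivation_eq_frame (hEJ : E * jacobian D y = 1) (i : Fin n) (x : A) :
    D i x = ∑ a, D i (y a) * frame D E a x := by
  simp only [frame, along_apply, Finset.mul_sum]
  rw [Finset.sum_comm]
  have h : ∀ k, ∑ a, D i (y a) * (E k a * D k x) = (if k = i then 1 else 0) * D k x := fun k => by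
    rw [← one_apply, ← hEJ, mul_apply, Finset.sum_mul]
    exact Finset.sum_congr rfl fun a _ => by rw [jacobian, of_apply]; ring
  simp [h]

theorem along_eq_frame (hEJ : E * jacobian D y = 1) (ξ : Fin n → A) (x : A) :
    along D ξ x = ∑ a, along D ξ (y a) * frame D E a x := by
  rw [along_apply]
  simp only [derivation_eq_frame hEJ _ x, Finset.mul_sum, along_apply D ξ (y _), Finset.sum_mul]
  rw [Finset.sum_comm]
  exact Finset.sum_congr rfl fun a _ => Finset.sum_congr rfl fun i _ => by ring

theorem eq_zero_of_along_coord (hEJ : E * jacobian D y = 1) {ξ : Fin n → A}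
    (h : ∀ a, along D ξ (y a) = 0) : ξ = 0 := by
  have e : jacobian D y *ᵥ ξ = 0 := funext fun a => by
    refine Eq.trans ?_ (h a)
    rw [along_apply, mulVec, dotProduct]
    exact Finset.sum_congr rfl fun i _ => mul_comm _ _
  rw [← one_mulVec ξ, ← hEJ, ← mulVec_mulVec, e, mulVec_zero]

theorem along_mulVec_coord (hJE : jacobian D y * E = 1) (f : Fin n → A) (a : Fin n) :
    along D (E *ᵥ f) (y a) = f a := by
  have e : along D (E *ᵥ f) (y a) = (jacobian D y *ᵥ (E *ᵥ f)) a := by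
    rw [along_apply, mulVec, dotProduct]
    exact Finset.sum_congr rfl fun i _ => mul_comm _ _
  rw [e, mulVec_mulVec, hJE, one_mulVec]

/-- The bracket of two frame fields kills every coordinate function, and a vector field with this
property is zero. -/
theorem frame_comm (hD : ∀ i j a, D i (D j a) = D j (D i a)) (hJE : jacobian D y * E = 1)
    (hEJ : E * jacobian D y = 1) (a b : Fin n) (x : A) :
    frame D E a (frame D E b x) = frame D E b (frame D E a x) := by
  have hk : ∀ a b c, frame D E a (frame D E b (y c)) = 0 := fun a b c => by
    rw [frame_coord hJE]
    split_ifs <;> simp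
  have h : brk D (fun i => E i a) (fun i => E i b) = 0 := eq_zero_of_along_coord hEJ fun c => by
    rw [along_brk hD]
    exact (congrArg₂ _ (hk a b c) (hk b a c)).trans (sub_zero 0)
  have := along_brk hD (fun i => E i a) (fun i => E i b) x
  rw [h, along_apply] at this
  simp only [Pi.zero_apply, zero_mul, Finset.sum_const_zero] at this
  exact (sub_eq_zero.1 this.symm)

/-- The conformal Killing equation in conformally flat coordinates. -/
theorem conformalKilling_iff_frame (hD : ∀ i j a, D i (D j a) = D j (D i a))
    (hJE : jacobian D y * E = 1) (hEJ : E * jacobian D y = 1) {g : Matrix (Fin n) (Fin n) A}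
    {N M : A} {ε : Fin n → ℝ} (hNM : N * M = 1)
    (hg : g = (N ^ 2) • ((jacobian D y)ᵀ * diagonal (fun a => algebraMap ℝ A (ε a))
      * jacobian D y)) {ξ : Fin n → A} {ψ : A} :
    ConformalKilling D g ξ ψ ↔ ∀ a b, frame D E a (algebraMap ℝ A (ε b) * along D ξ (y b))
      + frame D E b (algebraMap ℝ A (ε a) * along D ξ (y a))
      = if a = b then 2 * (ψ - along D ξ N * M) * algebraMap ℝ A (ε a) else 0 := by
  set J := jacobian D y with hJ
  set η : Matrix (Fin n) (Fin n) A := diagonal (fun a => algebraMap ℝ A (ε a)) with hη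
  set G : Matrix (Fin n) (Fin n) A := of fun a b => frame D E b (along D ξ (y a)) with hG
  -- Differentiating ξ(y^a) by the product rule and by the chain rule relates the Jacobian of ξ to
  -- its frame derivatives G.
  have hF : J.map (along D ξ) + J * jac D ξ = G * J := by
    ext a i
    rw [Matrix.add_apply, Matrix.map_apply, mul_apply, mul_apply]
    have := derivation_along hD ξ i (y a)
    have h2 := derivation_eq_frame hEJ i (along D ξ (y a))
    simp only [hJ, jacobian, of_apply, hG, jac_apply]
    rw [h2] at this
    simp only [mul_comm (frame D E _ _)]
    rw [this]
    congr 1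
    exact Finset.sum_congr rfl fun k _ => mul_comm _ _
  have hη0 : η.map (along D ξ) = 0 := by
    ext a b
    rw [Matrix.map_apply, hη, diagonal_apply]
    split_ifs <;> simp
  have hJξ : J.map (along D ξ) = G * J - J * jac D ξ := by rw [← hF]; abel
  have e : g.map (along D ξ) + (jac D ξ)ᵀ * g + g * jac D ξ
      = Jᵀ * ((2 * N * along D ξ N) • η + (N ^ 2) • (Gᵀ * η + η * G)) * J := by
    rw [hg, map_derivation_smul, map_derivation_mul, map_derivation_mul, hη0, transpose_map, hJξ]
    have : along D ξ (N ^ 2) = 2 * N * along D ξ N := by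
      rw [pow_two, Derivation.leibniz]; simp only [smul_eq_mul]; ring
    rw [this]
    simp only [transpose_sub, transpose_mul, mul_add, add_mul, sub_mul, mul_sub, smul_add,
      smul_sub, mul_smul_comm, smul_mul_assoc, Matrix.mul_assoc, mul_zero, zero_mul, smul_zero]
    abel
  have e2 : (2 * ψ) • g = Jᵀ * ((2 * ψ * N ^ 2) • η) * J := by
    rw [hg, smul_smul, mul_smul_comm, smul_mul_assoc]
  -- The change of frame is a congruence by the invertible J, so it may be cancelled.
  have hcancel : ∀ X Y : Matrix (Fin n) (Fin n) A, Jᵀ * X * J = Jᵀ * Y * J ↔ X = Y := by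
    refine fun X Y => ⟨fun h => ?_, fun h => by rw [h]⟩
    have h1 : Eᵀ * Jᵀ = 1 := by rw [← transpose_mul, hJE, transpose_one]
    have h2 : ∀ X, Eᵀ * (Jᵀ * X * J) * E = X := fun X => by
      calc Eᵀ * (Jᵀ * X * J) * E = (Eᵀ * Jᵀ) * X * (J * E) := by simp only [Matrix.mul_assoc]
        _ = X := by rw [h1, hJE, Matrix.one_mul, Matrix.mul_one]
    rw [← h2 X, h, h2 Y]
  unfold ConformalKilling
  rw [e, e2, hcancel, ← Matrix.ext_iff]
  refine forall_congr' fun a => forall_congr' fun b => ?_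
  have e3 : (Gᵀ * η + η * G) a b = frame D E a (algebraMap ℝ A (ε b) * along D ξ (y b))
      + frame D E b (algebraMap ℝ A (ε a) * along D ξ (y a)) := by
    simp only [Matrix.add_apply, hη, mul_diagonal, diagonal_mul, transpose_apply, hG, of_apply,
      Derivation.leibniz, Derivation.map_algebraMap, smul_eq_mul]
    ring
  rw [← e3, Matrix.add_apply, Matrix.smul_apply, Matrix.smul_apply, Matrix.smul_apply]
  generalize Gᵀ * η + η * G = K
  simp only [smul_eq_mul, hη, diagonal_apply]
  split_ifs with hab
  · subst hab
    constructor
    · intro h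
      linear_combination M ^ 2 * h - (2 * M * along D ξ N * algebraMap ℝ A (ε a)
        + K a a * (N * M + 1) - 2 * ψ * algebraMap ℝ A (ε a) * (N * M + 1)) * hNM
    · intro h
      linear_combination N ^ 2 * h - 2 * along D ξ N * algebraMap ℝ A (ε a) * N * hNM
  · constructor
    · intro h
      linear_combination M ^ 2 * h - (N * M + 1) * K a b * hNM
    · intro h
      linear_combination N ^ 2 * h

end Frame

/-! ### Liouville's theorem for flat metrics. -/

section Liouville

variable {n : ℕ} {A : Type*} [CommRing A] [Algebra ℝ A] {P : Fin n → Derivation ℝ A A}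
  {ε : Fin n → ℝ}

/-- The conformal Killing equation of a constant diagonal metric for the covariant components. -/
def FlatConformalKilling (P : Fin n → Derivation ℝ A A) (ε : Fin n → ℝ) (h : Fin n → A) (φ : A) :
    Prop :=
  ∀ a b, P a (h b) + P b (h a) = if a = b then 2 * φ * algebraMap ℝ A (ε a) else 0

theorem derivation_diagonal (d : Derivation ℝ A A) (a b : Fin n) (φ : A) :
    d (if a = b then 2 * φ * algebraMap ℝ A (ε a) else 0)
      = 2 * d φ * (if a = b then algebraMap ℝ A (ε a) else 0) := by
  have two : d (2 : A) = 0 := by simpa using d.map_natCast 2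
  split_ifs
  · simp [two]; ring
  · simp

/-- The cyclic combination of the differentiated equations, as in the Koszul formula: second
derivatives of h are determined by first derivatives of the factor. -/
theorem FlatConformalKilling.second_derivative (hP : ∀ a b x, P a (P b x) = P b (P a x))
    {h : Fin n → A} {φ : A} (H : FlatConformalKilling P ε h φ) (a b c : Fin n) :
    P a (P b (h c)) = P a φ * (if b = c then algebraMap ℝ A (ε b) else 0)
      + P b φ * (if a = c then algebraMap ℝ A (ε a) else 0)
      - P c φ * (if a = b then algebraMap ℝ A (ε a) else 0) := by
  have key : ∀ a b c, P a (P b (h c)) + P a (P c (h b))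
      = 2 * P a φ * (if b = c then algebraMap ℝ A (ε b) else 0) := fun a b c => by
    rw [← map_add, H, derivation_diagonal]
  have h1 := key a b c
  have h2 := key b a c
  have h3 := key c a b
  rw [hP a c] at h1
  rw [hP b a, hP b c] at h2
  refine two_mul_cancel ?_
  linear_combination h1 + h2 - h3

/-- The factor of a conformal Killing vector of a flat metric is affine. -/
theorem FlatConformalKilling.factor_affine (hn : 3 ≤ n) (hε : ∀ a, ε a = 1 ∨ ε a = -1)
    (hP : ∀ a b x, P a (P b x) = P b (P a x)) {h : Fin n → A} {φ : A}
    (H : FlatConformalKilling P ε h φ) (a d : Fin n) : P a (P d φ) = 0 := by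
  have hη : ∀ a, algebraMap ℝ A (ε a) * algebraMap ℝ A (ε a) = 1 := fun a => by
    rw [← map_mul]
    rcases hε a with h | h <;> simp [h]
  -- Integrability: the third derivatives of h_b in directions a, b, d are computed in two orders.
  have key : ∀ a b d, a ≠ b → d ≠ b → P d (P a φ) * algebraMap ℝ A (ε b)
      = -(P b (P b φ) * (if a = d then algebraMap ℝ A (ε a) else 0)) := by
    intro a b d hab hdb
    have dz : ∀ (c : Fin n) (i j : Fin n),
        P c (if i = j then algebraMap ℝ A (ε i) else 0) = 0 := fun c i j => by
      split_ifs <;> simp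
    have e1 := congrArg (P d) (H.second_derivative hP a b b)
    have e2 := congrArg (P b) (H.second_derivative hP a d b)
    rw [hP b a, hP b d] at e2
    simp only [map_add, map_sub, Derivation.leibniz, dz, smul_eq_mul, mul_zero, zero_add, if_true,
      if_neg hab, if_neg hdb, Derivation.map_algebraMap, map_zero] at e1 e2
    have e3 : P d (P a (P b (h b))) = P a (P d (P b (h b))) := hP _ _ _
    linear_combination e2 - e1 + e3
  have third : ∃ b, a ≠ b ∧ d ≠ b := by
    by_contra! hc
    have : (Finset.univ : Finset (Fin n)) ⊆ {a, d} := fun b _ => by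
      by_cases hb : a = b
      · simp [hb]
      · simp [hc b hb]
    have := (Finset.card_le_card this).trans Finset.card_le_two
    rw [Finset.card_univ, Fintype.card_fin] at this
    omega
  obtain ⟨b, hab, hdb⟩ := third
  by_cases had : a = d
  · subst had
    have fourth : ∃ c, a ≠ c ∧ b ≠ c := by
      by_contra! hc
      have : (Finset.univ : Finset (Fin n)) ⊆ {a, b} := fun c _ => by
        by_cases hb : a = c
        · simp [hb]
        · simp [hc c hb]
      have := (Finset.card_le_card this).trans Finset.card_le_two
      rw [Finset.card_univ, Fintype.card_fin] at this
      omega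
    -- With three distinct indices, the numbers F_a = ε_a P_a P_a φ satisfy F_a = -F_b, F_a = -F_c
    -- and F_b = -F_c, hence vanish.
    obtain ⟨c, hac, hbc⟩ := fourth
    have h1 := key a b a hab hab
    have h2 := key a c a hac hac
    have h3 := key b c b hbc hbc
    rw [if_pos rfl] at h1 h2 h3
    refine two_mul_cancel ?_
    have u := hη a
    have v := hη b
    have w := hη c
    set ηa := algebraMap ℝ A (ε a)
    set ηb := algebraMap ℝ A (ε b)
    set ηc := algebraMap ℝ A (ε c)
    linear_combination ηb * h1 + ηc * h2 - ηa * ηb * ηc * h3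
      - P a (P a φ) * (v + w) + P c (P c φ) * ηc * ηa * v
      + P b (P b φ) * ηa * ηb * w
  · have h1 := key d b a hdb hab
    rw [if_neg (Ne.symm had), mul_zero, neg_zero] at h1
    linear_combination algebraMap ℝ A (ε b) * h1 - P a (P d φ) * hη b

/-- The conformal Killing vector, in covariant components, with the given parameters. -/
noncomputable def liouville (ε : Fin n → ℝ) (y : Fin n → A) (p : Fin n → ℝ)
    (w : Fin n → Fin n → ℝ) (l : ℝ) (β : Fin n → ℝ) (c : Fin n) : A :=
  algebraMap ℝ A (p c) + ∑ b, algebraMap ℝ A (w b c) * y b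
    + (algebraMap ℝ A l + ∑ a, algebraMap ℝ A (β a) * y a) * (algebraMap ℝ A (ε c) * y c)
    - algebraMap ℝ A (1 / 2 * β c) * ∑ a, algebraMap ℝ A (ε a) * (y a * y a)

theorem derivation_affine {y : Fin n → A} (hy : ∀ a b, P a (y b) = if a = b then 1 else 0)
    (l : ℝ) (β : Fin n → ℝ) (a : Fin n) :
    P a (algebraMap ℝ A l + ∑ a, algebraMap ℝ A (β a) * y a) = algebraMap ℝ A (β a) := by
  simp [hy]

theorem derivation_liouville {y : Fin n → A} (hy : ∀ a b, P a (y b) = if a = b then 1 else 0)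
    (p : Fin n → ℝ) (w : Fin n → Fin n → ℝ) (l : ℝ) (β : Fin n → ℝ) (b c : Fin n) :
    P b (liouville ε y p w l β c) = algebraMap ℝ A (w b c)
      + algebraMap ℝ A (β b) * (algebraMap ℝ A (ε c) * y c)
      - algebraMap ℝ A (β c) * (algebraMap ℝ A (ε b) * y b)
      + (algebraMap ℝ A l + ∑ a, algebraMap ℝ A (β a) * y a)
        * (if b = c then algebraMap ℝ A (ε b) else 0) := by
  have h1 : P b (∑ a, algebraMap ℝ A (w a c) * y a) = algebraMap ℝ A (w b c) := by simp [hy]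
  have h2 : P b (∑ a, algebraMap ℝ A (ε a) * (y a * y a)) = algebraMap ℝ A (ε b) * (2 * y b) := by
    simp [hy, mul_add, mul_ite, Finset.sum_add_distrib]; ring
  have h3 : algebraMap ℝ A (1 / 2 * β c) * 2 = algebraMap ℝ A (β c) := by
    rw [show (2 : A) = algebraMap ℝ A 2 from (map_ofNat _ 2).symm, ← map_mul]
    congr 1; ring
  have h4 : algebraMap ℝ A (ε c) * (if b = c then 1 else 0)
      = if b = c then algebraMap ℝ A (ε b) else 0 := by
    split_ifs with h
    · rw [h, mul_one]
    · rw [mul_zero]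
  simp only [liouville, map_sub, map_add (P b) (_ + _) (_ * _),
    map_add (P b) (algebraMap ℝ A (p c)), Derivation.leibniz, h1, h2,
    derivation_affine hy, Derivation.map_algebraMap, hy, smul_eq_mul]
  linear_combination -algebraMap ℝ A (ε b) * y b * h3
    + (algebraMap ℝ A l + ∑ a, algebraMap ℝ A (β a) * y a) * h4

theorem flatConformalKilling_liouville {y : Fin n → A}
    (hy : ∀ a b, P a (y b) = if a = b then 1 else 0)
    (p : Fin n → ℝ) {w : Fin n → Fin n → ℝ} (hw : ∀ a b, w a b = -w b a) (l : ℝ) (β : Fin n → ℝ) :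
    FlatConformalKilling P ε (liouville ε y p w l β)
      (algebraMap ℝ A l + ∑ a, algebraMap ℝ A (β a) * y a) := fun a b => by
  rw [derivation_liouville hy, derivation_liouville hy, hw a b, map_neg]
  by_cases h : a = b
  · subst h; simp; ring
  · rw [if_neg h, if_neg h, if_neg (Ne.symm h)]; ring

/-- Liouville's theorem: the conformal Killing vectors of a flat metric. -/
theorem FlatConformalKilling.exists_liouville (hn : 3 ≤ n) (hε : ∀ a, ε a = 1 ∨ ε a = -1)
    (hP : ∀ a b x, P a (P b x) = P b (P a x)) {y : Fin n → A}
    (hy : ∀ a b, P a (y b) = if a = b then 1 else 0) (hinj : Function.Injective (algebraMap ℝ A))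
    (hconst : ∀ x : A, (∀ a, P a x = 0) → ∃ r, x = algebraMap ℝ A r) {h : Fin n → A} {φ : A}
    (H : FlatConformalKilling P ε h φ) : ∃ (p : Fin n → ℝ) (w : Fin n → Fin n → ℝ) (l : ℝ)
      (β : Fin n → ℝ), (∀ a b, w a b = -w b a) ∧ h = liouville ε y p w l β ∧
        φ = algebraMap ℝ A l + ∑ a, algebraMap ℝ A (β a) * y a := by
  choose β hβ using fun d => hconst (P d φ) fun a => H.factor_affine hn hε hP a d
  obtain ⟨l, hl⟩ := hconst (φ - ∑ a, algebraMap ℝ A (β a) * y a) fun a => by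
    rw [map_sub, hβ]; simp [hy]
  have hφ : φ = algebraMap ℝ A l + ∑ a, algebraMap ℝ A (β a) * y a := by rw [← hl]; ring
  have Hq := flatConformalKilling_liouville (P := P) (ε := ε) hy 0 (w := 0) (by simp) l β
  rw [← hφ] at Hq
  -- A particular solution with the same factor; then h - q has vanishing second derivatives, hence
  -- is affine, and has skew linear part because the two factors cancel.
  set q := liouville ε y 0 0 l β with hq
  choose w hw using fun b c => hconst (P b (h c - q c)) fun a => by
    rw [map_sub, map_sub, H.second_derivative hP, Hq.second_derivative hP, sub_self]
  choose p hp using fun c => hconst (h c - q c - ∑ b, algebraMap ℝ A (w b c) * y b) fun a => by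
    rw [map_sub, hw]; simp [hy]
  refine ⟨p, w, l, β, fun a b => hinj ?_, funext fun c => ?_, hφ⟩
  · rw [map_neg, ← hw, ← hw, map_sub, map_sub]
    linear_combination H a b - Hq a b
  · have e : liouville ε y p w l β c
        = algebraMap ℝ A (p c) + ∑ b, algebraMap ℝ A (w b c) * y b + q c := by
      simp only [hq, liouville, Pi.zero_apply, map_zero, zero_mul, Finset.sum_const_zero]
      ring
    rw [e, ← hp]; ring

/-- The parameters of a flat conformal Killing vector are unique. -/
theorem liouville_eq_zero [Nontrivial A] {y : Fin n → A}
    (hn : 0 < n) (hε : ∀ a, ε a = 1 ∨ ε a = -1)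
    (hy : ∀ a b, P a (y b) = if a = b then 1 else 0) {p : Fin n → ℝ} {w : Fin n → Fin n → ℝ}
    (hw : ∀ a b, w a b = -w b a) {l : ℝ} {β : Fin n → ℝ} (h : liouville ε y p w l β = 0) :
    p = 0 ∧ w = 0 ∧ l = 0 ∧ β = 0 := by
  have hinj := (algebraMap ℝ A).injective
  have hφ : algebraMap ℝ A l + ∑ a, algebraMap ℝ A (β a) * y a = 0 := by
    -- A diagonal entry of the equation recovers the factor; β, l, w and p are then read off by
    -- successive differentiation.
    have := flatConformalKilling_liouville (P := P) (ε := ε) hy p hw l β ⟨0, hn⟩ ⟨0, hn⟩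
    rw [h, Pi.zero_apply, map_zero, add_zero, if_pos rfl] at this
    have hη : algebraMap ℝ A (ε ⟨0, hn⟩) * algebraMap ℝ A (ε ⟨0, hn⟩) = 1 := by
      rw [← map_mul]
      rcases hε ⟨0, hn⟩ with h | h <;> simp [h]
    refine two_mul_cancel ?_
    linear_combination -algebraMap ℝ A (ε ⟨0, hn⟩) * this
      - 2 * (algebraMap ℝ A l + ∑ a, algebraMap ℝ A (β a) * y a) * hη
  have hβ : β = 0 := funext fun a => hinj <| by
    rw [← derivation_affine hy l β a, hφ, map_zero, Pi.zero_apply, map_zero]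
  subst hβ
  have hl : l = 0 := hinj <| by simpa using hφ
  subst hl
  have hw0 : w = 0 := funext fun b => funext fun c => hinj <| by
    have := derivation_liouville (P := P) (ε := ε) hy p w 0 0 b c
    rw [h] at this
    simpa using this.symm
  subst hw0
  exact ⟨funext fun c => hinj <| by simpa [liouville] using congrFun h c, rfl, rfl, rfl⟩

end Liouville

/-! ### Symmetries and a solution in conformally flat coordinates. -/

section ConformallyFlat

variable {n : ℕ} {A : Type*} [CommRing A] [Algebra ℝ A] {D : Fin n → Derivation ℝ A A}
  {y : Fin n → A} {E g H : Matrix (Fin n) (Fin n) A} {N M : A} {ε : Fin n → ℝ}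

theorem algebraMap_sign_mul_self (hε : ∀ a, ε a = 1 ∨ ε a = -1) (a : Fin n) :
    algebraMap ℝ A (ε a) * algebraMap ℝ A (ε a) = 1 := by
  rw [← map_mul]
  rcases hε a with h | h <;> simp [h]

/-- In conformally flat coordinates, conformal Killing vectors correspond to those of the flat
metric. -/
theorem conformalKilling_mulVec_iff (hD : ∀ i j a, D i (D j a) = D j (D i a))
    (hJE : jacobian D y * E = 1) (hEJ : E * jacobian D y = 1) (hNM : N * M = 1)
    (hg : g = (N ^ 2) • ((jacobian D y)ᵀ * diagonal (fun a => algebraMap ℝ A (ε a))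
      * jacobian D y)) (hε : ∀ a, ε a = 1 ∨ ε a = -1) {h : Fin n → A} {φ : A} :
    ConformalKilling D g (E *ᵥ fun a => algebraMap ℝ A (ε a) * h a)
      (φ + along D (E *ᵥ fun a => algebraMap ℝ A (ε a) * h a) N * M)
      ↔ FlatConformalKilling (frame D E) ε h φ := by
  rw [conformalKilling_iff_frame hD hJE hEJ hNM hg]
  simp only [along_mulVec_coord hJE, ← mul_assoc, algebraMap_sign_mul_self hε, one_mul,
    add_sub_cancel_right]
  rfl

/-- ∂/∂y^a is Killing for the flat metric, so its factor is just the logarithmic derivative of N. -/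
theorem conformalKilling_translation (hD : ∀ i j a, D i (D j a) = D j (D i a))
    (hJE : jacobian D y * E = 1) (hEJ : E * jacobian D y = 1) (hNM : N * M = 1)
    (hg : g = (N ^ 2) • ((jacobian D y)ᵀ * diagonal (fun a => algebraMap ℝ A (ε a))
      * jacobian D y)) (a : Fin n) :
    ConformalKilling D g (fun i => E i a) (frame D E a N * M) := by
  rw [conformalKilling_iff_frame hD hJE hEJ hNM hg]
  intro b c
  have h : ∀ b, along D (fun i => E i a) (y b) = if a = b then 1 else 0 := frame_coord hJE a
  have h' : ∀ b c, frame D E b (algebraMap ℝ A (ε c) * along D (fun i => E i a) (y c)) = 0 :=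
    fun b c => by
      rw [h]
      split_ifs <;> simp
  rw [h', h', frame, sub_self]
  simp

theorem along_mulVec_eq_sum (hJE : jacobian D y * E = 1) (hEJ : E * jacobian D y = 1)
    (f : Fin n → A) (x : A) : along D (E *ᵥ f) x = ∑ a, f a * frame D E a x := by
  rw [along_eq_frame hEJ]
  simp only [along_mulVec_coord hJE]

/-- The Euler field has flat factor 1, to which the logarithmic derivative of N along it is added.
-/
theorem conformalKilling_dilation (hD : ∀ i j a, D i (D j a) = D j (D i a))
    (hJE : jacobian D y * E = 1) (hEJ : E * jacobian D y = 1) (hNM : N * M = 1)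
    (hg : g = (N ^ 2) • ((jacobian D y)ᵀ * diagonal (fun a => algebraMap ℝ A (ε a))
      * jacobian D y)) :
    ConformalKilling D g (E *ᵥ y) (1 + ∑ a, y a * (frame D E a N * M)) := by
  rw [conformalKilling_iff_frame hD hJE hEJ hNM hg]
  intro b c
  have hN : along D (E *ᵥ y) N * M = ∑ a, y a * (frame D E a N * M) := by
    rw [along_mulVec_eq_sum hJE hEJ, Finset.sum_mul]
    exact Finset.sum_congr rfl fun a _ => mul_assoc _ _ _
  rw [hN]
  simp only [along_mulVec_coord hJE, Derivation.leibniz, frame_coord hJE,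
    Derivation.map_algebraMap, add_sub_cancel_right, smul_eq_mul]
  by_cases h : b = c
  · subst h; simp; ring
  · simp [h, Ne.symm h]

/-- The power `N ^ ((2 - n) / 2)` of the conformal factor is a solution of the conformal Laplace
equation. -/
theorem lap_eq_confPot_mul (hn : 2 ≤ n) (hD : ∀ i j a, D i (D j a) = D j (D i a))
    (hs : gᵀ = g) (hgH : g * H = 1) (hHg : H * g = 1)
    (hJE : jacobian D y * E = 1) (hEJ : E * jacobian D y = 1) (hNM : N * M = 1)
    (hg : g = (N ^ 2) • ((jacobian D y)ᵀ * diagonal (fun a => algebraMap ℝ A (ε a))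
      * jacobian D y)) {B : A}
    (hB : ∀ a, frame D E a B = algebraMap ℝ A ((2 - n) / 2) * (frame D E a N * M) * B) :
    lap D g H B = confPot D g H * B := by
  set c := algebraMap ℝ A ((2 - n) / 2) with hc
  set f := lap D g H B - confPot D g H * B with hf
  have key : ∀ {ξ : Fin n → A} {ψ : A}, ConformalKilling D g ξ ψ →
      lap D g H (along D ξ B - c * ψ * B) = along D ξ f + 2 * ψ * f - c * ψ * f
        + confPot D g H * (along D ξ B - c * ψ * B) := fun {ξ ψ} h => by
    rw [h.lap_twisted hD hs hgH hHg, hf, map_sub, Derivation.leibniz, smul_eq_mul, smul_eq_mul]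
    linear_combination B * h.lie_confPot hn hD hs hgH hHg
  -- The hypothesis on B says that the twisted translations annihilate B, so the commutator becomes
  -- a first order equation for the defect f.
  have h1 : ∀ a, frame D E a f = (c - 2) * (frame D E a N * M) * f := fun a => by
    have := key (conformalKilling_translation hD hJE hEJ hNM hg a)
    have h0 : along D (fun i => E i a) B - c * (frame D E a N * M) * B = 0 := by
      rw [show along D (fun i => E i a) B = _ from hB a, sub_self]
    rw [h0, mul_zero, add_zero, show lap D g H 0 = 0 by simp [lap]] at this
    rw [frame] at this ⊢
    linear_combination -this
  have h2 := key (conformalKilling_dilation hD hJE hEJ hNM hg)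
  have h3 : ∀ {x r : A}, (∀ a, frame D E a x = r * (frame D E a N * M) * x) →
      along D (E *ᵥ y) x = r * (∑ a, y a * (frame D E a N * M)) * x := fun {x r} h => by
    rw [along_mulVec_eq_sum hJE hEJ, Finset.mul_sum, Finset.sum_mul]
    exact Finset.sum_congr rfl fun a _ => by rw [h]; ring
  rw [h3 hB, h3 h1] at h2
  have h4 : c * (∑ a, y a * (frame D E a N * M)) * B
      - c * (1 + ∑ a, y a * (frame D E a N * M)) * B
      = algebraMap ℝ A (-((2 - n) / 2)) * B := by rw [map_neg, ← hc]; ring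
  rw [h4, lap_const_mul, map_neg, ← hc] at h2
  -- The twisted dilation multiplies B by -c, while on f the commutator yields 2 - c; hence -c f =
  -- (2 - c) f.
  have h5 : 2 * f = 2 * 0 := by
    rw [hf] at h2 ⊢
    linear_combination -h2
  exact sub_eq_zero.1 (two_mul_cancel h5)

/-- The antisymmetric matrix with given entries below the diagonal. -/
def skew {n : ℕ} : ((Σ i : Fin n, Fin i) → ℝ) →ₗ[ℝ] (Fin n → Fin n → ℝ) where
  toFun w b c := if h : c < b then w ⟨b, ⟨c, h⟩⟩ else if h : b < c then -w ⟨c, ⟨b, h⟩⟩ else 0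
  map_add' w w' := by
    funext b c
    simp only [Pi.add_apply]
    split_ifs
    · rfl
    · ring
    · ring
  map_smul' r w := by
    funext b c
    simp only [Pi.smul_apply, smul_eq_mul, RingHom.id_apply]
    split_ifs
    · rfl
    · ring
    · ring

theorem skew_antisymm (w : (Σ i : Fin n, Fin i) → ℝ) (a b : Fin n) :
    skew w a b = -skew w b a := by
  simp only [skew, LinearMap.coe_mk, AddHom.coe_mk]
  rcases lt_trichotomy a b with h | h | h
  · simp [h, h.not_gt]
  · subst h; simp
  · simp [h, h.not_gt]

theorem exists_skew {w : Fin n → Fin n → ℝ} (hw : ∀ a b, w a b = -w b a) : ∃ w', skew w' = w := by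
  refine ⟨fun s => w s.1 ⟨s.2, s.2.2.trans s.1.2⟩, ?_⟩
  funext a b
  simp only [skew, LinearMap.coe_mk, AddHom.coe_mk]
  rcases lt_trichotomy a b with h | h | h
  · rw [dif_neg h.not_gt, dif_pos h, hw a b]
  · subst h
    have := hw a a
    simp; linarith
  · rw [dif_pos h]

theorem skew_injective : Function.Injective (skew (n := n)) := by
  refine (injective_iff_map_eq_zero _).2 fun w hw => funext fun s => ?_
  have h : (⟨s.2, s.2.2.trans s.1.2⟩ : Fin n) < s.1 := s.2.2
  have := congrFun (congrFun hw s.1) ⟨s.2, s.2.2.trans s.1.2⟩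
  simp only [skew, LinearMap.coe_mk, AddHom.coe_mk, dif_pos h] at this
  exact this

/-- The parameters of a linear symmetry: translations, rotations, the dilation, special conformal
transformations, and the multiples of `u`. -/
abbrev ConformalParameters (n : ℕ) :=
  (Fin n → ℝ) × ((Σ i : Fin n, Fin i) → ℝ) × ℝ × (Fin n → ℝ) × ℝ

/-- The count is n + n(n-1)/2 + 1 + n + 1; indexing skew matrices by their entries below the
diagonal gives the second summand. -/
theorem finrank_conformalParameters :
    Module.finrank ℝ (ConformalParameters n) = (n + 1) * (n + 2) / 2 + 1 := by
  have h : Fintype.card (Σ i : Fin n, Fin i) * 2 = n * (n - 1) := by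
    rw [Fintype.card_sigma]
    simp only [Fintype.card_fin]
    rw [Fin.sum_univ_eq_sum_range (fun i => i), Finset.sum_range_id_mul_two]
  simp only [Module.finrank_prod, Module.finrank_fintype_fun_eq_card, Module.finrank_self,
    Fintype.card_fin]
  have h2 : (n + 1) * (n + 2) = n * (n - 1) + 2 * (2 * n + 1) := by
    cases n with
    | zero => rfl
    | succ m => simp; ring
  omega

/-- The flat conformal Killing vector with given parameters, together with its factor. -/
noncomputable def flatField (ε : Fin n → ℝ) (y : Fin n → A) :
    ConformalParameters n →ₗ[ℝ] (Fin n → A) × A where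
  toFun t := (liouville ε y t.1 (skew t.2.1) t.2.2.1 t.2.2.2.1,
    algebraMap ℝ A t.2.2.1 + ∑ a, algebraMap ℝ A (t.2.2.2.1 a) * y a)
  map_add' s t := by
    refine Prod.ext (funext fun c => ?_) ?_
    · simp only [liouville, Prod.fst_add, Prod.snd_add, Pi.add_apply, map_add, add_mul, mul_add,
        Finset.sum_add_distrib]
      ring
    · simp only [Prod.fst_add, Prod.snd_add, Pi.add_apply, map_add, add_mul,
        Finset.sum_add_distrib]
      ring
  map_smul' r t := by
    have hA : ∀ x : A, r • x = algebraMap ℝ A r * x := Algebra.smul_def r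
    refine Prod.ext (funext fun c => ?_) ?_
    · simp only [liouville, Prod.smul_fst, Prod.smul_snd, Pi.smul_apply, map_smul, smul_eq_mul,
        map_mul, RingHom.id_apply, hA, mul_assoc, ← Finset.mul_sum]
      ring
    · simp only [Prod.smul_fst, Prod.smul_snd, Pi.smul_apply, smul_eq_mul,
        map_mul, RingHom.id_apply, hA, mul_assoc, ← Finset.mul_sum]
      ring

/-- The components of a vector field in the original coordinates, and the coefficient of
`u ∂_u`. -/
noncomputable def weightedField (D : Fin n → Derivation ℝ A A) (E : Matrix (Fin n) (Fin n) A)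
    (N M : A) (ε : Fin n → ℝ) : ((Fin n → A) × A) →ₗ[ℝ] (Fin n → A) × A where
  toFun q := (E *ᵥ fun a => algebraMap ℝ A (ε a) * q.1 a, algebraMap ℝ A ((2 - n) / 2)
    * (q.2 + along D (E *ᵥ fun a => algebraMap ℝ A (ε a) * q.1 a) N * M))
  map_add' p q := by
    have h : (E *ᵥ fun a => algebraMap ℝ A (ε a) * (p + q).1 a)
        = (E *ᵥ fun a => algebraMap ℝ A (ε a) * p.1 a)
          + E *ᵥ fun a => algebraMap ℝ A (ε a) * q.1 a := by
      rw [← mulVec_add]; congr 1; funext a; exact mul_add _ _ _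
    refine Prod.ext h ?_
    simp only [h, Prod.snd_add, along_apply, Pi.add_apply, add_mul, Finset.sum_add_distrib]
    ring
  map_smul' r q := by
    have h : (E *ᵥ fun a => algebraMap ℝ A (ε a) * (r • q).1 a)
        = r • (E *ᵥ fun a => algebraMap ℝ A (ε a) * q.1 a) := by
      rw [← mulVec_smul]; congr 1; funext a
      exact mul_smul_comm _ _ _
    refine Prod.ext h ?_
    simp only [h, Prod.smul_snd, along_apply, Pi.smul_apply, smul_mul_assoc, RingHom.id_apply,
      ← Finset.smul_sum, ← smul_add, mul_smul_comm]

/-- The linear symmetry with given parameters. -/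
noncomputable def symmetryField (D : Fin n → Derivation ℝ A A) (E : Matrix (Fin n) (Fin n) A)
    (N M : A) (ε : Fin n → ℝ) (y : Fin n → A) :
    ConformalParameters n →ₗ[ℝ] (Fin n → A) × A :=
  weightedField D E N M ε ∘ₗ flatField ε y
    + LinearMap.inr ℝ (Fin n → A) A ∘ₗ Algebra.linearMap ℝ A ∘ₗ LinearMap.snd ℝ _ _
      ∘ₗ LinearMap.snd ℝ _ _ ∘ₗ LinearMap.snd ℝ _ _ ∘ₗ LinearMap.snd ℝ _ _

theorem symmetryField_apply (t : ConformalParameters n) : symmetryField D E N M ε y t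
    = ((weightedField D E N M ε (flatField ε y t)).1,
      (weightedField D E N M ε (flatField ε y t)).2 + algebraMap ℝ A t.2.2.2.2) := by
  refine Prod.ext ?_ rfl
  simp [symmetryField]

/-- Applying the field to the coordinates recovers its flat components, hence the Liouville
parameters; once these vanish, only a₀ remains in the vertical coefficient. -/
theorem symmetryField_injective [Nontrivial A] (hn : 0 < n) (hε : ∀ a, ε a = 1 ∨ ε a = -1)
    (hJE : jacobian D y * E = 1) : Function.Injective (symmetryField D E N M ε y) := by
  refine (injective_iff_map_eq_zero _).2 fun t ht => ?_
  rw [symmetryField_apply] at ht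
  obtain ⟨h1, h2⟩ := Prod.mk_eq_zero.1 ht
  have h3 : liouville ε y t.1 (skew t.2.1) t.2.2.1 t.2.2.2.1 = 0 := by
    have e : (fun a => algebraMap ℝ A (ε a) * (flatField ε y t).1 a) = 0 := by
      funext a
      rw [← along_mulVec_coord hJE (fun a => algebraMap ℝ A (ε a) * (flatField ε y t).1 a)]
      rw [show E *ᵥ (fun a => algebraMap ℝ A (ε a) * (flatField ε y t).1 a) = 0 from h1,
        along_apply]
      simp
    funext a
    have := congrFun e a
    have h4 : algebraMap ℝ A (ε a) * ((algebraMap ℝ A (ε a)) * (flatField ε y t).1 a) = 0 := by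
      rw [this]; exact mul_zero _
    rwa [← mul_assoc, algebraMap_sign_mul_self hε, one_mul] at h4
  obtain ⟨hp, hw, hl, hb⟩ := liouville_eq_zero hn hε (frame_coord hJE) (skew_antisymm _) h3
  have hw' : t.2.1 = 0 := skew_injective (hw.trans (map_zero _).symm)
  have hf : flatField ε y t = 0 := by
    refine Prod.ext h3 ?_
    simp [flatField, hl, hb]
  rw [hf, map_zero, Prod.snd_zero, zero_add] at h2
  have ha : t.2.2.2.2 = 0 := (algebraMap ℝ A).injective (h2.trans (map_zero _).symm)
  exact Prod.ext hp (Prod.ext hw' (Prod.ext hl (Prod.ext hb ha)))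

/-- The conformal Killing vectors of a conformally flat metric. -/
theorem mem_range_symmetryField_iff (hn : 3 ≤ n) (hD : ∀ i j a, D i (D j a) = D j (D i a))
    (hJE : jacobian D y * E = 1) (hEJ : E * jacobian D y = 1) (hNM : N * M = 1)
    (hg : g = (N ^ 2) • ((jacobian D y)ᵀ * diagonal (fun a => algebraMap ℝ A (ε a))
      * jacobian D y)) (hε : ∀ a, ε a = 1 ∨ ε a = -1)
    (hinj : Function.Injective (algebraMap ℝ A))
    (hconst : ∀ x : A, (∀ i, D i x = 0) → ∃ r, x = algebraMap ℝ A r) {q : (Fin n → A) × A} :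
    q ∈ LinearMap.range (symmetryField D E N M ε y) ↔ ∃ (v : Fin n → A) (p : A) (a₀ : ℝ),
      ConformalKilling D g v p
        ∧ q = (v, algebraMap ℝ A ((2 - n) / 2) * p + algebraMap ℝ A a₀) := by
  have hy := frame_coord hJE
  constructor
  · rintro ⟨t, rfl⟩
    refine ⟨_, _, t.2.2.2.2, (conformalKilling_mulVec_iff hD hJE hEJ hNM hg hε).2
      (flatConformalKilling_liouville hy t.1 (skew_antisymm t.2.1) t.2.2.1 t.2.2.2.1),
      symmetryField_apply t⟩
  · rintro ⟨v, p, a₀, h, rfl⟩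
    have hv : v = E *ᵥ fun a => algebraMap ℝ A (ε a) * (algebraMap ℝ A (ε a)
        * along D v (y a)) := by
      simp only [← mul_assoc, algebraMap_sign_mul_self hε, one_mul]
      refine sub_eq_zero.1 (eq_zero_of_along_coord hEJ fun a => ?_)
      have h1 := along_mulVec_coord hJE (fun a => along D v (y a)) a
      rw [along_apply] at h1 ⊢
      simp only [Pi.sub_apply, sub_mul, Finset.sum_sub_distrib, h1]
      rw [along_apply, sub_self]
    -- The covariant frame components of v; the sign ε_a serves both to lower and to raise the
    -- index, because ε_a² = 1.
    set f : Fin n → A := fun a => algebraMap ℝ A (ε a) * along D v (y a) with hf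
    have hp : p = (p - along D v N * M)
        + along D (E *ᵥ fun a => algebraMap ℝ A (ε a) * f a) N * M := by rw [← hv]; ring
    have hc : FlatConformalKilling (frame D E) ε f (p - along D v N * M) := by
      rw [← conformalKilling_mulVec_iff hD hJE hEJ hNM hg hε, ← hp, ← hv]
      exact h
    obtain ⟨p', w, l, β, hw, h1, h2⟩ := hc.exists_liouville hn hε (frame_comm hD hJE hEJ) hy hinj
      fun x hx => hconst x fun i => by
        rw [derivation_eq_frame hEJ]
        simp [hx]
    obtain ⟨w', rfl⟩ := exists_skew hw
    refine ⟨(p', w', l, β, a₀), ?_⟩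
    have e : flatField ε y (p', w', l, β, a₀) = (f, p - along D v N * M) :=
      Prod.ext h1.symm h2.symm
    rw [symmetryField_apply, e]
    refine Prod.ext hv.symm ?_
    change algebraMap ℝ A ((2 - n) / 2) * ((p - along D v N * M)
      + along D (E *ᵥ fun a => algebraMap ℝ A (ε a) * f a) N * M) + _ = _
    rw [← hp]

end ConformallyFlat

/-! ### Dimension of the symmetry algebra. -/

section FullSymmetry

variable {n : ℕ} {U W : Opens (Fin n → ℝ)} {g : (Fin n → ℝ) → Matrix (Fin n) (Fin n) ℝ}

theorem IsMetricOn.exists_frame (hg : IsMetricOn g U) (h : HasConformallyFlatCoordinates g U) :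
    ∃ (y : Fin n → SmoothFun U) (E : Matrix (Fin n) (Fin n) (SmoothFun U)) (N M : SmoothFun U)
      (ε : Fin n → ℝ), (∀ a, ε a = 1 ∨ ε a = -1) ∧ jacobian partialD y * E = 1 ∧
      E * jacobian partialD y = 1 ∧ N * M = 1 ∧
      hg.mat = (N ^ 2) • ((jacobian partialD y)ᵀ
        * diagonal (fun a => algebraMap ℝ (SmoothFun U) (ε a)) * jacobian partialD y) := by
  obtain ⟨y, N, ε, hy, -, hdet, hN, hN0, hε, hgy⟩ := h
  have hyr : ∀ a, Represents (fun x => y x a) (toSmooth _ (contDiffOn_pi.1 hy a)) := fun a =>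
    represents_toSmooth _ _
  have hNr := represents_toSmooth N hN
  set y' := fun a => toSmooth _ (contDiffOn_pi.1 hy a)
  have hu : IsUnit (jacobian partialD y').det := SmoothFun.isUnit_of_ne_zero fun x => by
    rw [AlgHom.map_det]
    convert hdet x x.2 using 2
    ext a i
    exact (((hyr a).pd i).eval x).symm
  have hNu : IsUnit (toSmooth N hN) := SmoothFun.isUnit_of_ne_zero fun x => by
    rw [← hNr.eval x]
    exact hN0 x x.2
  obtain ⟨M, hM⟩ := hNu.exists_right_inv
  refine ⟨y', (jacobian partialD y')⁻¹, toSmooth N hN, M, ε, hε, mul_nonsing_inv _ hu,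
    nonsing_inv_mul _ hu, hM, Matrix.ext fun i j => SmoothFun.ext_evalAt fun x => ?_⟩
  rw [← (hg.represents_mat i j).eval x, hgy x x.2 i j, Matrix.smul_apply, mul_apply, smul_eq_mul,
    map_mul, map_pow, ← hNr.eval x, map_sum]
  congr 1
  refine Finset.sum_congr rfl fun a _ => ?_
  rw [mul_diagonal, transpose_apply, map_mul, map_mul, AlgHom.commutes, jacobian, of_apply,
    of_apply, ← ((hyr a).pd i).eval x, ← ((hyr a).pd j).eval x, Algebra.algebraMap_self,
    RingHom.id_apply]
  ring

/-- Real powers of the absolute value of a nowhere vanishing smooth function. -/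
theorem SmoothFun.exists_abs_rpow {N M : SmoothFun U} (hNM : N * M = 1) (c : ℝ) :
    ∃ B : SmoothFun U, (∀ x, evalAt x B ≠ 0) ∧
      ∀ i, partialD i B = algebraMap ℝ _ c * (partialD i N * M) * B := by
  have hr := represents_zeroExtend N
  have hM : ∀ x : U, zeroExtend N.1 x * evalAt x M = 1 := fun x => by
    rw [hr.eval x, ← map_mul, hNM, map_one]
  have h0 : ∀ x ∈ U, zeroExtend N.1 x ≠ 0 := fun x hx => left_ne_zero_of_mul_eq_one (hM ⟨x, hx⟩)
  -- `Real.log` is log |·|, so this is |N|^c and N may have either sign.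
  have hs : ContDiffOn ℝ ∞ (fun x => Real.exp (c * Real.log (zeroExtend N.1 x))) U :=
    (contDiffOn_const.mul (hr.smooth.log h0)).exp
  have hB := represents_toSmooth _ hs
  refine ⟨toSmooth _ hs, fun x => ?_, fun i => SmoothFun.ext_evalAt fun x => ?_⟩
  · rw [← hB.eval x]
    exact Real.exp_ne_zero _
  · have hd := (ContDiffOn.differentiableAt_opens hr.smooth x.2).hasFDerivAt
    have h1 : fderiv ℝ (fun x => Real.exp (c * Real.log (zeroExtend N.1 x))) x = _ :=
      (((hd.log (h0 x x.2)).const_mul c).exp).fderiv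
    rw [← (hB.pd i).eval x, map_mul, map_mul, map_mul, AlgHom.commutes, ← (hr.pd i).eval x,
      ← hB.eval x, eq_inv_of_mul_eq_one_right (hM x), pd, h1]
    simp only [_root_.smul_apply, smul_eq_mul, pd, Algebra.algebraMap_self, RingHom.id_apply]
    ring

theorem exists_solution (hn : 2 ≤ n) (hg : IsMetricOn g U)
    (h : HasConformallyFlatCoordinates g U) :
    ∃ b, IsSolution g (conformalPotential g) U b ∧ ∀ x ∈ U, b x ≠ 0 := by
  obtain ⟨y, E, N, M, ε, -, hJE, hEJ, hNM, hgm⟩ := hg.exists_frame h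
  obtain ⟨B, hB0, hB⟩ := SmoothFun.exists_abs_rpow hNM ((2 - (n : ℝ)) / 2)
  have hr := represents_zeroExtend B
  have key := lap_eq_confPot_mul hn partialD_comm hg.mat_symm hg.mat_mul_inv hg.inv_mul_mat hJE hEJ
    hNM hgm (B := B) fun a => by
      simp only [frame, along_apply, hB, Finset.mul_sum, Finset.sum_mul]
      exact Finset.sum_congr rfl fun i _ => by ring
  refine ⟨zeroExtend B.1, ⟨hr.smooth, fun x hx => ?_⟩, fun x hx => ?_⟩
  · rw [(hg.represents_laplacian hr).eval ⟨x, hx⟩, hg.represents_confPot.eval ⟨x, hx⟩,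
      hr.eval ⟨x, hx⟩, key, map_mul]
  · rw [hr.eval ⟨x, hx⟩]
    exact hB0 _

theorem zeroExtend_add (a b : SmoothFun U) (x : Fin n → ℝ) :
    zeroExtend (a + b).1 x = zeroExtend a.1 x + zeroExtend b.1 x := by
  by_cases hx : x ∈ U
  · simp only [zeroExtend_apply _ hx]; rfl
  · simp [zeroExtend, hx]

theorem zeroExtend_smul (r : ℝ) (a : SmoothFun U) (x : Fin n → ℝ) :
    zeroExtend (r • a).1 x = r * zeroExtend a.1 x := by
  by_cases hx : x ∈ U
  · simp only [zeroExtend_apply _ hx]; rfl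
  · simp [zeroExtend, hx]

/-- The vector field `ξ^i ∂_i + α u ∂_u` (extended by zero). -/
noncomputable def linearField (U : Opens (Fin n → ℝ)) :
    ((Fin n → SmoothFun U) × SmoothFun U) →ₗ[ℝ] (Jet0 n → Jet0 n) where
  toFun q w := (fun i => zeroExtend (q.1 i).1 w.1, zeroExtend q.2.1 w.1 * w.2)
  map_add' _ _ := funext fun w => Prod.ext (funext fun _ => zeroExtend_add _ _ _)
    ((congrArg (· * w.2) (zeroExtend_add _ _ _)).trans (add_mul _ _ _))
  map_smul' _ _ := funext fun w => Prod.ext (funext fun _ => zeroExtend_smul _ _ _)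
    ((congrArg (· * w.2) (zeroExtend_smul _ _ _)).trans (mul_assoc _ _ _))

theorem linearField_injective : Function.Injective (linearField U) := by
  refine (injective_iff_map_eq_zero _).2 fun q hq => ?_
  refine Prod.ext (funext fun i => SmoothFun.ext_evalAt fun x => ?_)
    (SmoothFun.ext_evalAt fun x => ?_)
  · rw [← (represents_zeroExtend (q.1 i)).eval x]
    exact (congrFun (congrArg Prod.fst (congrFun hq (x, 0))) i).trans (map_zero (evalAt x)).symm
  · rw [← (represents_zeroExtend q.2).eval x]
    exact (mul_one _).symm.trans
      ((congrArg Prod.snd (congrFun hq (x, 1))).trans (map_zero (evalAt x)).symm)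

theorem mem_linearSymmetryAlgebra_conformal_iff_linearField (hn : 2 ≤ n)
    (hU : IsConnected (U : Set (Fin n → ℝ))) (hg : IsMetricOn g U) {X : Jet0 n → Jet0 n} :
    X ∈ linearSymmetryAlgebra g (conformalPotential g) U ↔
      ∃ (v : Fin n → SmoothFun U) (p : SmoothFun U) (a₀ : ℝ),
        ConformalKilling partialD hg.mat v p ∧ X = linearField U
          (v, algebraMap ℝ _ ((2 - (n : ℝ)) / 2) * p + algebraMap ℝ _ a₀) := by
  rw [mem_linearSymmetryAlgebra_conformal_iff hn hU hg]
  have hw : ∀ {ψ : (Fin n → ℝ) → ℝ} {p : SmoothFun U} (a₀ : ℝ), Represents ψ p → ∀ x : U,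
      (algebraMap ℝ (SmoothFun U) ((2 - (n : ℝ)) / 2) * p + algebraMap ℝ _ a₀).1 x
        = (2 - (n : ℝ)) / 2 * ψ x + a₀ := fun a₀ hp x => by
    rw [hp.eval x, ← evalAt_apply, map_add, map_mul, AlgHom.commutes, AlgHom.commutes]
    rfl
  constructor
  · rintro ⟨h0, ξ, ψ, a₀, h, hX⟩
    obtain ⟨v, p, hv, hp⟩ := h.represents
    refine ⟨v, p, a₀, (hg.isCKV_iff hv hp).1 h, funext fun w => ?_⟩
    by_cases hx : w.1 ∈ U
    · rw [← Prod.mk.eta (p := w), hX w.1 hx]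
      refine Prod.ext (funext fun k => ?_) ?_
      · exact (hv k ⟨w.1, hx⟩).trans (zeroExtend_apply _ hx).symm
      · refine congrArg (· * w.2) ?_
        exact (hw a₀ hp ⟨w.1, hx⟩).symm.trans (zeroExtend_apply _ hx).symm
    · rw [h0 w hx]
      refine Prod.ext (funext fun k => ?_) ?_
      · simp [linearField, zeroExtend, hx]
      · simp [linearField, zeroExtend, hx]
  · rintro ⟨v, p, a₀, h, rfl⟩
    refine ⟨fun w hx => ?_, fun x k => zeroExtend (v k).1 x, zeroExtend p.1, a₀,
      (hg.isCKV_iff (fun k => represents_zeroExtend _) (represents_zeroExtend _)).2 h,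
      fun x hx u => Prod.ext rfl ?_⟩
    · refine Prod.ext (funext fun k => ?_) ?_
      · simp [linearField, zeroExtend, hx]
      · simp [linearField, zeroExtend, hx]
    · refine congrArg (· * u) ?_
      exact (zeroExtend_apply _ hx).trans (hw a₀ (represents_zeroExtend p) ⟨x, hx⟩)

/-- Linear symmetries have vanishing vertical component at u = 0 and b ∂_u does not, so the sum is
direct and the dimension grows by one. -/
theorem finrank_sup_span_verticalField {V : (Fin n → ℝ) → ℝ} {m : ℕ}
    (h : Module.finrank ℝ (linearSymmetryAlgebra g V U) = m + 1) {b : (Fin n → ℝ) → ℝ}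
    (hb : ∃ x ∈ U, b x ≠ 0) :
    Module.finrank ℝ ↥(linearSymmetryAlgebra g V U ⊔ Submodule.span ℝ {verticalField U b})
      = m + 2 := by
  obtain ⟨x, hx, hbx⟩ := hb
  have hv : verticalField U b (x, 0) = (0, b x) := if_pos hx
  have hne : verticalField U b ≠ 0 := fun h0 => hbx <| by
    rw [h0] at hv
    exact (congrArg Prod.snd hv).symm
  -- `finrank` would be 0 in infinite dimension, so a positive value gives the finiteness needed for
  -- the dimension formula.
  have hfin : Module.Finite ℝ (linearSymmetryAlgebra g V U) :=
    Module.finite_of_finrank_pos (by omega)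
  have hinf : linearSymmetryAlgebra g V U ⊓ Submodule.span ℝ {verticalField U b} = ⊥ := by
    refine (Submodule.eq_bot_iff _).2 fun X hX => ?_
    obtain ⟨⟨-, a, ha⟩, hX2⟩ := hX
    obtain ⟨r, rfl⟩ := Submodule.mem_span_singleton.1 hX2
    have := ha x hx 0
    rw [Pi.smul_apply, hv, mul_zero] at this
    have hr : r = 0 := (mul_eq_zero.1 this).resolve_right hbx
    rw [hr, zero_smul]
  have := Submodule.finrank_sup_add_finrank_inf_eq (linearSymmetryAlgebra g V U)
    (Submodule.span ℝ {verticalField U b})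
  rw [hinf, finrank_bot, h, finrank_span_singleton hne] at this
  omega

/-- The conformal Laplace equation of a metric with conformally flat coordinates has a symmetry
algebra of maximal dimension. -/
theorem hasFullConformalSymmetry (hn : 3 ≤ n) (hU : IsConnected (U : Set (Fin n → ℝ)))
    (hg : IsMetricOn g U) (h : HasConformallyFlatCoordinates g U) :
    HasFullConformalSymmetry g U := by
  obtain ⟨y, E, N, M, ε, hε, hJE, hEJ, hNM, hgm⟩ := hg.exists_frame h
  obtain ⟨x₀, hx₀⟩ := hU.nonempty
  have : Nontrivial (SmoothFun U) := (evalAt ⟨x₀, hx₀⟩).toRingHom.domain_nontrivial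
  have hrange : linearSymmetryAlgebra g (conformalPotential g) U
      = LinearMap.range (linearField U ∘ₗ symmetryField partialD E N M ε y) := by
    ext X
    rw [mem_linearSymmetryAlgebra_conformal_iff_linearField (by omega) hU hg, LinearMap.range_comp,
      Submodule.mem_map]
    simp only [mem_range_symmetryField_iff hn partialD_comm hJE hEJ hNM hgm hε
      (algebraMap ℝ (SmoothFun U)).injective fun _ => exists_eq_algebraMap hU]
    constructor
    · rintro ⟨v, p, a₀, hc, rfl⟩
      exact ⟨_, ⟨v, p, a₀, hc, rfl⟩, rfl⟩
    · rintro ⟨q, ⟨v, p, a₀, hc, rfl⟩, rfl⟩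
      exact ⟨v, p, a₀, hc, rfl⟩
  have hfr : Module.finrank ℝ (linearSymmetryAlgebra g (conformalPotential g) U)
      = (n + 1) * (n + 2) / 2 + 1 := by
    rw [hrange, LinearMap.finrank_range_of_inj, finrank_conformalParameters]
    exact linearField_injective.comp (symmetryField_injective (by omega) hε hJE)
  obtain ⟨b, hb, hb0⟩ := exists_solution (by omega) hg h
  exact ⟨hfr, ⟨b, hb, x₀, hx₀, hb0 x₀ hx₀⟩, fun b _ hb => finrank_sup_span_verticalField hfr hb⟩

theorem IsMetricOn.mono (hg : IsMetricOn g U) (h : W ≤ U) : IsMetricOn g W :=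
  ⟨fun i j => (hg.smooth i j).mono h, fun x hx => hg.symm x (h hx),
    fun x hx => hg.nondegenerate x (h hx)⟩

theorem HasConformallyFlatCoordinates.mono (hg : HasConformallyFlatCoordinates g U) (h : W ≤ U) :
    HasConformallyFlatCoordinates g W := by
  obtain ⟨y, N, ε, h1, h2, h3, h4, h5, h6, h7⟩ := hg
  exact ⟨y, N, ε, h1.mono h, h2.mono h, fun x hx => h3 x (h hx), h4.mono h,
    fun x hx => h5 x (h hx), h6, fun x hx => h7 x (h hx)⟩

theorem IsConformallyFlat.exists_hasFullConformalSymmetry (hn : 3 ≤ n) (hg : IsMetricOn g U)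
    (h : IsConformallyFlat g U) {x : Fin n → ℝ} (hx : x ∈ U) {O : Set (Fin n → ℝ)}
    (hO : O ∈ nhds x) : ∃ W : Opens (Fin n → ℝ), x ∈ W ∧ W ≤ U ∧ (W : Set (Fin n → ℝ)) ⊆ O ∧
      IsConnected (W : Set (Fin n → ℝ)) ∧ HasFullConformalSymmetry g W := by
  obtain ⟨W', hxW, hWU, hc⟩ := h x hx
  -- A ball is convex, hence connected, and coordinates and metric restrict to it.
  obtain ⟨r, hr, hrs⟩ := Metric.mem_nhds_iff.1 (Filter.inter_mem hO (W'.isOpen.mem_nhds hxW))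
  have hle : (⟨Metric.ball x r, Metric.isOpen_ball⟩ : Opens (Fin n → ℝ)) ≤ W' := fun z hz =>
    (hrs hz).2
  have hcon : IsConnected (Metric.ball x r) :=
    ⟨⟨x, Metric.mem_ball_self hr⟩, (convex_ball x r).isPreconnected⟩
  exact ⟨⟨Metric.ball x r, Metric.isOpen_ball⟩, Metric.mem_ball_self hr, hle.trans hWU,
    fun z hz => (hrs hz).1, hcon,
    hasFullConformalSymmetry hn hcon (hg.mono (hle.trans hWU)) (hc.mono hle)⟩

end FullSymmetry

end ConfKG

theorem mainTheorem5 (n : ℕ) (hn : 2 ≤ n) (U : TopologicalSpace.Opens (Fin n → ℝ))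
    (hU : IsConnected (U : Set (Fin n → ℝ)))
    (g : (Fin n → ℝ) → Matrix (Fin n) (Fin n) ℝ) (hg : ConfKG.IsMetricOn g U) :
    -- the conformal Klein-Gordon equation, with potential `V = -(n-2)/(4(n-1)) R + Vbar`
    (∀ V Vbar : (Fin n → ℝ) → ℝ, ContDiffOn ℝ ∞ Vbar U →
      (∀ x ∈ U, V x = -(((n : ℝ) - 2) / (4 * ((n : ℝ) - 1))) * ConfKG.ricciScalar g x + Vbar x) →
      -- the symmetry condition reduces to `ξ^k Vbar_{,k} + 2 ψ Vbar = 0`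
      (∀ ξ ψ, ConfKG.IsCKV g U ξ ψ → ∀ x ∈ U,
        ConfKG.kgSymmetryExpr g V ξ ψ x
          = ∑ k, ξ x k * ConfKG.pd k Vbar x + 2 * ψ x * Vbar x) ∧
      -- hence the Lie point symmetries are exactly the following vector fields
      (∀ X : ConfKG.Jet0 n → ConfKG.Jet0 n,
        ConfKG.IsLiePointSymmetry (ConfKG.kleinGordon g V) U X ↔
          ∃ (ξ : (Fin n → ℝ) → (Fin n → ℝ)) (ψ : (Fin n → ℝ) → ℝ) (a₀ : ℝ)
            (b : (Fin n → ℝ) → ℝ),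
            ConfKG.IsCKV g U ξ ψ ∧ ConfKG.IsSolution g V U b ∧
            (∀ x ∈ U, ∑ k, ξ x k * ConfKG.pd k Vbar x + 2 * ψ x * Vbar x = 0) ∧
            ∀ x ∈ U, ∀ u : ℝ,
              X (x, u) = (ξ x, (2 - (n : ℝ)) / 2 * ψ x * u + a₀ * u + b x)) ∧
      -- they are the sum of the linear ones, which form a Lie algebra, and of the trivial ones
      -- `b ∂_u`, which form an ideal
      (∀ X, X ∈ ConfKG.symmetryAlgebra g V U ↔
        ∃ Y ∈ ConfKG.linearSymmetryAlgebra g V U, ∃ Z, ConfKG.IsSolutionSymmetry g V U Z ∧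
          X = Y + Z) ∧
      (∀ X ∈ ConfKG.linearSymmetryAlgebra g V U, ∀ Y ∈ ConfKG.linearSymmetryAlgebra g V U,
        VectorField.lieBracket ℝ X Y ∈ ConfKG.linearSymmetryAlgebra g V U) ∧
      (∀ X ∈ ConfKG.symmetryAlgebra g V U, ∀ Z, ConfKG.IsSolutionSymmetry g V U Z →
        ConfKG.IsSolutionSymmetry g V U (VectorField.lieBracket ℝ X Z))) ∧
    -- the symmetries of the Laplace equation are symmetries of the conformal Laplace equation
    ConfKG.linearSymmetryAlgebra g (fun _ => 0) U
      ≤ ConfKG.linearSymmetryAlgebra g (ConfKG.conformalPotential g) U ∧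
    ((∀ ξ ψ, ConfKG.IsCKV g U ξ ψ → ¬ ConfKG.IsProperCKV g U ξ ψ) →
      ConfKG.linearSymmetryAlgebra g (fun _ => 0) U
        = ConfKG.linearSymmetryAlgebra g (ConfKG.conformalPotential g) U) ∧
    ((∀ ξ ψ, ConfKG.IsCKV g U ξ ψ → ∀ x ∈ U, ConfKG.laplacian g ψ x = 0) →
      ConfKG.linearSymmetryAlgebra g (fun _ => 0) U
        = ConfKG.linearSymmetryAlgebra g (ConfKG.conformalPotential g) U) ∧
    -- conformally flat spaces
    (3 ≤ n →
      (ConfKG.HasConformallyFlatCoordinates g U → ConfKG.HasFullConformalSymmetry g U) ∧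
      (ConfKG.IsConformallyFlat g U → ∀ x ∈ U, ∀ O ∈ nhds x,
        ∃ W : TopologicalSpace.Opens (Fin n → ℝ), x ∈ W ∧ W ≤ U ∧
          (W : Set (Fin n → ℝ)) ⊆ O ∧ IsConnected (W : Set (Fin n → ℝ)) ∧
          ConfKG.HasFullConformalSymmetry g W)) := by
  refine ⟨fun V Vbar hVbar hV => ?_, ConfKG.linearSymmetryAlgebra_laplace_le hn hU hg,
    fun h => ConfKG.linearSymmetryAlgebra_laplace_eq hn hU hg fun ξ ψ hc _ hx =>
      hc.laplacian_eq_zero hg (h ξ ψ hc) hx,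
    ConfKG.linearSymmetryAlgebra_laplace_eq hn hU hg,
    fun hn3 => ⟨ConfKG.hasFullConformalSymmetry hn3 hU hg,
      fun hf _ hx _ hO => hf.exists_hasFullConformalSymmetry hn3 hg hx hO⟩⟩
  have hVs := hg.contDiffOn_potential hVbar hV
  refine ⟨fun ξ ψ h x hx => hg.kgSymmetryExpr_eq hn hVbar hV h hx, fun X => ?_,
    fun X => ConfKG.mem_symmetryAlgebra_iff hn hU hg hVs,
    fun X hX Y hY => ConfKG.lieBracket_mem_linearSymmetryAlgebra hn hU hg hVs hX hY,
    fun X hX Z hZ => ConfKG.isSolutionSymmetry_lieBracket hn hU hg hVs hX hZ⟩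
  rw [ConfKG.isLiePointSymmetry_iff hn hU hg hVs]
  -- The general classification is in terms of `kgSymmetryExpr`; only this clause changes, and the
  -- reduction applies because ξ is already known to be conformal Killing.
  refine exists_congr fun ξ => exists_congr fun ψ => exists_congr fun a₀ => exists_congr fun b =>
    and_congr_right fun hξ => and_congr_right fun _ => and_congr_left fun _ =>
      forall₂_congr fun x hx => ?_
  rw [hg.kgSymmetryExpr_eq hn hVbar hV hξ hx]
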